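/- Let $u^\infty(y)=\tfrac12(1-y^2)_+$. By a global smooth solution we mean contact points $\lambda_\pm:[0,\infty)\to\mathbb R$ with $\lambda_-(t)<\lambda_+(t)$, continuous on $[0,\infty)$ and $C^\infty$ on $(0,\infty)$, and a function $u(t,x)$, defined for $t\ge 0$ and $\lambda_-(t)\le x\le\lambda_+(t)$, such that $u$ is $C^\infty$ up to the contact points for $t>0$; $u(0,\cdot)$ is $C^2$ on $[\lambda_-(0),\lambda_+(0)]$ and $u,u_x,u_{xx}$ are continuous up to $t=0$ and up to the contact points; $u>0$ for $t\ge0$, $\lambda_-(t)<x<\lambda_+(t)$; and $$u_t+(u\,u_{xxx})_x=0\quad (t>0,\ \lambda_-(t)<x<\lambda_+(t)),$$ $$u(t,\lambda_\pm(t))=0,\qquad |u_x(t,\lambda_\pm(t))|=1\qquad (t\ge 0),$$ $$\lim_{x\to\lambda_\pm(t)}u_{xxx}(t,x)=\dot\lambda_\pm(t)\qquad (t>0).$$ If such a solution has initial mass $\int_{\lambda_-(0)}^{\lambda_+(0)}u(0,x)\,dx=\tfrac23$ (the mass is then conserved), define for $t\ge0$ and $y\in[-1,1]$ the point $Z(t,y)\in[\lambda_-(t),\lambda_+(t)]$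 by $$\int_{\lambda_-(t)}^{Z(t,y)}u(t,x)\,dx=\tfrac12\int_{-1}^y(1-s^2)\,ds,$$ and put $\tilde u(t,y)=u(t,Z(t,y))$ and $$E(t)=\frac12\int_{-1}^1\Big|\partial_y\Big(\frac{\tilde u(t,y)}{u^\infty(y)}\Big)\Big|^2dy .$$ **Corollary 1.4.** There are absolute constants $c_0>0$, $\gamma>0$, $C>0$ and $T\ge0$ such that for every global smooth solution with $$\int_{\lambda_-(0)}^{\lambda_+(0)}u(0,x)\,dx=\tfrac23,\qquad \int_{\lambda_-(0)}^{\lambda_+(0)}x\,u(0,x)\,dx=0,\qquad E(0)<c_0,$$ one has $E(t)\le E(0)e^{-\gamma t}$ for all $t\ge0$ and, with the same $\gamma$, for all $t\ge T$, $$|\lambda_+(t)-\lambda_-(t)-2|\le C e^{-\frac{\gamma}{2}t},\qquad |\lambda_+(t)+\lambda_-(t)|\le C e^{-\frac{\gamma}{2}t},$$ and in particular $$|\lambda_+(t)-1|+|\lambda_-(t)+1|\le C e^{-\frac{\gamma}{2}t}.$$ -/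

import Mathlib

open Set Filter Topology MeasureTheory
open scoped ContDiff

noncomputable section

namespace ThinFilm

/-- The `k`-th spatial derivative `∂ₓᵏ u (t, x)` of a function which is only meaningful for
`x ∈ [lm t, lp t]`; at the two end points it is the one-sided derivative. -/
def dx (u : ℝ → ℝ → ℝ) (lm lp : ℝ → ℝ) (k : ℕ) (t x : ℝ) : ℝ :=
  iteratedDerivWithin k (u t) (Icc (lm t) (lp t)) x

/-- Global smooth solution `u` (`u t x` is the film height) of the thin-film equation with linear
mobility and partial wetting, with contact points `lm t < lp t`, `t ≥ 0`. Only the values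
`u t x` with `t ≥ 0` and `lm t ≤ x ≤ lp t` are relevant.

For positive times everything is smooth up to the contact points. At the initial time one only asks
that the initial datum be `C²` and that it be attained in the `C²` sense, so that solutions that
are smooth up to `t = 0` are included, without any compatibility condition of higher order
being imposed on the initial datum. -/
structure IsGlobalSmoothSolution (u : ℝ → ℝ → ℝ) (lm lp : ℝ → ℝ) : Prop where
  lt : ∀ t, 0 ≤ t → lm t < lp t
  lm_continuousOn : ContinuousOn lm (Ici 0)
  lp_continuousOn : ContinuousOn lp (Ici 0)
  lm_smooth : ContDiffOn ℝ ∞ lm (Ioi 0)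
  lp_smooth : ContDiffOn ℝ ∞ lp (Ioi 0)
  /-- smoothness, up to the contact points, for positive times -/
  smooth : ContDiffOn ℝ ∞ (fun p : ℝ × ℝ => u p.1 p.2)
    {p : ℝ × ℝ | 0 < p.1 ∧ p.2 ∈ Icc (lm p.1) (lp p.1)}
  /-- the initial datum is twice continuously differentiable up to the contact points -/
  initial_smooth : ContDiffOn ℝ 2 (u 0) (Icc (lm 0) (lp 0))
  /-- `u`, `uₓ`, `uₓₓ` are continuous up to the initial time and up to the contact points -/
  dx_continuousOn : ∀ k ≤ 2, ContinuousOn (fun p : ℝ × ℝ => dx u lm lp k p.1 p.2)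
    {p : ℝ × ℝ | 0 ≤ p.1 ∧ p.2 ∈ Icc (lm p.1) (lp p.1)}
  pos : ∀ t, 0 ≤ t → ∀ x ∈ Ioo (lm t) (lp t), 0 < u t x
  /-- the equation `u_t + (u u_xxx)_x = 0` -/
  eqn : ∀ t, 0 < t → ∀ x ∈ Ioo (lm t) (lp t),
    deriv (fun s => u s x) t + deriv (fun z => u t z * iteratedDeriv 3 (u t) z) x = 0
  /-- the film height vanishes at the contact points -/
  left_zero : ∀ t, 0 ≤ t → u t (lm t) = 0
  right_zero : ∀ t, 0 ≤ t → u t (lp t) = 0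
  /-- contact angle condition `|u_x| = 1` at the contact points -/
  left_angle : ∀ t, 0 ≤ t → |dx u lm lp 1 t (lm t)| = 1
  right_angle : ∀ t, 0 ≤ t → |dx u lm lp 1 t (lp t)| = 1
  /-- `u_xxx` tends to the velocity of the contact point at each contact point -/
  left_velocity : ∀ t, 0 < t →
    Tendsto (iteratedDeriv 3 (u t)) (𝓝[Ioo (lm t) (lp t)] (lm t)) (𝓝 (deriv lm t))
  right_velocity : ∀ t, 0 < t →
    Tendsto (iteratedDeriv 3 (u t)) (𝓝[Ioo (lm t) (lp t)] (lp t)) (𝓝 (deriv lp t))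

/-- The mass at time `t`. -/
def mass (u : ℝ → ℝ → ℝ) (lm lp : ℝ → ℝ) (t : ℝ) : ℝ :=
  ∫ x in (lm t)..(lp t), u t x

/-- The center of mass (not divided by the mass) at time `t`. -/
def centerOfMass (u : ℝ → ℝ → ℝ) (lm lp : ℝ → ℝ) (t : ℝ) : ℝ :=
  ∫ x in (lm t)..(lp t), x * u t x

/-- The stationary solution `u^∞(x) = (1 - x²)₊ / 2`. -/
def uInf (x : ℝ) : ℝ := (1 / 2) * max (1 - x ^ 2) 0

/-- The mass Lagrangian variable: `Z(t, y)` is the point `x ∈ [lm t, lp t]` with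
`∫_{lm t}^x u(t, z) dz = (1/2) ∫_{-1}^y (1 - s²) ds`. For `u(t, ·)` continuous on `[lm t, lp t]`,
positive in the interior and of mass `2/3` there is exactly one such `x` for each `y ∈ [-1, 1]`. -/
def Z (u : ℝ → ℝ → ℝ) (lm lp : ℝ → ℝ) (t y : ℝ) : ℝ :=
  Function.invFunOn (fun x => ∫ z in (lm t)..x, u t z) (Icc (lm t) (lp t))
    ((1 / 2) * ∫ s in (-1 : ℝ)..y, (1 - s ^ 2))

/-- The height in Lagrangian coordinates, `ũ(t, y) = u(t, Z(t, y))`. -/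
def uTilde (u : ℝ → ℝ → ℝ) (lm lp : ℝ → ℝ) (t y : ℝ) : ℝ := u t (Z u lm lp t y)

/-- The energy `E(t) = (1/2) ∫_{-1}^1 |∂_y (ũ(t, y) / u^∞(y))|² dy`. -/
def energy (u : ℝ → ℝ → ℝ) (lm lp : ℝ → ℝ) (t : ℝ) : ℝ :=
  (1 / 2) * ∫ y in (-1 : ℝ)..1, |deriv (fun z => uTilde u lm lp t z / uInf z) y| ^ 2

end ThinFilm

end

/-! Write w = ũ/u^∞ for the relative height. In the mass variable Z_y = 1/w, hence ∂_x = w ∂_y, and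
Z_t = u_xxx, so the transport term drops out and w_t = -w u_xxxx. Since u = `par` · w, every
x-derivative of u is a differential expression in w, and the contact angle condition becomes w → 1
at y = ±1. For E = ½ ∫ w_y² one finds E' = ∫ w_yy w u_xxxx. The boundary terms vanish because
differentiating u_x = ±1 along a contact point, with u_xxx equal to its speed, forces u_xxxx = 0
there (`dx_four_left`, `dx_four_right`).

Coercivity. Further integration by parts, with boundary terms of favourable sign, bounds E' by the
integral of `remainder` (`Profile.integral_dissipation_le`). Its quadratic part at w = 1 is -8 w_yy²
- `par` w_yyy²; everything else is of higher order in w - 1 and its derivatives. If ∫ w_y² ≤ 10⁻⁶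
these terms are absorbed (`Profile.integral_remainder_le`). As w_y vanishes somewhere by Rolle, a
Poincaré inequality then gives E' ≤ -E/8. A barrier argument preserves the smallness of E
(`energy_lt`), and a Gronwall argument gives the decay (`energy_le_exp`).

Regularity. The computation needs w with bounded derivatives up to y = ±1, where w is a quotient of
two vanishing functions. The identity (`par`² w²)' = 2 `par` · u_x∘Z removes the quotient: near an
end point w² is a smooth factor times a weighted average of u_x∘Z, and weighted averages preserve
derivatives. Since u_x∘Z is one derivative smoother than w, a bootstrap gives all orders at positive
times (`bddDeriv_relHeight`). The quantitative form of the same identity gives bounds uniform down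
to t = 0, hence continuity of E there.

Contact points. Small E makes Z_y = 1/w close to 1, so Z is nearly a translation and the length is
nearly 2. The first moment is conserved because u u_xxx is an exact derivative whose boundary values
cancel; this fixes the translation (`abs_contact_le`). -/

noncomputable section

namespace ThinFilm

/-! ### Bounded continuous functions on an open interval -/

/-- `f` is continuous and bounded on `I`. -/
def BddCont (f : ℝ → ℝ) (I : Set ℝ) : Prop :=
  ContinuousOn f I ∧ ∃ C, ∀ y ∈ I, |f y| ≤ C

namespace BddCont

variable {f g : ℝ → ℝ} {I J : Set ℝ} {a b : ℝ}

theorem mono (hf : BddCont f I) (h : J ⊆ I) : BddCont f J :=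
  ⟨hf.1.mono h, hf.2.imp fun _ hC y hy => hC y (h hy)⟩

theorem add (hf : BddCont f I) (hg : BddCont g I) : BddCont (fun y => f y + g y) I := by
  obtain ⟨hf, C, hC⟩ := hf
  obtain ⟨hg, K, hK⟩ := hg
  exact ⟨hf.add hg, C + K, fun y hy => (abs_add_le _ _).trans (add_le_add (hC y hy) (hK y hy))⟩

theorem neg (hf : BddCont f I) : BddCont (fun y => -f y) I := by
  obtain ⟨hf, C, hC⟩ := hf
  exact ⟨hf.neg, C, fun y hy => by rw [abs_neg]; exact hC y hy⟩

theorem sub (hf : BddCont f I) (hg : BddCont g I) : BddCont (fun y => f y - g y) I := by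
  simpa only [sub_eq_add_neg] using hf.add hg.neg

theorem mul (hf : BddCont f I) (hg : BddCont g I) : BddCont (fun y => f y * g y) I := by
  obtain ⟨hf, C, hC⟩ := hf
  obtain ⟨hg, K, hK⟩ := hg
  refine ⟨hf.mul hg, C * K, fun y hy => ?_⟩
  rw [abs_mul]
  exact mul_le_mul (hC y hy) (hK y hy) (abs_nonneg _) ((abs_nonneg _).trans (hC y hy))

theorem const (c : ℝ) : BddCont (fun _ => c) I :=
  ⟨continuousOn_const, |c|, fun _ _ => le_rfl⟩

theorem pow (hf : BddCont f I) (n : ℕ) : BddCont (fun y => f y ^ n) I := by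
  obtain ⟨hf, C, hC⟩ := hf
  refine ⟨hf.pow n, C ^ n, fun y hy => ?_⟩
  rw [abs_pow]
  exact pow_le_pow_left₀ (abs_nonneg _) (hC y hy) n

theorem abs (hf : BddCont f I) : BddCont (fun y => |f y|) I := by
  obtain ⟨hf, C, hC⟩ := hf
  exact ⟨hf.abs, C, fun y hy => by rw [abs_abs]; exact hC y hy⟩

theorem of_continuous (hf : Continuous f) : BddCont f (Ioo a b) := by
  obtain ⟨C, hC⟩ := isCompact_Icc.exists_bound_of_continuousOn (s := Icc a b) hf.continuousOn
  exact ⟨hf.continuousOn, C, fun y hy => hC y (Ioo_subset_Icc_self hy)⟩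

theorem congr (hf : BddCont f I) (h : EqOn g f I) : BddCont g I := by
  obtain ⟨hf, C, hC⟩ := hf
  exact ⟨hf.congr h, C, fun y hy => by rw [h hy]; exact hC y hy⟩

theorem intervalIntegrable (hf : BddCont f (Ioo a b)) (hab : a ≤ b) :
    IntervalIntegrable f volume a b := by
  obtain ⟨hf, C, hC⟩ := hf
  rw [intervalIntegrable_iff_integrableOn_Ioo_of_le hab]
  refine Integrable.of_bound (C := C) (hf.aestronglyMeasurable measurableSet_Ioo) ?_
  filter_upwards [ae_restrict_mem measurableSet_Ioo] with y hy
  exact hC y hy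

end BddCont

theorem integral_mono_Ioo {f g : ℝ → ℝ} {a b : ℝ} (hab : a ≤ b) (hf : BddCont f (Ioo a b))
    (hg : BddCont g (Ioo a b)) (h : ∀ y ∈ Ioo a b, f y ≤ g y) :
    ∫ y in a..b, f y ≤ ∫ y in a..b, g y :=
  intervalIntegral.integral_mono_on_of_le_Ioo hab (hf.intervalIntegrable hab)
    (hg.intervalIntegrable hab) h

theorem integral_nonneg_Ioo {f : ℝ → ℝ} {a b : ℝ} (hab : a ≤ b) (hf : BddCont f (Ioo a b))
    (h : ∀ y ∈ Ioo a b, 0 ≤ f y) : 0 ≤ ∫ y in a..b, f y := by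
  simpa using integral_mono_Ioo hab (BddCont.const 0) hf h

/-- Cauchy-Schwarz inequality for bounded continuous functions. -/
theorem sq_integral_mul_le {f g : ℝ → ℝ} {a b : ℝ} (hab : a ≤ b) (hf : BddCont f (Ioo a b))
    (hg : BddCont g (Ioo a b)) :
    (∫ y in a..b, f y * g y) ^ 2 ≤ (∫ y in a..b, f y ^ 2) * ∫ y in a..b, g y ^ 2 := by
  -- The quadratic polynomial x ↦ ∫ (x f + g)² is nonnegative, so its discriminant is nonpositive.
  have key : ∀ x : ℝ, 0 ≤ (∫ y in a..b, f y ^ 2) * (x * x) +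
      (2 * ∫ y in a..b, f y * g y) * x + ∫ y in a..b, g y ^ 2 := by
    intro x
    have h1 : 0 ≤ ∫ y in a..b, (x * x * f y ^ 2 + 2 * x * (f y * g y) + g y ^ 2) := by
      refine integral_nonneg_Ioo hab ((((BddCont.const _).mul (hf.pow 2)).add
        ((BddCont.const _).mul (hf.mul hg))).add (hg.pow 2)) fun y _ => ?_
      nlinarith [sq_nonneg (x * f y + g y)]
    rw [intervalIntegral.integral_add, intervalIntegral.integral_add,
      intervalIntegral.integral_const_mul, intervalIntegral.integral_const_mul] at h1
    · linarith
    · exact ((BddCont.const _).mul (hf.pow 2)).intervalIntegrable hab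
    · exact ((BddCont.const _).mul (hf.mul hg)).intervalIntegrable hab
    · exact (((BddCont.const _).mul (hf.pow 2)).add
        ((BddCont.const _).mul (hf.mul hg))).intervalIntegrable hab
    · exact (hg.pow 2).intervalIntegrable hab
  have := discrim_le_zero key
  rw [discrim] at this
  nlinarith

/-- A function with bounded derivative on an interval, with a one-sided limit at the left end. -/
theorem integral_eq_sub_of_tendsto_left {f f' : ℝ → ℝ} {a b c la : ℝ}
    (hd : ∀ y ∈ Ioo a b, HasDerivAt f (f' y) y) (hf' : BddCont f' (Ioo a b))
    (ha : Tendsto f (𝓝[>] a) (𝓝 la)) (hc : c ∈ Ioo a b) :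
    ∫ y in a..c, f' y = f c - la :=
  intervalIntegral.integral_eq_sub_of_hasDerivAt_of_tendsto hc.1
    (fun y hy => hd y ⟨hy.1, hy.2.trans hc.2⟩)
    ((hf'.mono (Ioo_subset_Ioo_right hc.2.le)).intervalIntegrable hc.1.le) ha
    ((hd c hc).continuousAt.tendsto.mono_left nhdsWithin_le_nhds)

theorem integral_eq_sub_of_tendsto_right {f f' : ℝ → ℝ} {a b c lb : ℝ}
    (hd : ∀ y ∈ Ioo a b, HasDerivAt f (f' y) y) (hf' : BddCont f' (Ioo a b))
    (hb : Tendsto f (𝓝[<] b) (𝓝 lb)) (hc : c ∈ Ioo a b) :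
    ∫ y in c..b, f' y = lb - f c :=
  intervalIntegral.integral_eq_sub_of_hasDerivAt_of_tendsto hc.2
    (fun y hy => hd y ⟨hc.1.trans hy.1, hy.2⟩)
    ((hf'.mono (Ioo_subset_Ioo_left hc.1.le)).intervalIntegrable hc.2.le)
    ((hd c hc).continuousAt.tendsto.mono_left nhdsWithin_le_nhds) hb

theorem integral_eq_sub_of_mem_Ioo {f f' : ℝ → ℝ} {a b c d : ℝ}
    (hd : ∀ y ∈ Ioo a b, HasDerivAt f (f' y) y) (hf' : BddCont f' (Ioo a b))
    (hc : c ∈ Ioo a b) (hd' : d ∈ Ioo a b) :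
    ∫ y in c..d, f' y = f d - f c := by
  have hsub : uIcc c d ⊆ Ioo a b := ordConnected_Ioo.uIcc_subset hc hd'
  refine intervalIntegral.integral_eq_sub_of_hasDerivAt (fun y hy => hd y (hsub hy)) ?_
  exact (hf'.1.mono hsub).intervalIntegrable

/-- For nonnegative integrands the integral over a subinterval is at most the full one. -/
theorem abs_integral_le_of_mem {f : ℝ → ℝ} {a b c d : ℝ} (hf : BddCont f (Ioo a b)) (hab : a ≤ b)
    (hc : c ∈ Icc a b) (hd : d ∈ Icc a b) :
    |∫ y in c..d, f y| ≤ ∫ y in a..b, |f y| := by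
  have key : ∀ {c d : ℝ}, c ∈ Icc a b → d ∈ Icc a b → c ≤ d →
      |∫ y in c..d, f y| ≤ ∫ y in a..b, |f y| := by
    intro c d hc hd hcd
    refine (intervalIntegral.abs_integral_le_integral_abs hcd).trans ?_
    refine intervalIntegral.integral_mono_interval hc.1 hcd hd.2 ?_
      (hf.abs.intervalIntegrable hab)
    exact Eventually.of_forall fun y => abs_nonneg _
  rcases le_total c d with h | h
  · exact key hc hd h
  · rw [intervalIntegral.integral_symm, abs_neg]
    exact key hd hc h

/-! ### The dissipation estimate at a fixed time -/

/-- `w` together with derivatives `w1`, `w2`, `w3` on `(-1, 1)` which are bounded; `w` tends to `1`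
at the end points. -/
structure Profile (w w1 w2 w3 : ℝ → ℝ) : Prop where
  d0 : ∀ y ∈ Ioo (-1 : ℝ) 1, HasDerivAt w (w1 y) y
  d1 : ∀ y ∈ Ioo (-1 : ℝ) 1, HasDerivAt w1 (w2 y) y
  d2 : ∀ y ∈ Ioo (-1 : ℝ) 1, HasDerivAt w2 (w3 y) y
  b1 : BddCont w1 (Ioo (-1) 1)
  b2 : BddCont w2 (Ioo (-1) 1)
  b3 : BddCont w3 (Ioo (-1) 1)
  left : Tendsto w (𝓝[>] (-1)) (𝓝 1)
  right : Tendsto w (𝓝[<] 1) (𝓝 1)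

/-- The parabola `(1 - y²) / 2`. -/
def par (y : ℝ) : ℝ := (1 - y ^ 2) / 2

theorem continuous_par : Continuous par := by unfold par; fun_prop

theorem par_pos {y : ℝ} (hy : y ∈ Ioo (-1 : ℝ) 1) : 0 < par y := by
  have h1 := hy.1; have h2 := hy.2
  unfold par; nlinarith

theorem par_le (y : ℝ) : par y ≤ 1 / 2 := by unfold par; nlinarith [sq_nonneg y]

theorem hasDerivAt_par (y : ℝ) : HasDerivAt par (-y) y := by
  unfold par
  refine ((((hasDerivAt_id' y).fun_pow 2).const_sub 1).div_const 2).congr_deriv ?_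
  norm_num; ring

theorem bddCont_par : BddCont par (Ioo (-1) 1) := .of_continuous continuous_par

namespace Profile

variable {w w1 w2 w3 : ℝ → ℝ}

/-- Cauchy–Schwarz from the nearer end point, where w - 1 vanishes; the distance to it is at most (1
- y)(1 + y) = 2 `par y`. The factor `par y` is essential later, since w3² is only controlled with
that weight. -/
theorem sq_sub_one_le (h : Profile w w1 w2 w3) {y : ℝ} (hy : y ∈ Ioo (-1 : ℝ) 1) :
    (w y - 1) ^ 2 ≤ 2 * par y * ∫ s in (-1 : ℝ)..1, w1 s ^ 2 := by
  have hI : IntervalIntegrable (fun s => w1 s ^ 2) volume (-1) 1 :=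
    (h.b1.pow 2).intervalIntegrable (by norm_num)
  have hm0 : 0 ≤ ∫ s in (-1 : ℝ)..1, w1 s ^ 2 :=
    integral_nonneg_Ioo (by norm_num) (h.b1.pow 2) fun _ _ => sq_nonneg _
  have h1 := hy.1; have h2 := hy.2
  rcases le_total y 0 with h0 | h0
  · have e := integral_eq_sub_of_tendsto_left h.d0 h.b1 h.left hy
    have cs := sq_integral_mul_le h1.le (f := fun _ => 1) (g := w1) (BddCont.const 1)
      (h.b1.mono (Ioo_subset_Ioo_right h2.le))
    have mono : ∫ s in (-1 : ℝ)..y, w1 s ^ 2 ≤ ∫ s in (-1 : ℝ)..1, w1 s ^ 2 :=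
      intervalIntegral.integral_mono_interval le_rfl h1.le h2.le
        (Eventually.of_forall fun _ => sq_nonneg _) hI
    simp only [one_mul, one_pow, intervalIntegral.integral_const, smul_eq_mul, mul_one] at cs
    rw [e] at cs
    have : (y - -1) ≤ 2 * par y := by unfold par; nlinarith
    calc _ ≤ _ := cs
      _ ≤ (y - -1) * ∫ s in (-1 : ℝ)..1, w1 s ^ 2 :=
        mul_le_mul_of_nonneg_left mono (by linarith)
      _ ≤ _ := mul_le_mul_of_nonneg_right this hm0
  · have e := integral_eq_sub_of_tendsto_right h.d0 h.b1 h.right hy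
    have cs := sq_integral_mul_le h2.le (f := fun _ => 1) (g := w1) (BddCont.const 1)
      (h.b1.mono (Ioo_subset_Ioo_left h1.le))
    have mono : ∫ s in y..1, w1 s ^ 2 ≤ ∫ s in (-1 : ℝ)..1, w1 s ^ 2 :=
      intervalIntegral.integral_mono_interval h1.le h2.le le_rfl
        (Eventually.of_forall fun _ => sq_nonneg _) hI
    simp only [one_mul, one_pow, intervalIntegral.integral_const, smul_eq_mul, mul_one] at cs
    rw [e] at cs
    have : (1 - y) ≤ 2 * par y := by unfold par; nlinarith
    calc (w y - 1) ^ 2 = (1 - w y) ^ 2 := by ring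
      _ ≤ _ := cs
      _ ≤ (1 - y) * ∫ s in (-1 : ℝ)..1, w1 s ^ 2 :=
        mul_le_mul_of_nonneg_left mono (by linarith)
      _ ≤ _ := mul_le_mul_of_nonneg_right this hm0

theorem exists_zero (h : Profile w w1 w2 w3) : ∃ c ∈ Ioo (-1 : ℝ) 1, w1 c = 0 :=
  exists_hasDerivAt_eq_zero' (by norm_num) h.left h.right h.d0

/-- Integrate (w1²)' = 2 w1 w2 from a zero of w1, which exists by Rolle. Together with
Cauchy–Schwarz this is an interpolation estimate: sup w1² is small when ∫ w1² is small, relative to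
the square root of ∫ w2². -/
theorem sq_le_integral_abs (h : Profile w w1 w2 w3) {y : ℝ} (hy : y ∈ Ioo (-1 : ℝ) 1) :
    w1 y ^ 2 ≤ 2 * ∫ s in (-1 : ℝ)..1, |w1 s * w2 s| := by
  obtain ⟨c, hc, h0⟩ := h.exists_zero
  have hd : ∀ z ∈ Ioo (-1 : ℝ) 1, HasDerivAt (fun z => w1 z ^ 2) (2 * (w1 z * w2 z)) z := by
    intro z hz
    refine ((h.d1 z hz).fun_pow 2).congr_deriv ?_
    push_cast; ring
  have e := integral_eq_sub_of_mem_Ioo hd ((BddCont.const 2).mul (h.b1.mul h.b2)) hc hy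
  rw [intervalIntegral.integral_const_mul, h0] at e
  have := abs_integral_le_of_mem (h.b1.mul h.b2) (by norm_num) (Ioo_subset_Icc_self hc)
    (Ioo_subset_Icc_self hy)
  have := (le_abs_self _).trans this
  nlinarith

theorem sq_le_integral_sq (h : Profile w w1 w2 w3) {y : ℝ} (hy : y ∈ Ioo (-1 : ℝ) 1) :
    w1 y ^ 2 ≤ 2 * ∫ s in (-1 : ℝ)..1, w2 s ^ 2 := by
  obtain ⟨c, hc, h0⟩ := h.exists_zero
  have e := integral_eq_sub_of_mem_Ioo h.d1 h.b2 hc hy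
  rw [h0, sub_zero] at e
  have h1 := abs_integral_le_of_mem h.b2 (by norm_num) (Ioo_subset_Icc_self hc)
    (Ioo_subset_Icc_self hy)
  rw [e] at h1
  have cs := sq_integral_mul_le (show (-1 : ℝ) ≤ 1 by norm_num) (f := fun _ => 1)
    (g := fun s => |w2 s|) (BddCont.const 1) h.b2.abs
  simp only [one_mul, one_pow, intervalIntegral.integral_const, smul_eq_mul, mul_one, sq_abs] at cs
  calc w1 y ^ 2 = |w1 y| ^ 2 := (sq_abs _).symm
    _ ≤ (∫ y in (-1 : ℝ)..1, |w2 y|) ^ 2 := pow_le_pow_left₀ (abs_nonneg _) h1 2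
    _ ≤ _ := cs
    _ = _ := by norm_num

theorem integral_abs_sq_le (h : Profile w w1 w2 w3) :
    (∫ s in (-1 : ℝ)..1, |w1 s * w2 s|) ^ 2 ≤
      (∫ s in (-1 : ℝ)..1, w1 s ^ 2) * ∫ s in (-1 : ℝ)..1, w2 s ^ 2 := by
  have := sq_integral_mul_le (show (-1 : ℝ) ≤ 1 by norm_num) h.b1.abs h.b2.abs
  simpa only [abs_mul, sq_abs] using this

/-- Cauchy–Schwarz with the weight split as √par · √par; on the w1 factor the weight is then dropped
because it is at most 1/2. -/
theorem integral_par_abs_sq_le (h : Profile w w1 w2 w3) :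
    (∫ s in (-1 : ℝ)..1, par s * |w1 s * w3 s|) ^ 2 ≤
      (∫ s in (-1 : ℝ)..1, w1 s ^ 2) * ∫ s in (-1 : ℝ)..1, par s * w3 s ^ 2 := by
  have hs : BddCont (fun y => √(par y)) (Ioo (-1) 1) := .of_continuous continuous_par.sqrt
  have hm0 : 0 ≤ ∫ s in (-1 : ℝ)..1, par s * w3 s ^ 2 :=
    integral_nonneg_Ioo (by norm_num) (bddCont_par.mul (h.b3.pow 2)) fun y hy =>
      mul_nonneg (par_pos hy).le (sq_nonneg _)
  have cs := sq_integral_mul_le (show (-1 : ℝ) ≤ 1 by norm_num) (hs.mul h.b1.abs)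
    (hs.mul h.b3.abs)
  have e1 : ∫ s in (-1 : ℝ)..1, √(par s) * |w1 s| * (√(par s) * |w3 s|) =
      ∫ s in (-1 : ℝ)..1, par s * |w1 s * w3 s| := by
    refine intervalIntegral.integral_congr_Ioo_of_le (by norm_num) fun y hy => ?_
    have := Real.mul_self_sqrt (par_pos hy).le
    simp only [abs_mul]
    linear_combination |w1 y| * |w3 y| * this
  have e2 : ∫ s in (-1 : ℝ)..1, (√(par s) * |w3 s|) ^ 2 =
      ∫ s in (-1 : ℝ)..1, par s * w3 s ^ 2 := by
    refine intervalIntegral.integral_congr_Ioo_of_le (by norm_num) fun y hy => ?_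
    simp only [mul_pow, sq_abs, Real.sq_sqrt (par_pos hy).le]
  have e3 : ∫ s in (-1 : ℝ)..1, (√(par s) * |w1 s|) ^ 2 ≤ ∫ s in (-1 : ℝ)..1, w1 s ^ 2 := by
    refine integral_mono_Ioo (by norm_num) ((hs.mul h.b1.abs).pow 2) (h.b1.pow 2) fun y hy => ?_
    simp only [mul_pow, sq_abs, Real.sq_sqrt (par_pos hy).le]
    nlinarith [par_le y, sq_nonneg (w1 y)]
  rw [e1, e2] at cs
  exact cs.trans (mul_le_mul_of_nonneg_right e3 hm0)

/-- Integration by parts of `par` · w1 · w2, whose boundary values vanish because of the weight.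
Bounding the left side by ∫ w2² would not do: multiplied by sup w1² it would be superquadratic in
the dissipation, which has no a priori bound. Here each term on the right carries a factor w1. -/
theorem integral_par_sq_le (h : Profile w w1 w2 w3) :
    ∫ s in (-1 : ℝ)..1, par s * w2 s ^ 2 ≤
      (∫ s in (-1 : ℝ)..1, |w1 s * w2 s|) + ∫ s in (-1 : ℝ)..1, par s * |w1 s * w3 s| := by
  have hy' : BddCont (fun y : ℝ => -y) (Ioo (-1) 1) := .of_continuous continuous_neg
  have b12 := h.b1.mul h.b2
  have b13 := h.b1.mul h.b3
  have hd : ∀ y ∈ Ioo (-1 : ℝ) 1, HasDerivAt (fun y => par y * (w1 y * w2 y))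
      (-y * (w1 y * w2 y) + par y * (w1 y * w3 y) + par y * w2 y ^ 2) y := by
    intro y hy
    refine ((hasDerivAt_par y).fun_mul ((h.d1 y hy).fun_mul (h.d2 y hy))).congr_deriv ?_
    ring
  have lim : ∀ {x : ℝ} {s : Set ℝ}, par x = 0 → (∀ᶠ y in 𝓝[s] x, y ∈ Ioo (-1 : ℝ) 1) →
      Tendsto (fun y => par y * (w1 y * w2 y)) (𝓝[s] x) (𝓝 0) := by
    intro x s hx hs
    obtain ⟨C, hC⟩ := b12.2
    refine squeeze_zero_norm' (a := fun y => |par y| * C) ?_ ?_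
    · filter_upwards [hs] with y hy
      rw [Real.norm_eq_abs, abs_mul]
      exact mul_le_mul_of_nonneg_left (hC y hy) (abs_nonneg _)
    · have : Tendsto (fun y => |par y| * C) (𝓝 x) (𝓝 (|par x| * C)) :=
        (continuous_par.abs.mul continuous_const).tendsto x
      simp only [hx, abs_zero, zero_mul] at this
      exact this.mono_left nhdsWithin_le_nhds
  have b := ((hy'.mul b12).add (bddCont_par.mul b13)).add (bddCont_par.mul (h.b2.pow 2))
  have e := intervalIntegral.integral_eq_sub_of_hasDerivAt_of_tendsto (show (-1 : ℝ) < 1 by norm_num)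
    hd (b.intervalIntegrable (by norm_num))
    (lim (by norm_num [par]) (Ioo_mem_nhdsGT (by norm_num)))
    (lim (by norm_num [par]) (Ioo_mem_nhdsLT (by norm_num)))
  have hle : (-1 : ℝ) ≤ 1 := by norm_num
  rw [intervalIntegral.integral_add, intervalIntegral.integral_add] at e
  rotate_left
  · exact (hy'.mul b12).intervalIntegrable hle
  · exact (bddCont_par.mul b13).intervalIntegrable hle
  · exact ((hy'.mul b12).add (bddCont_par.mul b13)).intervalIntegrable hle
  · exact (bddCont_par.mul (h.b2.pow 2)).intervalIntegrable hle
  have i1 : -(∫ s in (-1 : ℝ)..1, |w1 s * w2 s|) ≤ ∫ s in (-1 : ℝ)..1, -s * (w1 s * w2 s) := by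
    rw [← intervalIntegral.integral_neg]
    refine integral_mono_Ioo hle b12.abs.neg (hy'.mul b12) fun y hy => ?_
    have h1 : |-y * (w1 y * w2 y)| ≤ |w1 y * w2 y| := by
      rw [abs_mul, abs_neg]
      exact mul_le_of_le_one_left (abs_nonneg _) (abs_le.2 ⟨hy.1.le, hy.2.le⟩)
    linarith [neg_abs_le (-y * (w1 y * w2 y))]
  have i2 : -(∫ s in (-1 : ℝ)..1, par s * |w1 s * w3 s|) ≤
      ∫ s in (-1 : ℝ)..1, par s * (w1 s * w3 s) := by
    rw [← intervalIntegral.integral_neg]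
    refine integral_mono_Ioo hle (bddCont_par.mul b13.abs).neg (bddCont_par.mul b13) fun y hy => ?_
    have := par_pos hy
    nlinarith [neg_abs_le (w1 y * w3 y)]
  linarith

end Profile

/-- The remainder in the energy dissipation identity, as a function of the values of `y`, the
parabola and the profile with its first three derivatives. -/
def remainder (y a w w1 w2 w3 : ℝ) : ℝ :=
  -w ^ 5 * a * w3 ^ 2 - 8 * w ^ 5 * w2 ^ 2
    - 16 / 5 * (w ^ 5 - 1) * (-w2 ^ 2 - 2 * y * w2 * w3) - 25 * w ^ 4 * w1 ^ 2 * w2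
    - 14 * w ^ 3 * w1 ^ 3 * w2 * y - a * w ^ 3 * w1 ^ 3 * w3 - 6 * a * w ^ 4 * w1 * w2 * w3
    - 2 * a * w ^ 2 * w1 ^ 4 * w2 - 8 * a * w ^ 3 * w1 ^ 2 * w2 ^ 2

/-! ### Pointwise bounds for the remainder when w is close to 1 -/

theorem pow_bounds {w : ℝ} (hw : |w - 1| ≤ 1 / 1000) :
    0.9 ≤ w ∧ w ≤ 1.01 ∧ w ^ 2 ≤ 1.05 ∧ w ^ 3 ≤ 1.05 ∧ w ^ 4 ≤ 1.05 ∧ 0.95 ≤ w ^ 5 := by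
  obtain ⟨h1, h2⟩ := abs_le.1 hw
  have l : (0.999 : ℝ) ≤ w := by linarith
  have u : w ≤ 1.001 := by linarith
  have p : (0 : ℝ) ≤ w := by linarith
  refine ⟨by linarith, by linarith, ?_, ?_, ?_, ?_⟩
  · exact (pow_le_pow_left₀ p u 2).trans (by norm_num)
  · exact (pow_le_pow_left₀ p u 3).trans (by norm_num)
  · exact (pow_le_pow_left₀ p u 4).trans (by norm_num)
  · exact le_trans (by norm_num) (pow_le_pow_left₀ (by norm_num) l 5)

theorem abs_pow_five_sub_one_le {w : ℝ} (hw : |w - 1| ≤ 1 / 1000) :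
    |w ^ 5 - 1| ≤ 6 * |w - 1| := by
  obtain ⟨h1, h2, h3, h4, h5, -⟩ := pow_bounds hw
  have : w ^ 5 - 1 = (w ^ 4 + w ^ 3 + w ^ 2 + w + 1) * (w - 1) := by ring
  rw [this, abs_mul]
  refine mul_le_mul_of_nonneg_right ?_ (abs_nonneg _)
  rw [abs_of_nonneg (by positivity)]
  linarith

/-- The mixed product w2 w3 is not weighted, while the dissipation controls only a w3². The missing
√a is supplied by the coefficient w⁵ - 1, which is O(√a) near the end points. -/
theorem remainder_bound_one {y a s w w2 w3 : ℝ} (hy : |y| ≤ 1) (ss : s ^ 2 = a)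
    (d1 : |w ^ 5 - 1| ≤ 6 / 1000) (d2 : |w ^ 5 - 1| ≤ 12 / 1000 * s) :
    -(16 / 5 * (w ^ 5 - 1) * (-w2 ^ 2 - 2 * y * w2 * w3)) ≤
      0.1 * w2 ^ 2 + 0.1 * (a * w3 ^ 2) := by
  generalize w ^ 5 - 1 = d at *
  have e0 : |-w2 ^ 2 - 2 * y * w2 * w3| ≤ w2 ^ 2 + 2 * (|w2| * |w3|) := by
    refine (abs_sub _ _).trans ?_
    rw [abs_neg, abs_of_nonneg (sq_nonneg w2), abs_mul, abs_mul, abs_mul, abs_two]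
    have := mul_le_mul_of_nonneg_right hy (mul_nonneg (abs_nonneg w2) (abs_nonneg w3))
    linarith
  have e1 : -(16 / 5 * d * (-w2 ^ 2 - 2 * y * w2 * w3)) ≤
      16 / 5 * (|d| * (w2 ^ 2 + 2 * (|w2| * |w3|))) := by
    refine (neg_le_abs _).trans ?_
    rw [abs_mul, abs_mul, abs_of_pos (show (0 : ℝ) < 16 / 5 by norm_num), mul_assoc]
    exact mul_le_mul_of_nonneg_left (mul_le_mul_of_nonneg_left e0 (abs_nonneg _)) (by norm_num)
  have e2 : |d| * (|w2| * |w3|) ≤ 12 / 1000 * s * (|w2| * |w3|) :=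
    mul_le_mul_of_nonneg_right d2 (by positivity)
  have e3 : 2 * (s * (|w2| * |w3|)) ≤ w2 ^ 2 + a * w3 ^ 2 := by
    rw [← ss, ← sq_abs w2, ← sq_abs w3]
    have := sq_nonneg (|w2| - s * |w3|)
    linarith
  have e4 := mul_le_mul_of_nonneg_right d1 (sq_nonneg w2)
  have e5 : 0 ≤ a * w3 ^ 2 := by rw [← ss]; positivity
  linarith [sq_nonneg w2]

/-- Young's inequality by completing a square, as in the four bounds that follow: the top-order
factor is absorbed by a fraction of the dissipation. The constant covers 12.5² · 1.05². -/
theorem remainder_bound_two {w w1 w2 : ℝ} (h : w ^ 4 ≤ 1.05) :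
    -(25 * w ^ 4 * w1 ^ 2 * w2) ≤ w2 ^ 2 + 183 * w1 ^ 4 := by
  have k : (w ^ 4) ^ 2 ≤ 1.05 ^ 2 := pow_le_pow_left₀ (by positivity) h 2
  have h1 := mul_le_mul_of_nonneg_right k (sq_nonneg (w1 ^ 2))
  have h2 := sq_nonneg (w2 + 12.5 * (w ^ 4 * w1 ^ 2))
  have h3 := sq_nonneg (w1 ^ 2)
  linarith

theorem remainder_bound_three {y w w1 w2 : ℝ} (hw : 0 ≤ w) (hy : |y| ≤ 1) (h : w ^ 3 ≤ 1.05) :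
    -(14 * w ^ 3 * w1 ^ 3 * w2 * y) ≤ w2 ^ 2 + 57 * w1 ^ 6 := by
  have hy2 : y ^ 2 ≤ 1 := by rw [← sq_abs]; exact pow_le_one₀ (abs_nonneg _) hy
  have k : (w ^ 3) ^ 2 ≤ 1.05 ^ 2 := pow_le_pow_left₀ (by positivity) h 2
  have k' : (w ^ 3) ^ 2 * y ^ 2 ≤ 1.05 ^ 2 * 1 := mul_le_mul k hy2 (sq_nonneg _) (by norm_num)
  have h1 := mul_le_mul_of_nonneg_right k' (sq_nonneg (w1 ^ 3))
  have h2 := sq_nonneg (w2 + 7 * (w ^ 3 * w1 ^ 3 * y))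
  have h3 := sq_nonneg (w1 ^ 3)
  linarith

theorem remainder_bound_four {a w w1 w3 : ℝ} (hw : 0 ≤ w) (ha : 0 ≤ a) (ha' : a ≤ 1 / 2)
    (h : w ^ 3 ≤ 1.05) :
    -(a * w ^ 3 * w1 ^ 3 * w3) ≤ 0.1 * (a * w3 ^ 2) + 2 * w1 ^ 6 := by
  have k : (w ^ 3) ^ 2 ≤ 1.05 ^ 2 := pow_le_pow_left₀ (by positivity) h 2
  have h1 := mul_le_mul_of_nonneg_right k (sq_nonneg (w1 ^ 3))
  have h2 := sq_nonneg (w3 + 5 * (w ^ 3 * w1 ^ 3))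
  have h3 := sq_nonneg (w1 ^ 3)
  have e : -(w ^ 3 * w1 ^ 3 * w3) ≤ 0.1 * w3 ^ 2 + 3 * w1 ^ 6 := by linarith
  have h4 := mul_le_mul_of_nonneg_left e ha
  have h5 := mul_le_mul_of_nonneg_right ha' h3
  linarith

theorem remainder_bound_five {a w w1 w2 w3 : ℝ} (ha : 0 ≤ a) (h : w ^ 4 ≤ 1.05) :
    -(6 * a * w ^ 4 * w1 * w2 * w3) ≤
      0.1 * (a * w3 ^ 2) + 100 * (a * (w1 ^ 2 * w2 ^ 2)) := by
  have k : (w ^ 4) ^ 2 ≤ 1.05 ^ 2 := pow_le_pow_left₀ (by positivity) h 2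
  have h1 := mul_le_mul_of_nonneg_right k (sq_nonneg (w1 * w2))
  have h2 := sq_nonneg (w3 + 30 * (w ^ 4 * (w1 * w2)))
  have h3 := sq_nonneg (w1 * w2)
  have e : -(6 * w ^ 4 * w1 * w2 * w3) ≤ 0.1 * w3 ^ 2 + 100 * (w1 ^ 2 * w2 ^ 2) := by linarith
  have h4 := mul_le_mul_of_nonneg_left e ha
  linarith

theorem remainder_bound_six {a w w1 w2 : ℝ} (ha : 0 ≤ a) (ha' : a ≤ 1 / 2) (h : w ^ 2 ≤ 1.05) :
    -(2 * a * w ^ 2 * w1 ^ 4 * w2) ≤ a * (w1 ^ 2 * w2 ^ 2) + w1 ^ 6 := by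
  have k : (w ^ 2) ^ 2 ≤ 1.05 ^ 2 := pow_le_pow_left₀ (by positivity) h 2
  have h1 := mul_le_mul_of_nonneg_right k (sq_nonneg (w1 ^ 3))
  have h2 := sq_nonneg (w1 * w2 + w ^ 2 * w1 ^ 3)
  have h3 := sq_nonneg (w1 ^ 3)
  have e : -(2 * w ^ 2 * w1 ^ 4 * w2) ≤ w1 ^ 2 * w2 ^ 2 + 1.2 * w1 ^ 6 := by linarith
  have h4 := mul_le_mul_of_nonneg_left e ha
  have h5 := mul_le_mul_of_nonneg_right ha' h3
  linarith

/-- With w⁵ ≥ 0.95 the good terms are at least 7.6 w2² and 0.95 a w3². The six bounds use up 2.1 of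
the first and 0.3 of the second, leaving more than one half of each. The last term of `remainder`
already has the good sign and is dropped. -/
theorem remainder_le {y a w w1 w2 w3 m : ℝ} (hy : |y| ≤ 1) (ha : 0 ≤ a) (ha' : a ≤ 1 / 2)
    (hm : 0 ≤ m) (hm' : m ≤ 1 / 1000) (hw : (w - 1) ^ 2 ≤ 2 * a * m ^ 2) :
    remainder y a w w1 w2 w3 ≤ -(1 / 2) * (w2 ^ 2 + a * w3 ^ 2)
      + (101 * (a * (w1 ^ 2 * w2 ^ 2)) + 183 * w1 ^ 4 + 60 * w1 ^ 6) := by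
  have hwm : |w - 1| ≤ m := abs_le_of_sq_le_sq (by nlinarith [sq_nonneg m]) hm
  have hw' : |w - 1| ≤ 1 / 1000 := hwm.trans hm'
  obtain ⟨g1, g2, g3, g4, g5, g6⟩ := pow_bounds hw'
  have s0 : 0 ≤ √a := Real.sqrt_nonneg _
  have ss : √a ^ 2 = a := Real.sq_sqrt ha
  -- Two bounds on w - 1 are needed: the plain one makes the powers of w close to 1, this one
  -- vanishes at the end points like √a.
  have hws : |w - 1| ≤ 2 * m * √a := by
    refine abs_le_of_sq_le_sq ?_ (by positivity)
    rw [mul_pow, ss]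
    nlinarith [mul_nonneg ha (sq_nonneg m)]
  have h5 := abs_pow_five_sub_one_le hw'
  have w0 : 0 ≤ w := by linarith
  have T1 := remainder_bound_one (w2 := w2) (w3 := w3) hy ss (by linarith)
    (show |w ^ 5 - 1| ≤ 12 / 1000 * √a by nlinarith)
  have T2 := remainder_bound_two (w1 := w1) (w2 := w2) g5
  have T3 := remainder_bound_three (w1 := w1) (w2 := w2) w0 hy g4
  have T4 := remainder_bound_four (w1 := w1) (w3 := w3) w0 ha ha' g4
  have T5 := remainder_bound_five (w1 := w1) (w2 := w2) (w3 := w3) ha g5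
  have T6 := remainder_bound_six (w1 := w1) (w2 := w2) ha ha' g3
  have T7 : 0 ≤ 8 * a * w ^ 3 * w1 ^ 2 * w2 ^ 2 := by positivity
  have T8 := mul_le_mul_of_nonneg_right g6 (mul_nonneg ha (sq_nonneg w3))
  have T9 := mul_le_mul_of_nonneg_right g6 (sq_nonneg w2)
  have p1 : 0 ≤ a * w3 ^ 2 := by positivity
  have p2 : 0 ≤ w1 ^ 6 := by positivity
  unfold remainder
  linarith [sq_nonneg w2]

/-! ### The integrated dissipation inequality -/

namespace Profile

variable {w w1 w2 w3 : ℝ → ℝ}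

theorem bdd (h : Profile w w1 w2 w3) : BddCont w (Ioo (-1) 1) := by
  refine ⟨fun y hy => (h.d0 y hy).continuousAt.continuousWithinAt,
    1 + (1 + ∫ s in (-1 : ℝ)..1, w1 s ^ 2), fun y hy => ?_⟩
  have h1 := h.sq_sub_one_le hy
  have hm0 : 0 ≤ ∫ s in (-1 : ℝ)..1, w1 s ^ 2 :=
    integral_nonneg_Ioo (by norm_num) (h.b1.pow 2) fun _ _ => sq_nonneg _
  have h2 : |w y - 1| ≤ 1 + ∫ s in (-1 : ℝ)..1, w1 s ^ 2 := by
    refine abs_le_of_sq_le_sq ?_ (by positivity)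
    nlinarith [mul_le_mul_of_nonneg_right (par_le y) hm0]
  have : |w y| ≤ |w y - 1| + |1| := by simpa using abs_add_le (w y - 1) 1
  rw [abs_one] at this
  linarith

theorem bddCont_remainder (h : Profile w w1 w2 w3) :
    BddCont (fun y => remainder y (par y) (w y) (w1 y) (w2 y) (w3 y)) (Ioo (-1) 1) := by
  have hw := h.bdd
  have hy : BddCont (fun y : ℝ => y) (Ioo (-1) 1) := .of_continuous continuous_id
  have c : ∀ r : ℝ, BddCont (fun _ => r) (Ioo (-1) 1) := fun r => .const r
  have a := bddCont_par
  have b1 := h.b1; have b2 := h.b2; have b3 := h.b3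
  unfold remainder
  exact ((((((((((hw.pow 5).neg.mul a).mul (b3.pow 2)).sub (((c _).mul (hw.pow 5)).mul (b2.pow 2))).sub
    (((c _).mul ((hw.pow 5).sub (c _))).mul ((b2.pow 2).neg.sub
      ((((c _).mul hy).mul b2).mul b3)))).sub
    ((((c _).mul (hw.pow 4)).mul (b1.pow 2)).mul b2)).sub
    (((((c _).mul (hw.pow 3)).mul (b1.pow 3)).mul b2).mul hy)).sub
    (((a.mul (hw.pow 3)).mul (b1.pow 3)).mul b3)).sub
    ((((((c _).mul a).mul (hw.pow 4)).mul b1).mul b2).mul b3)).sub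
    (((((c _).mul a).mul (hw.pow 2)).mul (b1.pow 4)).mul b2)).sub
    (((((c _).mul a).mul (hw.pow 3)).mul (b1.pow 2)).mul (b2.pow 2))

theorem integral_sq_le (h : Profile w w1 w2 w3) :
    ∫ s in (-1 : ℝ)..1, w1 s ^ 2 ≤ 4 * ∫ s in (-1 : ℝ)..1, w2 s ^ 2 := by
  have := integral_mono_Ioo (show (-1 : ℝ) ≤ 1 by norm_num) (h.b1.pow 2) (.const _)
    fun y hy => h.sq_le_integral_sq hy
  rw [intervalIntegral.integral_const, smul_eq_mul] at this
  linarith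

/-- Each superquadratic term is at most a constant times M (D2 + D3), with M = ∫ w1² ≤ 10⁻⁶, so it
is absorbed by the dissipation whatever the size of the latter. More than a quarter of D2 survives,
and the Poincaré constant 4 turns it into M/16. -/
theorem integral_remainder_le (h : Profile w w1 w2 w3)
    (hm : ∫ s in (-1 : ℝ)..1, w1 s ^ 2 ≤ (1 / 1000) ^ 2) :
    ∫ s in (-1 : ℝ)..1, remainder s (par s) (w s) (w1 s) (w2 s) (w3 s) ≤
      -(1 / 16) * ∫ s in (-1 : ℝ)..1, w1 s ^ 2 := by
  have hle : (-1 : ℝ) ≤ 1 := by norm_num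
  have b1 := h.b1; have b2 := h.b2; have b3 := h.b3
  have a := bddCont_par
  set M := ∫ s in (-1 : ℝ)..1, w1 s ^ 2 with hM
  set P := ∫ s in (-1 : ℝ)..1, |w1 s * w2 s| with hP
  set Q := ∫ s in (-1 : ℝ)..1, par s * |w1 s * w3 s| with hQ
  set D2 := ∫ s in (-1 : ℝ)..1, w2 s ^ 2 with hD2
  set D3 := ∫ s in (-1 : ℝ)..1, par s * w3 s ^ 2 with hD3
  have M0 : 0 ≤ M := integral_nonneg_Ioo hle (b1.pow 2) fun _ _ => sq_nonneg _
  have P0 : 0 ≤ P := integral_nonneg_Ioo hle (b1.mul b2).abs fun _ _ => abs_nonneg _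
  have Q0 : 0 ≤ Q := integral_nonneg_Ioo hle (a.mul (b1.mul b3).abs) fun y hy =>
    mul_nonneg (par_pos hy).le (abs_nonneg _)
  have D20 : 0 ≤ D2 := integral_nonneg_Ioo hle (b2.pow 2) fun _ _ => sq_nonneg _
  have D30 : 0 ≤ D3 := integral_nonneg_Ioo hle (a.mul (b3.pow 2)) fun y hy =>
    mul_nonneg (par_pos hy).le (sq_nonneg _)
  have PM : P ^ 2 ≤ M * D2 := h.integral_abs_sq_le
  have QM : Q ^ 2 ≤ M * D3 := h.integral_par_abs_sq_le
  have I1 : ∫ s in (-1 : ℝ)..1, par s * (w1 s ^ 2 * w2 s ^ 2) ≤ 2 * P * (P + Q) := by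
    calc _ ≤ ∫ s in (-1 : ℝ)..1, 2 * P * (par s * w2 s ^ 2) := by
          refine integral_mono_Ioo hle (a.mul ((b1.pow 2).mul (b2.pow 2)))
            ((BddCont.const _).mul (a.mul (b2.pow 2))) fun y hy => ?_
          have := mul_le_mul_of_nonneg_right (h.sq_le_integral_abs hy)
            (mul_nonneg (par_pos hy).le (sq_nonneg (w2 y)))
          linarith
      _ ≤ _ := by
          rw [intervalIntegral.integral_const_mul]
          exact mul_le_mul_of_nonneg_left h.integral_par_sq_le (by positivity)
  have I2 : ∫ s in (-1 : ℝ)..1, w1 s ^ 4 ≤ 2 * D2 * M := by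
    rw [hM, ← intervalIntegral.integral_const_mul]
    refine integral_mono_Ioo hle (b1.pow 4) ((BddCont.const _).mul (b1.pow 2)) fun y hy => ?_
    nlinarith [mul_le_mul_of_nonneg_right (h.sq_le_integral_sq hy) (sq_nonneg (w1 y))]
  have I3 : ∫ s in (-1 : ℝ)..1, w1 s ^ 6 ≤ (2 * P) ^ 2 * M := by
    rw [hM, ← intervalIntegral.integral_const_mul]
    refine integral_mono_Ioo hle (b1.pow 6) ((BddCont.const _).mul (b1.pow 2)) fun y hy => ?_
    have := pow_le_pow_left₀ (sq_nonneg _) (h.sq_le_integral_abs hy) 2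
    nlinarith [mul_le_mul_of_nonneg_right this (sq_nonneg (w1 y))]
  have main : ∫ s in (-1 : ℝ)..1, remainder s (par s) (w s) (w1 s) (w2 s) (w3 s) ≤
      ∫ s in (-1 : ℝ)..1, (-(1 / 2) * (w2 s ^ 2 + par s * w3 s ^ 2)
      + (101 * (par s * (w1 s ^ 2 * w2 s ^ 2)) + 183 * w1 s ^ 4 + 60 * w1 s ^ 6)) := by
    refine integral_mono_Ioo hle h.bddCont_remainder
      (((BddCont.const _).mul ((b2.pow 2).add (a.mul (b3.pow 2)))).add
        ((((BddCont.const _).mul (a.mul ((b1.pow 2).mul (b2.pow 2)))).add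
          ((BddCont.const _).mul (b1.pow 4))).add ((BddCont.const _).mul (b1.pow 6))))
      fun y hy => ?_
    refine remainder_le (m := √M) (abs_le.2 ⟨hy.1.le, hy.2.le⟩) (par_pos hy).le (par_le y)
      (Real.sqrt_nonneg _) ?_ ?_
    · exact Real.sqrt_le_iff.2 ⟨by norm_num, hm⟩
    · rw [Real.sq_sqrt M0]; exact h.sq_sub_one_le hy
  rw [intervalIntegral.integral_add, intervalIntegral.integral_add, intervalIntegral.integral_add,
    intervalIntegral.integral_const_mul, intervalIntegral.integral_const_mul,
    intervalIntegral.integral_const_mul, intervalIntegral.integral_const_mul,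
    intervalIntegral.integral_add] at main
  rotate_left
  · exact (b2.pow 2).intervalIntegrable hle
  · exact (a.mul (b3.pow 2)).intervalIntegrable hle
  · exact ((BddCont.const _).mul (a.mul ((b1.pow 2).mul (b2.pow 2)))).intervalIntegrable hle
  · exact ((BddCont.const _).mul (b1.pow 4)).intervalIntegrable hle
  · exact (((BddCont.const _).mul (a.mul ((b1.pow 2).mul (b2.pow 2)))).add
      ((BddCont.const _).mul (b1.pow 4))).intervalIntegrable hle
  · exact ((BddCont.const _).mul (b1.pow 6)).intervalIntegrable hle
  · exact ((BddCont.const _).mul ((b2.pow 2).add (a.mul (b3.pow 2)))).intervalIntegrable hle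
  · exact ((((BddCont.const _).mul (a.mul ((b1.pow 2).mul (b2.pow 2)))).add
      ((BddCont.const _).mul (b1.pow 4))).add
      ((BddCont.const _).mul (b1.pow 6))).intervalIntegrable hle
  -- 2PQ ≤ P² + Q², followed by the two Cauchy–Schwarz bounds.
  have hPQ : 2 * P * (P + Q) ≤ 3 * (M * D2) + M * D3 := by nlinarith [sq_nonneg (P - Q)]
  have hMD2 : M * D2 ≤ 1 / 1000000 * D2 := mul_le_mul_of_nonneg_right (by linarith) D20
  have hMD3 : M * D3 ≤ 1 / 1000000 * D3 := mul_le_mul_of_nonneg_right (by linarith) D30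
  have hPM : P ^ 2 * M ≤ M * D2 := by
    nlinarith [mul_le_mul_of_nonneg_right PM M0, mul_nonneg M0 D20]
  have := h.integral_sq_le
  linarith

/-- The energy dissipation inequality at a fixed time. -/
theorem integral_dissipation_le (h : Profile w w1 w2 w3) {q q1 : ℝ → ℝ}
    (hq : ∀ y ∈ Ioo (-1 : ℝ) 1, q y =
      (w y * w1 y ^ 3 + 4 * w y ^ 2 * w1 y * w2 y + w y ^ 3 * w3 y) * par y
        - (7 * w y ^ 2 * w1 y ^ 2 + 4 * w y ^ 3 * w2 y) * y - 6 * w y ^ 3 * w1 y)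
    (dq : ∀ y ∈ Ioo (-1 : ℝ) 1, HasDerivAt q (q1 y) y) (bq : BddCont q1 (Ioo (-1) 1))
    (hm : ∫ s in (-1 : ℝ)..1, w1 s ^ 2 ≤ (1 / 1000) ^ 2) :
    ∫ s in (-1 : ℝ)..1, w2 s * w s ^ 2 * q1 s ≤ -(1 / 16) * ∫ s in (-1 : ℝ)..1, w1 s ^ 2 := by
  refine le_trans ?_ (h.integral_remainder_le hm)
  -- The first four terms come from integrating by parts. They leave -16 y w⁴ w1 w2², which the
  -- dissipation cannot absorb since it is cubic and unweighted. The last term has been chosen to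
  -- cancel it: 16/5 because (w⁵)' = 5 w⁴ w1, and w⁵ - 1 in place of w⁵ so that the newly created
  -- quadratic terms have a small coefficient.
  set B : ℝ → ℝ := fun y => w y ^ 2 * w2 y * q y + 7 * (w y ^ 4 * w1 y ^ 2 * w2 y * y)
    + 2 * (w y ^ 5 * w2 y ^ 2 * y) + 6 * (w y ^ 5 * w1 y * w2 y)
    - 16 / 5 * ((w y ^ 5 - 1) * y * w2 y ^ 2) with hB
  set R : ℝ → ℝ := fun y => remainder y (par y) (w y) (w1 y) (w2 y) (w3 y) with hR
  have dB : ∀ y ∈ Ioo (-1 : ℝ) 1, HasDerivAt B (w2 y * w y ^ 2 * q1 y - R y) y := by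
    intro y hy
    have d0 := h.d0 y hy; have d1 := h.d1 y hy; have d2 := h.d2 y hy
    have dy := hasDerivAt_id' y
    have D := (((((((d0.fun_pow 2).fun_mul d2).fun_mul (dq y hy))).fun_add
      (((((d0.fun_pow 4).fun_mul (d1.fun_pow 2)).fun_mul d2).fun_mul dy).const_mul 7)).fun_add
      ((((d0.fun_pow 5).fun_mul (d2.fun_pow 2)).fun_mul dy).const_mul 2)).fun_add
      ((((d0.fun_pow 5).fun_mul d1).fun_mul d2).const_mul 6)).fun_sub
      (((((d0.fun_pow 5).sub_const 1).fun_mul dy).fun_mul (d2.fun_pow 2)).const_mul (16 / 5))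
    refine D.congr_deriv ?_
    simp only [hR, remainder]
    rw [hq y hy]
    push_cast
    ring
  have b0 := h.bdd; have b1 := h.b1; have b2 := h.b2; have b3 := h.b3
  set V : ℝ → ℝ := fun y => w y ^ 2 * w2 y *
    (w y * w1 y ^ 3 + 4 * w y ^ 2 * w1 y * w2 y + w y ^ 3 * w3 y) with hV
  have bV : BddCont V (Ioo (-1) 1) :=
    ((b0.pow 2).mul b2).mul (((b0.mul (b1.pow 3)).add
      ((((BddCont.const 4).mul (b0.pow 2)).mul b1).mul b2)).add ((b0.pow 3).mul b3))
  obtain ⟨K, hK⟩ := bV.2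
  have hBV : ∀ y ∈ Ioo (-1 : ℝ) 1, B y = par y * V y
      - (2 * w y ^ 5 + 16 / 5 * (w y ^ 5 - 1)) * w2 y ^ 2 * y := by
    intro y hy
    simp only [hB, hV]
    rw [hq y hy]; ring
  -- Up to the part that carries `par`, B is minus y times this quantity: nonpositive near 1 and
  -- nonnegative near -1. Hence both boundary contributions have the favourable sign.
  have hcoef : ∀ y ∈ Ioo (-1 : ℝ) 1, 0 ≤ (2 * w y ^ 5 + 16 / 5 * (w y ^ 5 - 1)) * w2 y ^ 2 := by
    intro y hy
    have h1 : |w y - 1| ≤ 1 / 1000 := by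
      refine abs_le_of_sq_le_sq ?_ (by norm_num)
      have hm0 : 0 ≤ ∫ s in (-1 : ℝ)..1, w1 s ^ 2 :=
        integral_nonneg_Ioo (by norm_num) (b1.pow 2) fun _ _ => sq_nonneg _
      have := h.sq_sub_one_le hy
      nlinarith [mul_le_mul_of_nonneg_right (par_le y) hm0]
    obtain ⟨-, -, -, -, -, g⟩ := pow_bounds h1
    exact mul_nonneg (by linarith) (sq_nonneg _)
  have hr : BddCont (fun s => w2 s * w s ^ 2 * q1 s) (Ioo (-1) 1) := (b2.mul (b0.pow 2)).mul bq
  have hRb : BddCont R (Ioo (-1) 1) := h.bddCont_remainder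
  have hdiff := hr.sub hRb
  have hle : (-1 : ℝ) ≤ 1 := by norm_num
  suffices H : ∫ s in (-1 : ℝ)..1, (w2 s * w s ^ 2 * q1 s - R s) ≤ 0 by
    rw [intervalIntegral.integral_sub (hr.intervalIntegrable hle) (hRb.intervalIntegrable hle)] at H
    linarith
  set G : ℝ → ℝ := fun x => ∫ s in (0 : ℝ)..x, (w2 s * w s ^ 2 * q1 s - R s) with hG
  have hint := hdiff.intervalIntegrable hle
  have cont : ContinuousOn G (Icc (-1) 1) := by
    have := intervalIntegral.continuousOn_primitive_interval' hint (a := 0)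
      (by rw [uIcc_of_le hle]; constructor <;> norm_num)
    rwa [uIcc_of_le hle] at this
  have G1 : ∀ y ∈ Ioo (-1 : ℝ) 1, G y = B y - B 0 := fun y hy =>
    integral_eq_sub_of_mem_Ioo dB hdiff (by norm_num) hy
  -- No limit of V at the end points is assumed, only the bound K. The primitive G is continuous up
  -- to the ends, and there it is compared with ±`par` · K, which vanishes in the limit.
  have tr : Tendsto (fun y => G y - (par y * K - B 0)) (𝓝[<] 1) (𝓝 (G 1 - (par 1 * K - B 0))) := by
    refine (((cont 1 (by norm_num)).mono_left (nhdsWithin_mono _ Ioo_subset_Icc_self)).mono_left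
      (nhdsWithin_Ioo_eq_nhdsLT (by norm_num)).ge).sub ?_
    exact (((continuous_par.mul continuous_const).sub continuous_const).tendsto 1).mono_left
      nhdsWithin_le_nhds
  have tl : Tendsto (fun y => G y - (-par y * K - B 0)) (𝓝[>] (-1))
      (𝓝 (G (-1) - (-par (-1) * K - B 0))) := by
    refine (((cont (-1) (by norm_num)).mono_left
      (nhdsWithin_mono _ Ioo_subset_Icc_self)).mono_left
      (nhdsWithin_Ioo_eq_nhdsGT (by norm_num)).ge).sub ?_
    exact (((continuous_par.neg.mul continuous_const).sub continuous_const).tendsto (-1)).mono_left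
      nhdsWithin_le_nhds
  have r1 : G 1 - (par 1 * K - B 0) ≤ 0 := by
    refine le_of_tendsto tr ?_
    filter_upwards [Ioo_mem_nhdsLT (show (0 : ℝ) < 1 by norm_num)] with y hy
    have hy' : y ∈ Ioo (-1 : ℝ) 1 := ⟨by linarith [hy.1], hy.2⟩
    rw [G1 y hy', hBV y hy']
    nlinarith [mul_nonneg (hcoef y hy') hy.1.le,
      mul_le_mul_of_nonneg_left ((le_abs_self _).trans (hK y hy')) (par_pos hy').le]
  have r2 : 0 ≤ G (-1) - (-par (-1) * K - B 0) := by
    refine ge_of_tendsto tl ?_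
    filter_upwards [Ioo_mem_nhdsGT (show (-1 : ℝ) < 0 by norm_num)] with y hy
    have hy' : y ∈ Ioo (-1 : ℝ) 1 := ⟨hy.1, by linarith [hy.2]⟩
    rw [G1 y hy', hBV y hy']
    nlinarith [mul_nonneg (hcoef y hy') (neg_nonneg.2 hy.2.le),
      mul_le_mul_of_nonneg_left (neg_le.1 ((neg_le_abs _).trans (hK y hy'))) (par_pos hy').le]
  have e : ∫ s in (-1 : ℝ)..1, (w2 s * w s ^ 2 * q1 s - R s) = G 1 - G (-1) := by
    rw [hG]
    exact (intervalIntegral.integral_interval_sub_left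
      (hint.mono_set (uIcc_subset_uIcc (by rw [uIcc_of_le hle]; norm_num) right_mem_uIcc))
      (hint.mono_set (uIcc_subset_uIcc (by rw [uIcc_of_le hle]; norm_num) left_mem_uIcc))).symm
  have p1 : par 1 = 0 := by norm_num [par]
  have p2 : par (-1) = 0 := by norm_num [par]
  rw [p1] at r1
  rw [p2] at r2
  rw [e]
  linarith

end Profile

/-! ### Functions with bounded derivatives and weighted averages -/

/-- `f` has `n` continuous bounded derivatives on the open set `I`. -/
def BddDeriv : ℕ → (ℝ → ℝ) → Set ℝ → Prop
  | 0, f, I => BddCont f I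
  | n + 1, f, I => BddCont f I ∧ (∀ y ∈ I, DifferentiableAt ℝ f y) ∧ BddDeriv n (deriv f) I

namespace BddDeriv

variable {f g f' : ℝ → ℝ} {I J : Set ℝ} {n : ℕ}

theorem bddCont (h : BddDeriv n f I) : BddCont f I := by
  cases n with
  | zero => exact h
  | succ n => exact h.1

theorem congr (hI : IsOpen I) (h : BddDeriv n f I) (hfg : EqOn g f I) : BddDeriv n g I := by
  induction n generalizing f g with
  | zero => exact BddCont.congr h hfg
  | succ n ih =>
    have ev : ∀ y ∈ I, g =ᶠ[𝓝 y] f := fun y hy => by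
      filter_upwards [hI.mem_nhds hy] with z hz using hfg hz
    exact ⟨h.1.congr hfg, fun y hy => (h.2.1 y hy).congr_of_eventuallyEq (ev y hy),
      ih h.2.2 fun y hy => (ev y hy).deriv_eq⟩

theorem of_hasDerivAt (hI : IsOpen I) (hf : BddCont f I) (hd : ∀ y ∈ I, HasDerivAt f (f' y) y)
    (h : BddDeriv n f' I) : BddDeriv (n + 1) f I :=
  ⟨hf, fun y hy => (hd y hy).differentiableAt, h.congr hI fun y hy => (hd y hy).deriv⟩

theorem mono (h : BddDeriv n f I) (hJ : J ⊆ I) : BddDeriv n f J := by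
  induction n generalizing f with
  | zero => exact BddCont.mono h hJ
  | succ n ih => exact ⟨h.1.mono hJ, fun y hy => h.2.1 y (hJ hy), ih h.2.2⟩

theorem pred (h : BddDeriv (n + 1) f I) : BddDeriv n f I := by
  induction n generalizing f with
  | zero => exact h.1
  | succ n ih => exact ⟨h.1, h.2.1, ih h.2.2⟩

theorem hasDerivAt (h : BddDeriv (n + 1) f I) {y : ℝ} (hy : y ∈ I) :
    HasDerivAt f (deriv f y) y := (h.2.1 y hy).hasDerivAt

theorem add (hI : IsOpen I) (hf : BddDeriv n f I) (hg : BddDeriv n g I) :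
    BddDeriv n (fun y => f y + g y) I := by
  induction n generalizing f g with
  | zero => exact BddCont.add hf hg
  | succ n ih =>
    exact of_hasDerivAt hI (hf.1.add hg.1)
      (fun y hy => (hf.hasDerivAt hy).fun_add (hg.hasDerivAt hy)) (ih hf.2.2 hg.2.2)

theorem neg (hI : IsOpen I) (hf : BddDeriv n f I) : BddDeriv n (fun y => -f y) I := by
  induction n generalizing f with
  | zero => exact BddCont.neg hf
  | succ n ih =>
    exact of_hasDerivAt hI hf.1.neg (fun y hy => (hf.hasDerivAt hy).fun_neg) (ih hf.2.2)

theorem mul (hI : IsOpen I) (hf : BddDeriv n f I) (hg : BddDeriv n g I) :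
    BddDeriv n (fun y => f y * g y) I := by
  induction n generalizing f g with
  | zero => exact BddCont.mul hf hg
  | succ n ih =>
    exact of_hasDerivAt hI (hf.1.mul hg.1)
      (fun y hy => (hf.hasDerivAt hy).fun_mul (hg.hasDerivAt hy))
      ((ih hf.2.2 hg.pred).add hI (ih hf.pred hg.2.2))

theorem const (c : ℝ) (hI : IsOpen I) : BddDeriv n (fun _ => c) I := by
  induction n generalizing c with
  | zero => exact BddCont.const c
  | succ n ih => exact of_hasDerivAt hI (.const c) (fun y _ => hasDerivAt_const y c) (ih 0)

theorem of_contDiff {a b : ℝ} (hf : ContDiff ℝ ∞ f) : BddDeriv n f (Ioo a b) := by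
  induction n generalizing f with
  | zero => exact BddCont.of_continuous hf.continuous
  | succ n ih =>
    exact ⟨.of_continuous hf.continuous, fun y _ => hf.differentiable (by simp) y,
      ih (contDiff_infty_iff_deriv.1 hf).2⟩

/-- Induction through (1/f)' = -f'/f², where 1/f has one derivative fewer by the inductive
hypothesis. The uniform lower bound c keeps everything bounded up to the boundary of I. -/
theorem inv (hI : IsOpen I) {c : ℝ} (hc : 0 < c) (hf : BddDeriv n f I) (h : ∀ y ∈ I, c ≤ f y) :
    BddDeriv n (fun y => (f y)⁻¹) I := by
  have h0 : ∀ y ∈ I, f y ≠ 0 := fun y hy => (hc.trans_le (h y hy)).ne'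
  have hb : BddCont f I → BddCont (fun y => (f y)⁻¹) I := fun hf =>
    ⟨hf.1.inv₀ h0, c⁻¹, fun y hy => by
      rw [abs_of_pos (inv_pos.2 (hc.trans_le (h y hy)))]
      exact inv_anti₀ hc (h y hy)⟩
  induction n with
  | zero => exact hb hf
  | succ n ih =>
    have i := ih hf.pred
    refine of_hasDerivAt (f' := fun y => -deriv f y * ((f y)⁻¹ * (f y)⁻¹)) hI (hb hf.1)
      (fun y hy => ((hf.hasDerivAt hy).fun_inv (h0 y hy)).congr_deriv ?_)
      ((hf.2.2.neg hI).mul hI (i.mul hI i))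
    have := h0 y hy
    field_simp

theorem sqrt (hI : IsOpen I) {c : ℝ} (hc : 0 < c) (hf : BddDeriv n f I) (h : ∀ y ∈ I, c ≤ f y) :
    BddDeriv n (fun y => √(f y)) I := by
  have h0 : ∀ y ∈ I, f y ≠ 0 := fun y hy => (hc.trans_le (h y hy)).ne'
  have hb : BddCont f I → BddCont (fun y => √(f y)) I := fun hf => by
    obtain ⟨C, hC⟩ := hf.2
    refine ⟨hf.1.sqrt, √C, fun y hy => ?_⟩
    rw [abs_of_nonneg (Real.sqrt_nonneg _)]
    exact Real.sqrt_le_sqrt ((le_abs_self _).trans (hC y hy))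
  induction n with
  | zero => exact hb hf
  | succ n ih =>
    have i := ih hf.pred
    refine of_hasDerivAt (f' := fun y => (1 / 2 * deriv f y) * (√(f y))⁻¹) hI (hb hf.1)
      (fun y hy => ((hf.hasDerivAt hy).sqrt (h0 y hy)).congr_deriv ?_)
      (((const _ hI).mul hI hf.2.2).mul hI (i.inv hI (Real.sqrt_pos.2 hc)
        fun y hy => Real.sqrt_le_sqrt (h y hy)))
    ring

theorem comp_neg {a b : ℝ} (h : BddDeriv n f (Ioo a b)) :
    BddDeriv n (fun y => f (-y)) (Ioo (-b) (-a)) := by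
  have hm : ∀ y ∈ Ioo (-b) (-a), -y ∈ Ioo a b := fun y hy =>
    ⟨by linarith [hy.2], by linarith [hy.1]⟩
  have hb : ∀ {f : ℝ → ℝ}, BddCont f (Ioo a b) → BddCont (fun y => f (-y)) (Ioo (-b) (-a)) :=
    fun hf => ⟨hf.1.comp continuous_neg.continuousOn hm, hf.2.imp fun C hC y hy => hC _ (hm y hy)⟩
  induction n generalizing f with
  | zero => exact hb h
  | succ n ih =>
    refine of_hasDerivAt (f' := fun y => -deriv f (-y)) isOpen_Ioo (hb h.1) (fun y hy => ?_)
      ((ih h.2.2).neg isOpen_Ioo)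
    exact ((h.hasDerivAt (hm y hy)).comp y (hasDerivAt_neg y)).congr_deriv (by ring)

theorem union (hI : IsOpen I) (hJ : IsOpen J) (h : BddDeriv n f I) (h' : BddDeriv n f J) :
    BddDeriv n f (I ∪ J) := by
  have hb : ∀ {f : ℝ → ℝ}, BddCont f I → BddCont f J → BddCont f (I ∪ J) := fun hf hg => by
    obtain ⟨C, hC⟩ := hf.2
    obtain ⟨K, hK⟩ := hg.2
    exact ⟨hf.1.union_of_isOpen hg.1 hI hJ, max C K, fun y hy => hy.elim
      (fun hy => (hC y hy).trans (le_max_left _ _)) fun hy => (hK y hy).trans (le_max_right _ _)⟩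
  induction n generalizing f with
  | zero => exact hb h h'
  | succ n ih => exact ⟨hb h.1 h'.1, fun y hy => hy.elim (h.2.1 y) (h'.2.1 y), ih h.2.2 h'.2.2⟩

end BddDeriv

/-- The weighted average `(1 + y)^{-(k+1)} ∫_{-1}^y (1 + s)^k f(s) ds`. -/
def avg (k : ℕ) (f : ℝ → ℝ) (y : ℝ) : ℝ :=
  (∫ s in (-1 : ℝ)..y, (1 + s) ^ k * f s) / (1 + y) ^ (k + 1)

/-! ### Weighted averages at a degenerate end point -/

section avg

variable {f f' : ℝ → ℝ} {b C : ℝ} {k n : ℕ}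

theorem bddCont_weight (k : ℕ) {a b : ℝ} : BddCont (fun s => (1 + s) ^ k) (Ioo a b) :=
  .of_continuous (by fun_prop)

theorem abs_avg_le (hC : ∀ y ∈ Ioo (-1) b, |f y| ≤ C) {y : ℝ} (hy : y ∈ Ioo (-1) b) :
    |avg k f y| ≤ C := by
  have h1 : 0 < 1 + y := by linarith [hy.1]
  rw [avg, abs_div, abs_of_pos (pow_pos h1 _), div_le_iff₀ (pow_pos h1 _)]
  have := intervalIntegral.norm_integral_le_of_norm_le_const_ae (a := -1) (b := y)
    (f := fun s => (1 + s) ^ k * f s) (C := (1 + y) ^ k * C) ?_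
  · rw [Real.norm_eq_abs] at this
    refine this.trans_eq ?_
    rw [abs_of_pos (by linarith)]
    ring
  · have hne : ∀ᵐ x : ℝ, x ≠ y := by simp [ae_iff]
    filter_upwards [hne] with s hsy hs
    rw [uIoc_of_le hy.1.le] at hs
    have hs' : 0 ≤ 1 + s := by linarith [hs.1]
    rw [Real.norm_eq_abs, abs_mul, abs_of_nonneg (pow_nonneg hs' k)]
    exact mul_le_mul (pow_le_pow_left₀ hs' (by linarith [hs.2]) k)
      (hC s ⟨hs.1, hs.2.trans_lt hy.2⟩) (abs_nonneg _) (pow_nonneg h1.le k)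

/-- Integrating ((1 + s)^(k+1) f)' by parts absorbs the singular term that comes from
differentiating the denominator. The derivative is again an average, of f' with the next weight, so
boundedness passes to all orders despite the division by powers of 1 + y. -/
theorem hasDerivAt_avg (hf : BddCont f (Ioo (-1) b)) (hd : ∀ y ∈ Ioo (-1) b, HasDerivAt f (f' y) y)
    (hf' : BddCont f' (Ioo (-1) b)) {y : ℝ} (hy : y ∈ Ioo (-1) b) :
    HasDerivAt (avg k f) (avg (k + 1) f' y) y := by
  have h1 : 0 < 1 + y := by linarith [hy.1]
  have i1 := (bddCont_weight k).mul hf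
  have i2 := (bddCont_weight (k + 1)).mul hf'
  have parts : (∫ s in (-1 : ℝ)..y, (1 + s) ^ (k + 1) * f' s) =
      (1 + y) ^ (k + 1) * f y - (k + 1) * ∫ s in (-1 : ℝ)..y, (1 + s) ^ k * f s := by
    have dw : ∀ s ∈ Ioo (-1) b, HasDerivAt (fun s => (1 + s) ^ (k + 1) * f s)
        ((k + 1) * ((1 + s) ^ k * f s) + (1 + s) ^ (k + 1) * f' s) s := by
      intro s hs
      refine ((((hasDerivAt_id' s).const_add 1).fun_pow (k + 1)).fun_mul (hd s hs)).congr_deriv ?_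
      push_cast
      simp only [mul_one]
      ring
    have lim : Tendsto (fun s => (1 + s) ^ (k + 1) * f s) (𝓝[>] (-1)) (𝓝 0) := by
      obtain ⟨C, hC⟩ := hf.2
      refine squeeze_zero_norm' (a := fun s => |(1 + s) ^ (k + 1)| * C) ?_ ?_
      · filter_upwards [Ioo_mem_nhdsGT (hy.1.trans hy.2)] with s hs
        rw [Real.norm_eq_abs, abs_mul]
        exact mul_le_mul_of_nonneg_left (hC s hs) (abs_nonneg _)
      · have : Continuous fun s : ℝ => |(1 + s) ^ (k + 1)| * C := by fun_prop
        have := this.tendsto (-1)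
        simp only [add_neg_cancel, ne_eq, Nat.succ_ne_zero, not_false_eq_true, zero_pow, abs_zero,
          zero_mul] at this
        exact this.mono_left nhdsWithin_le_nhds
    have e := integral_eq_sub_of_tendsto_left dw (((BddCont.const _).mul i1).add i2) lim hy
    have sub : Ioo (-1) y ⊆ Ioo (-1) b := Ioo_subset_Ioo_right hy.2.le
    rw [intervalIntegral.integral_add ((((BddCont.const _).mul i1).mono sub).intervalIntegrable
      hy.1.le) ((i2.mono sub).intervalIntegrable hy.1.le),
      intervalIntegral.integral_const_mul] at e
    linarith
  have dint : HasDerivAt (fun y => ∫ s in (-1 : ℝ)..y, (1 + s) ^ k * f s) ((1 + y) ^ k * f y) y := by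
    refine intervalIntegral.integral_hasDerivAt_right
      ((i1.mono (Ioo_subset_Ioo_right hy.2.le)).intervalIntegrable hy.1.le) ?_
      (i1.1.continuousAt (isOpen_Ioo.mem_nhds hy))
    exact i1.1.stronglyMeasurableAtFilter isOpen_Ioo y hy
  refine (dint.fun_div (((hasDerivAt_id' y).const_add 1).fun_pow (k + 1))
    (pow_pos h1 _).ne').congr_deriv ?_
  rw [avg, parts]
  push_cast
  field_simp
  ring

theorem BddDeriv.avg (hf : BddDeriv n f (Ioo (-1) b)) : BddDeriv n (avg k f) (Ioo (-1) b) := by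
  have hb : ∀ {f : ℝ → ℝ} {k : ℕ}, BddCont f (Ioo (-1) b) →
      BddCont (ThinFilm.avg k f) (Ioo (-1) b) := by
    intro f k hf
    obtain ⟨C, hC⟩ := hf.2
    refine ⟨fun y hy => ContinuousAt.continuousWithinAt ?_, C, fun y hy => abs_avg_le hC hy⟩
    have h1 : 0 < 1 + y := by linarith [hy.1]
    have i1 := (bddCont_weight k).mul hf
    have dint : HasDerivAt (fun y => ∫ s in (-1 : ℝ)..y, (1 + s) ^ k * f s)
        ((1 + y) ^ k * f y) y := by
      refine intervalIntegral.integral_hasDerivAt_right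
        ((i1.mono (Ioo_subset_Ioo_right hy.2.le)).intervalIntegrable hy.1.le) ?_
        (i1.1.continuousAt (isOpen_Ioo.mem_nhds hy))
      exact i1.1.stronglyMeasurableAtFilter isOpen_Ioo y hy
    exact ContinuousAt.div dint.continuousAt (by fun_prop) (pow_pos h1 _).ne'
  induction n generalizing f k with
  | zero => exact hb hf
  | succ n ih =>
    exact .of_hasDerivAt isOpen_Ioo (hb hf.1)
      (fun y hy => hasDerivAt_avg hf.1 (fun z hz => hf.hasDerivAt hz) hf.2.2.bddCont hy)
      (ih hf.2.2)

end avg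

/-- `(par² g)' = 2 par e` on `(-1, 1)`, and `par² g` vanishes at the end points. -/
structure Weighted (g e : ℝ → ℝ) : Prop where
  hasDerivAt : ∀ y ∈ Ioo (-1 : ℝ) 1, HasDerivAt (fun y => par y ^ 2 * g y) (2 * par y * e y) y
  left : Tendsto (fun y => par y ^ 2 * g y) (𝓝[>] (-1)) (𝓝 0)
  right : Tendsto (fun y => par y ^ 2 * g y) (𝓝[<] 1) (𝓝 0)

namespace Weighted

variable {g e e1 : ℝ → ℝ} {K K1 : ℝ}

theorem reflect (h : Weighted g e) : Weighted (fun y => g (-y)) (fun y => -e (-y)) := by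
  have hp : ∀ y, par (-y) = par y := fun y => by simp [par]
  refine ⟨fun y hy => ?_, ?_, ?_⟩
  · have := (h.hasDerivAt (-y) ⟨by linarith [hy.2], by linarith [hy.1]⟩).comp y (hasDerivAt_neg y)
    simp only [Function.comp_def, hp] at this
    exact this.congr_deriv (by ring)
  · have t : Tendsto (fun y : ℝ => -y) (𝓝[>] (-1)) (𝓝[<] 1) := by
      simpa using tendsto_neg_nhdsGT (a := (-1 : ℝ))
    simpa only [Function.comp_def, hp] using h.right.comp t
  · have t : Tendsto (fun y : ℝ => -y) (𝓝[<] 1) (𝓝[>] (-1)) := tendsto_neg_nhdsLT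
    simpa only [Function.comp_def, hp] using h.left.comp t

/-- Here `par` = (1 + s)(1 - s)/2: the vanishing factor 1 + s becomes the weight of the average, and
the factor 1 - s is harmless away from the right end. -/
theorem eq_avg (h : Weighted g e) (he : BddCont e (Ioo (-1) 1)) {y : ℝ} (hy : y ∈ Ioo (-1 : ℝ) 1) :
    g y = 8 * ((1 - y)⁻¹ * (1 - y)⁻¹) * avg 1 (fun s => (1 - s) / 2 * e s) y := by
  have b : BddCont (fun y => 2 * par y * e y) (Ioo (-1) 1) :=
    ((BddCont.const 2).mul bddCont_par).mul he
  have i := integral_eq_sub_of_tendsto_left h.hasDerivAt b h.left hy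
  have i2 : (∫ s in (-1 : ℝ)..y, (1 + s) ^ 1 * ((1 - s) / 2 * e s)) = par y ^ 2 * g y / 2 := by
    rw [← sub_zero (par y ^ 2 * g y), ← i, ← intervalIntegral.integral_div]
    congr 1; ext s
    unfold par; ring
  have h1 : 0 < 1 + y := by linarith [hy.1]
  have h2 : 0 < 1 - y := by linarith [hy.2]
  rw [avg, i2, par]
  field_simp
  ring

theorem bddDeriv_left {n : ℕ} (h : Weighted g e) (he : BddDeriv n e (Ioo (-1) 1)) :
    BddDeriv n g (Ioo (-1) (1 / 2)) := by
  have sub : Ioo (-1 : ℝ) (1 / 2) ⊆ Ioo (-1) 1 := Ioo_subset_Ioo_right (by norm_num)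
  have i : BddDeriv n (fun y : ℝ => (1 - y)⁻¹) (Ioo (-1) (1 / 2)) :=
    (BddDeriv.of_contDiff (by fun_prop)).inv isOpen_Ioo (c := 1 / 2) (by norm_num)
      fun y hy => by linarith [hy.2]
  have l : BddDeriv n (fun s : ℝ => (1 - s) / 2 * e s) (Ioo (-1) (1 / 2)) :=
    (BddDeriv.of_contDiff (by fun_prop)).mul isOpen_Ioo (he.mono sub)
  exact (((BddDeriv.const 8 isOpen_Ioo).mul isOpen_Ioo (i.mul isOpen_Ioo i)).mul isOpen_Ioo
    l.avg).congr isOpen_Ioo fun y hy => h.eq_avg he.bddCont (sub hy)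

/-- The representation by averages at -1 covers (-1, 1/2); the reflection y ↦ -y covers (-1/2, 1).
-/
theorem bddDeriv {n : ℕ} (h : Weighted g e) (he : BddDeriv n e (Ioo (-1) 1)) :
    BddDeriv n g (Ioo (-1) 1) := by
  have l := h.bddDeriv_left he
  have he' : BddDeriv n (fun y => -e (-y)) (Ioo (-1) 1) := by
    simpa using (he.comp_neg).neg isOpen_Ioo
  have r := (h.reflect.bddDeriv_left he').comp_neg
  simp only [neg_neg] at r
  exact (l.union isOpen_Ioo isOpen_Ioo r).mono fun y hy => by
    rcases lt_or_ge y (1 / 2) with h0 | h0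
    · exact Or.inl ⟨hy.1, h0⟩
    · exact Or.inr ⟨by linarith, hy.2⟩

/-- Explicit constants depending only on bounds for e and e' are what makes the resulting estimates
uniform in time, down to the initial time. -/
theorem abs_le_left (h : Weighted g e) (he : BddCont e (Ioo (-1) 1))
    (hd : ∀ y ∈ Ioo (-1 : ℝ) 1, HasDerivAt e (e1 y) y) (he1 : BddCont e1 (Ioo (-1) 1))
    (hK : ∀ y ∈ Ioo (-1 : ℝ) 1, |e y| ≤ K) (hK1 : ∀ y ∈ Ioo (-1 : ℝ) 1, |e1 y| ≤ K1)
    {y : ℝ} (hy : y ∈ Ioo (-1 : ℝ) (1 / 2)) : |g y| ≤ 32 * K ∧ |deriv g y| ≤ 160 * (K + K1) := by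
  have hy' : y ∈ Ioo (-1 : ℝ) 1 := ⟨hy.1, by linarith [hy.2]⟩
  have K0 : 0 ≤ K := (abs_nonneg _).trans (hK y hy')
  have K10 : 0 ≤ K1 := (abs_nonneg _).trans (hK1 y hy')
  have lin : BddCont (fun s : ℝ => (1 - s) / 2) (Ioo (-1) 1) := .of_continuous (by fun_prop)
  have bl : BddCont (fun s => (1 - s) / 2 * e s) (Ioo (-1) 1) := lin.mul he
  have bl' : BddCont (fun s => -1 / 2 * e s + (1 - s) / 2 * e1 s) (Ioo (-1) 1) :=
    ((BddCont.const _).mul he).add (lin.mul he1)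
  have dl : ∀ s ∈ Ioo (-1 : ℝ) 1, HasDerivAt (fun s => (1 - s) / 2 * e s)
      (-1 / 2 * e s + (1 - s) / 2 * e1 s) s := fun s hs =>
    ((((hasDerivAt_id' s).const_sub 1).div_const 2).fun_mul (hd s hs))
  have labs : ∀ s ∈ Ioo (-1 : ℝ) 1, |(1 - s) / 2| ≤ 1 := fun s hs =>
    abs_le.2 ⟨by linarith [hs.2], by linarith [hs.1]⟩
  have c0 : ∀ s ∈ Ioo (-1 : ℝ) 1, |(1 - s) / 2 * e s| ≤ K := fun s hs => by
    rw [abs_mul]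
    exact (mul_le_of_le_one_left (abs_nonneg _) (labs s hs)).trans (hK s hs)
  have c1 : ∀ s ∈ Ioo (-1 : ℝ) 1, |-1 / 2 * e s + (1 - s) / 2 * e1 s| ≤ K + K1 := fun s hs => by
    refine (abs_add_le _ _).trans (add_le_add ?_ ?_)
    · rw [abs_mul]
      exact (mul_le_of_le_one_left (abs_nonneg _) (by norm_num [abs_le])).trans (hK s hs)
    · rw [abs_mul]
      exact (mul_le_of_le_one_left (abs_nonneg _) (labs s hs)).trans (hK1 s hs)
  have A0 := abs_avg_le (k := 1) c0 hy'
  have A1 := abs_avg_le (k := 2) c1 hy'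
  have h2 : (1 / 2 : ℝ) < 1 - y := by linarith [hy.2]
  have i0 : 0 < (1 - y)⁻¹ := inv_pos.2 (by linarith)
  have i1 : (1 - y)⁻¹ ≤ 2 := by
    rw [inv_le_comm₀ (by linarith) (by norm_num)]; linarith
  have i2 : (1 - y)⁻¹ * (1 - y)⁻¹ ≤ 4 := by nlinarith
  have i3 : (1 - y)⁻¹ * (1 - y)⁻¹ * (1 - y)⁻¹ ≤ 8 := by nlinarith [mul_pos i0 i0]
  constructor
  · rw [h.eq_avg he hy', abs_mul, abs_of_pos (by positivity)]
    nlinarith [mul_pos i0 i0, abs_nonneg (avg 1 (fun s => (1 - s) / 2 * e s) y)]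
  · have ev : g =ᶠ[𝓝 y] fun y => 8 * ((1 - y)⁻¹ * (1 - y)⁻¹) *
        avg 1 (fun s => (1 - s) / 2 * e s) y := by
      filter_upwards [isOpen_Ioo.mem_nhds hy'] with z hz using h.eq_avg he hz
    have di := ((hasDerivAt_id' y).const_sub 1).fun_inv (show 1 - y ≠ 0 by linarith)
    have D := ((di.fun_mul di).const_mul 8).fun_mul (hasDerivAt_avg (k := 1) bl dl bl' hy')
    have e : deriv g y = 16 * ((1 - y)⁻¹ * (1 - y)⁻¹ * (1 - y)⁻¹) *
        avg 1 (fun s => (1 - s) / 2 * e s) y + 8 * ((1 - y)⁻¹ * (1 - y)⁻¹) *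
        avg 2 (fun s => -1 / 2 * e s + (1 - s) / 2 * e1 s) y := by
      rw [ev.deriv_eq, D.deriv]
      have : 1 - y ≠ 0 := by linarith
      field_simp
      ring
    rw [e]
    refine (abs_add_le _ _).trans ?_
    have p3 := mul_pos (mul_pos i0 i0) i0
    have p2 := mul_pos i0 i0
    simp only [abs_mul, abs_of_pos i0, Nat.abs_ofNat]
    have q1 := mul_le_mul (mul_le_mul_of_nonneg_left i3 (show (0 : ℝ) ≤ 16 by norm_num)) A0
      (abs_nonneg _) (by norm_num)
    have q2 := mul_le_mul (mul_le_mul_of_nonneg_left i2 (show (0 : ℝ) ≤ 8 by norm_num)) A1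
      (abs_nonneg _) (by norm_num)
    linarith

theorem abs_le (h : Weighted g e) (he : BddCont e (Ioo (-1) 1))
    (hd : ∀ y ∈ Ioo (-1 : ℝ) 1, HasDerivAt e (e1 y) y) (he1 : BddCont e1 (Ioo (-1) 1))
    (hK : ∀ y ∈ Ioo (-1 : ℝ) 1, |e y| ≤ K) (hK1 : ∀ y ∈ Ioo (-1 : ℝ) 1, |e1 y| ≤ K1)
    {y : ℝ} (hy : y ∈ Ioo (-1 : ℝ) 1) : |g y| ≤ 32 * K ∧ |deriv g y| ≤ 160 * (K + K1) := by
  rcases lt_or_ge y (1 / 2) with h0 | h0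
  · exact h.abs_le_left he hd he1 hK hK1 ⟨hy.1, h0⟩
  · have hm : ∀ y ∈ Ioo (-1 : ℝ) 1, -y ∈ Ioo (-1 : ℝ) 1 := fun y hy =>
      ⟨by linarith [hy.2], by linarith [hy.1]⟩
    have he' : BddCont (fun y => -e (-y)) (Ioo (-1) 1) :=
      BddCont.neg ⟨he.1.comp continuous_neg.continuousOn hm, he.2.imp fun C hC y hy => hC _ (hm y hy)⟩
    have he1' : BddCont (fun y => e1 (-y)) (Ioo (-1) 1) :=
      ⟨he1.1.comp continuous_neg.continuousOn hm, he1.2.imp fun C hC y hy => hC _ (hm y hy)⟩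
    have := h.reflect.abs_le_left (K := K) (K1 := K1) he' (fun y hy =>
      (((hd (-y) (hm y hy)).comp y (hasDerivAt_neg y)).fun_neg).congr_deriv (by ring)) he1'
      (fun y hy => by rw [abs_neg]; exact hK _ (hm y hy)) (fun y hy => hK1 _ (hm y hy))
      (y := -y) ⟨by linarith [hy.2], by linarith⟩
    rw [neg_neg, deriv_comp_neg, neg_neg, abs_neg] at this
    exact this

end Weighted

/-! ### Regularity up to the contact points -/

/-- The positivity set including contact points, for positive times. -/
def dom (lm lp : ℝ → ℝ) : Set (ℝ × ℝ) := {p | 0 < p.1 ∧ p.2 ∈ Icc (lm p.1) (lp p.1)}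

/-- The positivity set without contact points, for positive times. -/
def inn (lm lp : ℝ → ℝ) : Set (ℝ × ℝ) := {p | 0 < p.1 ∧ p.2 ∈ Ioo (lm p.1) (lp p.1)}

/-- The time derivative of the `k`-th spatial derivative. -/
def dtx (u : ℝ → ℝ → ℝ) (lm lp : ℝ → ℝ) (k : ℕ) (t x : ℝ) : ℝ :=
  fderivWithin ℝ (fun p : ℝ × ℝ => dx u lm lp k p.1 p.2) (dom lm lp) (t, x) (1, 0)

theorem fderiv_fderiv_comm {F : ℝ × ℝ → ℝ} {p : ℝ × ℝ} (hF : ContDiffAt ℝ 2 F p) (v w : ℝ × ℝ) :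
    fderiv ℝ (fun q => fderiv ℝ F q v) p w = fderiv ℝ (fun q => fderiv ℝ F q w) p v := by
  have hd : DifferentiableAt ℝ (fderiv ℝ F) p :=
    (hF.fderiv_right (m := 1) (by norm_num)).differentiableAt (by norm_num)
  have hs := hF.isSymmSndFDerivAt (by simp)
  have e : ∀ v w, fderiv ℝ (fun q => fderiv ℝ F q v) p w = fderiv ℝ (fderiv ℝ F) p w v := by
    intro v w
    rw [fderiv_clm_apply hd (differentiableAt_const v)]
    simp
  rw [e, e]
  exact hs w v

theorem inn_subset_dom {lm lp : ℝ → ℝ} : inn lm lp ⊆ dom lm lp :=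
  fun _ hp => ⟨hp.1, Ioo_subset_Icc_self hp.2⟩

namespace IsGlobalSmoothSolution

variable {u : ℝ → ℝ → ℝ} {lm lp : ℝ → ℝ}

theorem hasDerivAt_lm (h : IsGlobalSmoothSolution u lm lp) {t : ℝ} (ht : 0 < t) :
    HasDerivAt lm (deriv lm t) t :=
  ((h.lm_smooth.differentiableOn (by simp)).differentiableAt (Ioi_mem_nhds ht)).hasDerivAt

theorem hasDerivAt_lp (h : IsGlobalSmoothSolution u lm lp) {t : ℝ} (ht : 0 < t) :
    HasDerivAt lp (deriv lp t) t :=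
  ((h.lp_smooth.differentiableOn (by simp)).differentiableAt (Ioi_mem_nhds ht)).hasDerivAt

theorem isOpen_inn (h : IsGlobalSmoothSolution u lm lp) : IsOpen (inn lm lp) := by
  rw [isOpen_iff_mem_nhds]
  rintro ⟨t, x⟩ ⟨ht, h1, h2⟩
  have ht : 0 < t := ht
  have c1 : ContinuousAt (fun p : ℝ × ℝ => lm p.1) (t, x) :=
    ContinuousAt.comp (f := Prod.fst) (g := lm) (h.hasDerivAt_lm ht).continuousAt continuousAt_fst
  have c2 : ContinuousAt (fun p : ℝ × ℝ => lp p.1) (t, x) :=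
    ContinuousAt.comp (f := Prod.fst) (g := lp) (h.hasDerivAt_lp ht).continuousAt continuousAt_fst
  filter_upwards [continuousAt_fst.eventually (lt_mem_nhds ht), c1.eventually_lt continuousAt_snd h1,
    continuousAt_snd.eventually_lt c2 h2] with p a b c using ⟨a, b, c⟩

/-- Straightening: the domain is the image of (0, ∞) × [0, 1] under (t, s) ↦ (t, lm + s (lp - lm)),
whose differential is onto since lm < lp. This makes derivatives within the closed domain well
defined at the contact points. -/
theorem uniqueDiffOn_dom (h : IsGlobalSmoothSolution u lm lp) :
    UniqueDiffOn ℝ (dom lm lp) := by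
  set Φ : ℝ × ℝ → ℝ × ℝ := fun p => (p.1, lm p.1 + p.2 * (lp p.1 - lm p.1)) with hΦ
  have himg : dom lm lp = Φ '' (Ioi 0 ×ˢ Icc 0 1) := by
    ext ⟨t, x⟩
    constructor
    · rintro ⟨ht, hx⟩
      simp only at ht hx
      have hL : 0 < lp t - lm t := sub_pos.2 (h.lt t ht.le)
      refine ⟨(t, (x - lm t) / (lp t - lm t)), ⟨ht, ?_, ?_⟩, ?_⟩
      · exact div_nonneg (by linarith [hx.1]) hL.le
      · exact (div_le_one hL).2 (by linarith [hx.2])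
      · simp only [hΦ, Prod.mk.injEq, true_and]
        field_simp; ring
    · rintro ⟨⟨t', s⟩, ⟨ht, hs⟩, he⟩
      simp only [hΦ, Prod.mk.injEq] at he ht hs
      obtain ⟨rfl, rfl⟩ := he
      have ht : 0 < t' := ht
      have hL : 0 < lp t' - lm t' := sub_pos.2 (h.lt _ ht.le)
      refine ⟨ht, ?_, ?_⟩
      · simp only; nlinarith [hs.1]
      · simp only; nlinarith [hs.2]
  rw [himg]
  set Φ' : ℝ × ℝ → ℝ × ℝ →L[ℝ] ℝ × ℝ := fun p =>
    (ContinuousLinearMap.fst ℝ ℝ ℝ).prod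
      ((deriv lm p.1 + p.2 * (deriv lp p.1 - deriv lm p.1)) • ContinuousLinearMap.fst ℝ ℝ ℝ +
        (lp p.1 - lm p.1) • ContinuousLinearMap.snd ℝ ℝ ℝ) with hΦ'
  refine UniqueDiffOn.image (f' := Φ') ((isOpen_Ioi.uniqueDiffOn).prod (uniqueDiffOn_Icc one_pos))
    ?_ ?_
  · rintro ⟨t, s⟩ ⟨ht, -⟩
    have ht : 0 < t := ht
    have d1 : HasFDerivAt (fun p : ℝ × ℝ => lm p.1) (deriv lm t • ContinuousLinearMap.fst ℝ ℝ ℝ) (t, s) :=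
      (h.hasDerivAt_lm ht).comp_hasFDerivAt (t, s) hasFDerivAt_fst
    have d2 : HasFDerivAt (fun p : ℝ × ℝ => lp p.1) (deriv lp t • ContinuousLinearMap.fst ℝ ℝ ℝ) (t, s) :=
      (h.hasDerivAt_lp ht).comp_hasFDerivAt (t, s) hasFDerivAt_fst
    have d3 : HasFDerivAt (fun p : ℝ × ℝ => p.2) (ContinuousLinearMap.snd ℝ ℝ ℝ) (t, s) :=
      hasFDerivAt_snd
    have := hasFDerivAt_fst.prodMk (d1.fun_add (d3.fun_mul (d2.fun_sub d1)))
    refine (this.congr_fderiv ?_).hasFDerivWithinAt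
    ext <;> simp [hΦ']
  · rintro ⟨t, s⟩ ⟨ht, -⟩
    have ht : 0 < t := ht
    have hL : lp t - lm t ≠ 0 := (sub_pos.2 (h.lt _ ht.le)).ne'
    refine Function.Surjective.denseRange fun v =>
      ⟨(v.1, (v.2 - (deriv lm t + s * (deriv lp t - deriv lm t)) * v.1) / (lp t - lm t)), ?_⟩
    ext
    · simp [hΦ']
    · simp only [hΦ', ContinuousLinearMap.prod_apply, ContinuousLinearMap.coe_fst',
        _root_.add_apply, _root_.smul_apply, smul_eq_mul,
        ContinuousLinearMap.coe_snd']
      field_simp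
      ring

theorem hasDerivWithinAt_slice {F : ℝ × ℝ → ℝ} {t x : ℝ} (ht : 0 < t)
    (hF : DifferentiableWithinAt ℝ F (dom lm lp) (t, x)) :
    HasDerivWithinAt (fun z => F (t, z)) (fderivWithin ℝ F (dom lm lp) (t, x) (0, 1))
      (Icc (lm t) (lp t)) x := by
  have c : HasDerivWithinAt (fun z : ℝ => (t, z)) ((0 : ℝ), (1 : ℝ)) (Icc (lm t) (lp t)) x :=
    (hasDerivWithinAt_const x _ t).prodMk (hasDerivWithinAt_id x _)
  exact hF.hasFDerivWithinAt.comp_hasDerivWithinAt x c fun z hz => ⟨ht, hz⟩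

theorem contDiffOn_dx (h : IsGlobalSmoothSolution u lm lp) (k : ℕ) :
    ContDiffOn ℝ ∞ (fun p : ℝ × ℝ => dx u lm lp k p.1 p.2) (dom lm lp) := by
  induction k with
  | zero => exact h.smooth.congr fun p _ => by simp [dx]
  | succ k ih =>
    have h1 : ContDiffOn ℝ ∞ (fun p => fderivWithin ℝ
        (fun p : ℝ × ℝ => dx u lm lp k p.1 p.2) (dom lm lp) p (0, 1)) (dom lm lp) :=
      (ih.fderivWithin h.uniqueDiffOn_dom (by simp)).clm_apply contDiffOn_const
    refine h1.congr ?_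
    rintro ⟨t, x⟩ ⟨ht, hx⟩
    have ht : 0 < t := ht
    simp only [dx, iteratedDerivWithin_succ]
    exact (hasDerivWithinAt_slice (F := fun p : ℝ × ℝ => dx u lm lp k p.1 p.2) ht
      (ih.differentiableOn (by simp) (t, x) ⟨ht, hx⟩)).derivWithin
      (uniqueDiffOn_Icc (h.lt t ht.le) x hx)

/-- The alternative in `hk` reflects the regularity of the solution: all orders at positive times,
only two derivatives at the initial time. -/
theorem hasDerivWithinAt_dx (h : IsGlobalSmoothSolution u lm lp) {k : ℕ} {t x : ℝ} (ht : 0 ≤ t)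
    (hk : 0 < t ∨ k < 2) (hx : x ∈ Icc (lm t) (lp t)) :
    HasDerivWithinAt (dx u lm lp k t) (dx u lm lp (k + 1) t x) (Icc (lm t) (lp t)) x := by
  have hd : DifferentiableWithinAt ℝ (dx u lm lp k t) (Icc (lm t) (lp t)) x := by
    rcases ht.lt_or_eq with h0 | rfl
    · exact (hasDerivWithinAt_slice (F := fun p : ℝ × ℝ => dx u lm lp k p.1 p.2) h0
        ((h.contDiffOn_dx k).differentiableOn (by simp) (t, x) ⟨h0, hx⟩)).differentiableWithinAt
    · exact h.initial_smooth.differentiableOn_iteratedDerivWithin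
        (by exact_mod_cast hk.resolve_left (lt_irrefl _)) (uniqueDiffOn_Icc (h.lt 0 le_rfl)) x hx
  have := hd.hasDerivWithinAt
  rwa [dx, iteratedDerivWithin_succ]

theorem hasDerivAt_dx (h : IsGlobalSmoothSolution u lm lp) {k : ℕ} {t x : ℝ} (ht : 0 ≤ t)
    (hk : 0 < t ∨ k < 2) (hx : x ∈ Ioo (lm t) (lp t)) :
    HasDerivAt (dx u lm lp k t) (dx u lm lp (k + 1) t x) x :=
  (h.hasDerivWithinAt_dx ht hk (Ioo_subset_Icc_self hx)).hasDerivAt (Icc_mem_nhds hx.1 hx.2)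

theorem dx_zero (t x : ℝ) : dx u lm lp 0 t x = u t x := by simp [dx]

theorem continuousOn_dx_slice (h : IsGlobalSmoothSolution u lm lp) {k : ℕ} {t : ℝ} (ht : 0 ≤ t)
    (hk : 0 < t ∨ k ≤ 2) : ContinuousOn (dx u lm lp k t) (Icc (lm t) (lp t)) := by
  rcases hk with h0 | hk
  · exact fun x hx => (h.hasDerivWithinAt_dx ht (Or.inl h0) hx).continuousWithinAt
  · exact (h.dx_continuousOn k hk).comp (f := fun x => (t, x)) (by fun_prop) fun x hx => ⟨ht, hx⟩

theorem iteratedDeriv_eq_dx (h : IsGlobalSmoothSolution u lm lp) (k : ℕ) {t x : ℝ} (ht : 0 < t)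
    (hx : x ∈ Ioo (lm t) (lp t)) : iteratedDeriv k (u t) x = dx u lm lp k t x := by
  induction k generalizing x with
  | zero => simp [dx]
  | succ k ih =>
    rw [iteratedDeriv_succ]
    have : iteratedDeriv k (u t) =ᶠ[𝓝 x] dx u lm lp k t := by
      filter_upwards [isOpen_Ioo.mem_nhds hx] with z hz using ih hz
    rw [this.deriv_eq, (h.hasDerivAt_dx ht.le (Or.inl ht) hx).deriv]

theorem hasFDerivWithinAt_dx (h : IsGlobalSmoothSolution u lm lp) (k : ℕ) {t x : ℝ} (ht : 0 < t)
    (hx : x ∈ Icc (lm t) (lp t)) :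
    HasFDerivWithinAt (fun p : ℝ × ℝ => dx u lm lp k p.1 p.2)
      (dtx u lm lp k t x • ContinuousLinearMap.fst ℝ ℝ ℝ +
        dx u lm lp (k + 1) t x • ContinuousLinearMap.snd ℝ ℝ ℝ) (dom lm lp) (t, x) := by
  have hd := (h.contDiffOn_dx k).differentiableOn (by simp) (t, x) ⟨ht, hx⟩
  have e := ((hasDerivWithinAt_slice (F := fun p : ℝ × ℝ => dx u lm lp k p.1 p.2) ht
    hd).derivWithin (uniqueDiffOn_Icc (h.lt t ht.le) x hx)).symm.trans
    ((h.hasDerivWithinAt_dx ht.le (Or.inl ht) hx).derivWithin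
      (uniqueDiffOn_Icc (h.lt t ht.le) x hx))
  refine hd.hasFDerivWithinAt.congr_fderiv ?_
  ext
  · simp [dtx]
  · simpa using e

theorem hasFDerivAt_dx (h : IsGlobalSmoothSolution u lm lp) (k : ℕ) {t x : ℝ} (ht : 0 < t)
    (hx : x ∈ Ioo (lm t) (lp t)) :
    HasFDerivAt (fun p : ℝ × ℝ => dx u lm lp k p.1 p.2)
      (dtx u lm lp k t x • ContinuousLinearMap.fst ℝ ℝ ℝ +
        dx u lm lp (k + 1) t x • ContinuousLinearMap.snd ℝ ℝ ℝ) (t, x) :=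
  (h.hasFDerivWithinAt_dx k ht (Ioo_subset_Icc_self hx)).hasFDerivAt
    (mem_of_superset (h.isOpen_inn.mem_nhds ⟨ht, hx⟩) inn_subset_dom)

theorem contDiffOn_dtx (h : IsGlobalSmoothSolution u lm lp) (k : ℕ) :
    ContDiffOn ℝ ∞ (fun p : ℝ × ℝ => dtx u lm lp k p.1 p.2) (dom lm lp) :=
  ((h.contDiffOn_dx k).fderivWithin h.uniqueDiffOn_dom (by simp)).clm_apply contDiffOn_const

/-- Chain rule along a curve in the closed positivity set. -/
theorem hasDerivAt_dx_curve (h : IsGlobalSmoothSolution u lm lp) (k : ℕ) {t c' : ℝ} {c : ℝ → ℝ}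
    (ht : 0 < t) (hc : HasDerivAt c c' t) (hmem : ∀ s, 0 < s → c s ∈ Icc (lm s) (lp s)) :
    HasDerivAt (fun s => dx u lm lp k s (c s))
      (dtx u lm lp k t (c t) + dx u lm lp (k + 1) t (c t) * c') t := by
  have d := (h.hasFDerivWithinAt_dx k ht (hmem t ht)).comp_hasDerivWithinAt (s := Ioi 0) t
    ((hasDerivAt_id' t).prodMk hc).hasDerivWithinAt fun s (hs : 0 < s) =>
      (⟨hs, hmem s hs⟩ : (s, c s) ∈ dom lm lp)
  refine (d.hasDerivAt (Ioi_mem_nhds ht)).congr_deriv ?_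
  simp

/-! ### The equation up to the boundary and its consequences at the contact points -/

theorem eq_on_Icc_of_eq_on_Ioo {f g : ℝ → ℝ} {a b : ℝ} (hab : a < b)
    (hf : ContinuousOn f (Icc a b)) (hg : ContinuousOn g (Icc a b)) (he : EqOn f g (Ioo a b)) :
    EqOn f g (Icc a b) :=
  he.of_subset_closure hf hg Ioo_subset_Icc_self (by rw [closure_Ioo hab.ne])

theorem dtx_zero_inn (h : IsGlobalSmoothSolution u lm lp) {t x : ℝ} (ht : 0 < t)
    (hx : x ∈ Ioo (lm t) (lp t)) :
    dtx u lm lp 0 t x = -(dx u lm lp 1 t x * dx u lm lp 3 t x +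
      dx u lm lp 0 t x * dx u lm lp 4 t x) := by
  have e := h.eqn t ht x hx
  have e1 : deriv (fun s => u s x) t = dtx u lm lp 0 t x := by
    have d := (h.hasFDerivAt_dx 0 ht hx).comp_hasDerivAt t
      ((hasDerivAt_id' t).prodMk (hasDerivAt_const t x))
    simpa [Function.comp_def, dx_zero] using d.deriv
  have e2 : deriv (fun z => u t z * iteratedDeriv 3 (u t) z) x =
      dx u lm lp 1 t x * dx u lm lp 3 t x + dx u lm lp 0 t x * dx u lm lp 4 t x := by
    have ev : (fun z => u t z * iteratedDeriv 3 (u t) z) =ᶠ[𝓝 x]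
        fun z => dx u lm lp 0 t z * dx u lm lp 3 t z := by
      filter_upwards [isOpen_Ioo.mem_nhds hx] with z hz
      rw [h.iteratedDeriv_eq_dx 3 ht hz, dx_zero]
    rw [ev.deriv_eq]
    exact ((h.hasDerivAt_dx (k := 0) ht.le (Or.inl ht) hx).fun_mul
      (h.hasDerivAt_dx (k := 3) ht.le (Or.inl ht) hx)).deriv
  rw [e1, e2] at e
  linarith

theorem dtx_slice_continuousOn (h : IsGlobalSmoothSolution u lm lp) (k : ℕ) {t : ℝ} (ht : 0 < t) :
    ContinuousOn (dtx u lm lp k t) (Icc (lm t) (lp t)) :=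
  (h.contDiffOn_dtx k).continuousOn.comp (f := fun x => (t, x)) (by fun_prop) fun x hx => ⟨ht, hx⟩

theorem dtx_zero (h : IsGlobalSmoothSolution u lm lp) {t x : ℝ} (ht : 0 < t)
    (hx : x ∈ Icc (lm t) (lp t)) :
    dtx u lm lp 0 t x = -(dx u lm lp 1 t x * dx u lm lp 3 t x +
      dx u lm lp 0 t x * dx u lm lp 4 t x) := by
  have c : ∀ k, ContinuousOn (dx u lm lp k t) (Icc (lm t) (lp t)) :=
    fun k => h.continuousOn_dx_slice ht.le (Or.inl ht)
  exact eq_on_Icc_of_eq_on_Ioo (h.lt t ht.le) (h.dtx_slice_continuousOn 0 ht)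
    (((c 1).mul (c 3)).add ((c 0).mul (c 4))).neg (fun z hz => h.dtx_zero_inn ht hz) hx

/-- Differentiate the equation in x and exchange ∂_t with ∂_x by the symmetry of second derivatives.
-/
theorem dtx_one_inn (h : IsGlobalSmoothSolution u lm lp) {t x : ℝ} (ht : 0 < t)
    (hx : x ∈ Ioo (lm t) (lp t)) :
    dtx u lm lp 1 t x = -(dx u lm lp 2 t x * dx u lm lp 3 t x +
      2 * (dx u lm lp 1 t x * dx u lm lp 4 t x) + dx u lm lp 0 t x * dx u lm lp 5 t x) := by
  set F : ℝ × ℝ → ℝ := fun p => dx u lm lp 0 p.1 p.2 with hF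
  have hp : (t, x) ∈ inn lm lp := ⟨ht, hx⟩
  have nh := h.isOpen_inn.mem_nhds hp
  have hc : ContDiffAt ℝ 2 F (t, x) :=
    (((h.contDiffOn_dx 0).mono inn_subset_dom).contDiffAt nh).of_le (WithTop.coe_le_coe.2 le_top)
  have fd : ∀ p ∈ inn lm lp, fderiv ℝ F p = dtx u lm lp 0 p.1 p.2 • ContinuousLinearMap.fst ℝ ℝ ℝ +
      dx u lm lp 1 p.1 p.2 • ContinuousLinearMap.snd ℝ ℝ ℝ :=
    fun p hp => (h.hasFDerivAt_dx 0 hp.1 hp.2).fderiv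
  have comm := fderiv_fderiv_comm hc (0, 1) (1, 0)
  have e1 : (fun q => fderiv ℝ F q (0, 1)) =ᶠ[𝓝 (t, x)] fun p => dx u lm lp 1 p.1 p.2 := by
    filter_upwards [nh] with p hp
    rw [fd p hp]; simp
  have e2 : (fun q => fderiv ℝ F q (1, 0)) =ᶠ[𝓝 (t, x)] fun p =>
      -(dx u lm lp 1 p.1 p.2 * dx u lm lp 3 p.1 p.2 +
      dx u lm lp 0 p.1 p.2 * dx u lm lp 4 p.1 p.2) := by
    filter_upwards [nh] with p hp
    rw [fd p hp, ← h.dtx_zero_inn hp.1 hp.2]; simp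
  rw [e1.fderiv_eq, e2.fderiv_eq, (h.hasFDerivAt_dx 1 ht hx).fderiv] at comm
  have D := (((h.hasFDerivAt_dx 1 ht hx).fun_mul (h.hasFDerivAt_dx 3 ht hx)).fun_add
    ((h.hasFDerivAt_dx 0 ht hx).fun_mul (h.hasFDerivAt_dx 4 ht hx))).fun_neg
  rw [D.fderiv] at comm
  simp at comm
  rw [comm]
  ring

theorem dtx_one (h : IsGlobalSmoothSolution u lm lp) {t x : ℝ} (ht : 0 < t)
    (hx : x ∈ Icc (lm t) (lp t)) :
    dtx u lm lp 1 t x = -(dx u lm lp 2 t x * dx u lm lp 3 t x +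
      2 * (dx u lm lp 1 t x * dx u lm lp 4 t x) + dx u lm lp 0 t x * dx u lm lp 5 t x) := by
  have c : ∀ k, ContinuousOn (dx u lm lp k t) (Icc (lm t) (lp t)) :=
    fun k => h.continuousOn_dx_slice ht.le (Or.inl ht)
  exact eq_on_Icc_of_eq_on_Ioo (h.lt t ht.le) (h.dtx_slice_continuousOn 1 ht)
    ((((c 2).mul (c 3)).add (((c 1).mul (c 4)).const_mul 2)).add ((c 0).mul (c 5))).neg
    (fun z hz => h.dtx_one_inn ht hz) hx

theorem left_mem (h : IsGlobalSmoothSolution u lm lp) {t : ℝ} (ht : 0 ≤ t) :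
    lm t ∈ Icc (lm t) (lp t) := left_mem_Icc.2 (h.lt t ht).le

theorem right_mem (h : IsGlobalSmoothSolution u lm lp) {t : ℝ} (ht : 0 ≤ t) :
    lp t ∈ Icc (lm t) (lp t) := right_mem_Icc.2 (h.lt t ht).le

theorem nonneg (h : IsGlobalSmoothSolution u lm lp) {t x : ℝ} (ht : 0 ≤ t)
    (hx : x ∈ Icc (lm t) (lp t)) : 0 ≤ u t x := by
  rcases hx.1.eq_or_lt with rfl | h1
  · exact (h.left_zero t ht).ge
  rcases hx.2.eq_or_lt with rfl | h2
  · exact (h.right_zero t ht).ge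
  exact (h.pos t ht x ⟨h1, h2⟩).le

/-- The sign left open by |u_x| = 1 is decided by u ≥ 0 in the difference quotients. -/
theorem dx_one_left (h : IsGlobalSmoothSolution u lm lp) {t : ℝ} (ht : 0 ≤ t) :
    dx u lm lp 1 t (lm t) = 1 := by
  have d := h.hasDerivWithinAt_dx (k := 0) ht (Or.inr two_pos) (h.left_mem ht)
  have d' := d.mono_of_mem_nhdsWithin (Icc_mem_nhdsGT (h.lt t ht))
  rw [hasDerivWithinAt_iff_tendsto_slope' (by simp)] at d'
  have : 0 ≤ dx u lm lp 1 t (lm t) := by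
    refine ge_of_tendsto d' ?_
    filter_upwards [Ioo_mem_nhdsGT (h.lt t ht)] with z hz
    rw [slope_def_field, dx_zero, dx_zero, h.left_zero t ht, sub_zero]
    exact div_nonneg (h.nonneg ht (Ioo_subset_Icc_self hz)) (by linarith [hz.1])
  rw [← abs_of_nonneg this, h.left_angle t ht]

theorem dx_one_right (h : IsGlobalSmoothSolution u lm lp) {t : ℝ} (ht : 0 ≤ t) :
    dx u lm lp 1 t (lp t) = -1 := by
  have d := h.hasDerivWithinAt_dx (k := 0) ht (Or.inr two_pos) (h.right_mem ht)
  have d' := d.mono_of_mem_nhdsWithin (Icc_mem_nhdsLT (h.lt t ht))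
  rw [hasDerivWithinAt_iff_tendsto_slope' (by simp)] at d'
  have : dx u lm lp 1 t (lp t) ≤ 0 := by
    refine le_of_tendsto d' ?_
    filter_upwards [Ioo_mem_nhdsLT (h.lt t ht)] with z hz
    rw [slope_def_field, dx_zero, dx_zero, h.right_zero t ht, sub_zero]
    exact div_nonpos_of_nonneg_of_nonpos (h.nonneg ht (Ioo_subset_Icc_self hz))
      (by linarith [hz.2])
  have a := h.right_angle t ht
  rw [abs_of_nonpos this] at a
  linarith

theorem dx_three_left (h : IsGlobalSmoothSolution u lm lp) {t : ℝ} (ht : 0 < t) :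
    dx u lm lp 3 t (lm t) = deriv lm t := by
  have hlt := h.lt t ht.le
  have c := (h.continuousOn_dx_slice (k := 3) ht.le (Or.inl ht) _ (h.left_mem ht.le)).mono
    Ioo_subset_Icc_self
  have : (𝓝[Ioo (lm t) (lp t)] (lm t)).NeBot := by
    rw [nhdsWithin_Ioo_eq_nhdsGT hlt]; infer_instance
  refine tendsto_nhds_unique_of_eventuallyEq c (h.left_velocity t ht) ?_
  filter_upwards [self_mem_nhdsWithin] with z hz
  exact (h.iteratedDeriv_eq_dx 3 ht hz).symm

theorem dx_three_right (h : IsGlobalSmoothSolution u lm lp) {t : ℝ} (ht : 0 < t) :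
    dx u lm lp 3 t (lp t) = deriv lp t := by
  have hlt := h.lt t ht.le
  have c := (h.continuousOn_dx_slice (k := 3) ht.le (Or.inl ht) _ (h.right_mem ht.le)).mono
    Ioo_subset_Icc_self
  have : (𝓝[Ioo (lm t) (lp t)] (lp t)).NeBot := by
    rw [nhdsWithin_Ioo_eq_nhdsLT hlt]; infer_instance
  refine tendsto_nhds_unique_of_eventuallyEq c (h.right_velocity t ht) ?_
  filter_upwards [self_mem_nhdsWithin] with z hz
  exact (h.iteratedDeriv_eq_dx 3 ht hz).symm

/-- The derivative of u_x = 1 along the contact point gives u_xt + u_xx u_xxx = 0, because the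
contact point moves with speed u_xxx. The differentiated equation at u = 0 reads u_xt = -u_xx u_xxx
- 2 u_x u_xxxx, and only the last term remains. This is what removes the boundary terms in the
energy identity. -/
theorem dx_four_left (h : IsGlobalSmoothSolution u lm lp) {t : ℝ} (ht : 0 < t) :
    dx u lm lp 4 t (lm t) = 0 := by
  have d := h.hasDerivAt_dx_curve 1 ht (h.hasDerivAt_lm ht) fun s hs => h.left_mem hs.le
  have ev : (fun s => dx u lm lp 1 s (lm s)) =ᶠ[𝓝 t] fun _ => 1 := by
    filter_upwards [Ioi_mem_nhds ht] with s hs using h.dx_one_left (le_of_lt hs)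
  have e := d.deriv
  rw [ev.deriv_eq, deriv_const, h.dtx_one ht (h.left_mem ht.le), h.dx_three_left ht,
    h.dx_one_left ht.le, dx_zero, h.left_zero t ht.le] at e
  linarith

theorem dx_four_right (h : IsGlobalSmoothSolution u lm lp) {t : ℝ} (ht : 0 < t) :
    dx u lm lp 4 t (lp t) = 0 := by
  have d := h.hasDerivAt_dx_curve 1 ht (h.hasDerivAt_lp ht) fun s hs => h.right_mem hs.le
  have ev : (fun s => dx u lm lp 1 s (lp s)) =ᶠ[𝓝 t] fun _ => -1 := by
    filter_upwards [Ioi_mem_nhds ht] with s hs using h.dx_one_right (le_of_lt hs)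
  have e := d.deriv
  rw [ev.deriv_eq, deriv_const, h.dtx_one ht (h.right_mem ht.le), h.dx_three_right ht,
    h.dx_one_right ht.le, dx_zero, h.right_zero t ht.le] at e
  linarith

end IsGlobalSmoothSolution

/-! ### Integrals over the moving interval -/

theorem hasDerivAt_integral_of_jointly_continuous {G G' : ℝ → ℝ → ℝ} {t η : ℝ} (ht : 0 < t)
    (hη : η ∈ Icc (0 : ℝ) 1)
    (hc : ∀ t, 0 < t → ContinuousOn (G t) (Icc 0 1))
    (hd : ∀ t, 0 < t → ∀ s ∈ Icc (0 : ℝ) 1, HasDerivAt (fun t => G t s) (G' t s) t)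
    (hG' : ContinuousOn (fun p : ℝ × ℝ => G' p.1 p.2) (Ioi 0 ×ˢ Icc 0 1)) :
    HasDerivAt (fun t => ∫ s in (0 : ℝ)..η, G t s) (∫ s in (0 : ℝ)..η, G' t s) t := by
  have sub : uIoc 0 η ⊆ Icc (0 : ℝ) 1 := by
    rw [uIoc_of_le hη.1]
    exact fun s hs => ⟨hs.1.le, hs.2.trans hη.2⟩
  have sub' : uIcc 0 η ⊆ Icc (0 : ℝ) 1 := by
    rw [uIcc_of_le hη.1]
    exact Icc_subset_Icc_right hη.2
  have hK : IsCompact (Icc (t / 2) (2 * t) ×ˢ Icc (0 : ℝ) 1) := isCompact_Icc.prod isCompact_Icc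
  obtain ⟨C, hC⟩ := hK.exists_bound_of_continuousOn (f := fun p : ℝ × ℝ => G' p.1 p.2)
    (hG'.mono (prod_mono (fun s hs => lt_of_lt_of_le (by positivity) hs.1) subset_rfl))
  have hpos : ∀ x ∈ Icc (t / 2) (2 * t), 0 < x := fun x hx => lt_of_lt_of_le (by positivity) hx.1
  refine (intervalIntegral.hasDerivAt_integral_of_dominated_loc_of_deriv_le (bound := fun _ => C)
    (Icc_mem_nhds (show t / 2 < t by linarith) (show t < 2 * t by linarith)) ?_ ?_ ?_ ?_ ?_ ?_).2
  · filter_upwards [Ioi_mem_nhds ht] with x hx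
    exact ((hc x hx).mono sub).aestronglyMeasurable measurableSet_uIoc
  · exact ((hc t ht).mono sub').intervalIntegrable
  · have : ContinuousOn (G' t) (Icc 0 1) :=
      hG'.comp (f := fun s => (t, s)) (by fun_prop) fun s hs => ⟨ht, hs⟩
    exact (this.mono sub).aestronglyMeasurable measurableSet_uIoc
  · exact Eventually.of_forall fun s hs x hx => hC (x, s) ⟨hx, sub hs⟩
  · exact intervalIntegrable_const
  · exact Eventually.of_forall fun s hs x hx => hd x (hpos x hx) s (sub hs)

theorem continuousOn_integral_of_jointly_continuous {G : ℝ → ℝ → ℝ} {η : ℝ}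
    (hη : η ∈ Icc (0 : ℝ) 1)
    (hG : ContinuousOn (fun p : ℝ × ℝ => G p.1 p.2) (Ici 0 ×ˢ Icc 0 1)) :
    ContinuousOn (fun t => ∫ s in (0 : ℝ)..η, G t s) (Ici 0) := by
  intro t ht
  have ht : 0 ≤ t := ht
  have sub : uIoc 0 η ⊆ Icc (0 : ℝ) 1 := by
    rw [uIoc_of_le hη.1]
    exact fun s hs => ⟨hs.1.le, hs.2.trans hη.2⟩
  have hK : IsCompact (Icc 0 (t + 1) ×ˢ Icc (0 : ℝ) 1) := isCompact_Icc.prod isCompact_Icc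
  obtain ⟨C, hC⟩ := hK.exists_bound_of_continuousOn (f := fun p : ℝ × ℝ => G p.1 p.2)
    (hG.mono (prod_mono (fun s hs => hs.1) subset_rfl))
  refine intervalIntegral.continuousWithinAt_of_dominated_interval (bound := fun _ => C) ?_ ?_ ?_ ?_
  · filter_upwards [self_mem_nhdsWithin] with x hx
    have : ContinuousOn (G x) (Icc 0 1) :=
      hG.comp (f := fun s => (x, s)) (by fun_prop) fun s hs => ⟨hx, hs⟩
    exact (this.mono sub).aestronglyMeasurable measurableSet_uIoc
  · filter_upwards [self_mem_nhdsWithin, mem_nhdsWithin_of_mem_nhds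
      (Iio_mem_nhds (show t < t + 1 by linarith))] with x hx hx'
    exact Eventually.of_forall fun s hs => hC (x, s) ⟨⟨hx, le_of_lt hx'⟩, sub hs⟩
  · exact intervalIntegrable_const
  · refine Eventually.of_forall fun s hs => ?_
    exact hG.comp (f := fun x => (x, s)) (by fun_prop) (fun x hx => ⟨hx, sub hs⟩) t ht

/-- The point with relative position `s` in the interval `[lm t, lp t]`. -/
def pt (lm lp : ℝ → ℝ) (t s : ℝ) : ℝ := lm t + s * (lp t - lm t)

/-- The velocity of the point with relative position `s`. -/
def ptVel (lm lp : ℝ → ℝ) (t s : ℝ) : ℝ := deriv lm t + s * (deriv lp t - deriv lm t)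

/-- The mass in `[lm t, x]`. -/
def cum (u : ℝ → ℝ → ℝ) (lm : ℝ → ℝ) (t x : ℝ) : ℝ := ∫ z in (lm t)..x, u t z

/-! ### Conservation of mass and first moment -/

namespace IsGlobalSmoothSolution

variable {u : ℝ → ℝ → ℝ} {lm lp : ℝ → ℝ}

theorem pt_mem (h : IsGlobalSmoothSolution u lm lp) {t s : ℝ} (ht : 0 ≤ t) (hs : s ∈ Icc (0 : ℝ) 1) :
    pt lm lp t s ∈ Icc (lm t) (lp t) := by
  have := h.lt t ht
  obtain ⟨h0, h1⟩ := hs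
  constructor <;> unfold pt <;> nlinarith

theorem pt_mem_Ioo (h : IsGlobalSmoothSolution u lm lp) {t s : ℝ} (ht : 0 ≤ t)
    (hs : s ∈ Ioo (0 : ℝ) 1) : pt lm lp t s ∈ Ioo (lm t) (lp t) := by
  have := h.lt t ht
  obtain ⟨h0, h1⟩ := hs
  constructor <;> unfold pt <;> nlinarith

theorem pt_zero (t : ℝ) : pt lm lp t 0 = lm t := by simp [pt]

theorem pt_one (t : ℝ) : pt lm lp t 1 = lp t := by simp [pt]

theorem continuousOn_pt (h : IsGlobalSmoothSolution u lm lp) :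
    ContinuousOn (fun p : ℝ × ℝ => pt lm lp p.1 p.2) (Ici 0 ×ˢ Icc 0 1) := by
  have c1 : ContinuousOn (fun p : ℝ × ℝ => lm p.1) (Ici 0 ×ˢ Icc 0 1) :=
    h.lm_continuousOn.comp continuousOn_fst fun p hp => hp.1
  have c2 : ContinuousOn (fun p : ℝ × ℝ => lp p.1) (Ici 0 ×ˢ Icc 0 1) :=
    h.lp_continuousOn.comp continuousOn_fst fun p hp => hp.1
  exact c1.add (continuousOn_snd.mul (c2.sub c1))

theorem continuousOn_ptVel (h : IsGlobalSmoothSolution u lm lp) :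
    ContinuousOn (fun p : ℝ × ℝ => ptVel lm lp p.1 p.2) (Ioi 0 ×ˢ Icc 0 1) := by
  have c1 : ContinuousOn (fun p : ℝ × ℝ => deriv lm p.1) (Ioi 0 ×ˢ Icc 0 1) :=
    (h.lm_smooth.continuousOn_deriv_of_isOpen isOpen_Ioi (by simp)).comp continuousOn_fst
      fun p hp => hp.1
  have c2 : ContinuousOn (fun p : ℝ × ℝ => deriv lp p.1) (Ioi 0 ×ˢ Icc 0 1) :=
    (h.lp_smooth.continuousOn_deriv_of_isOpen isOpen_Ioi (by simp)).comp continuousOn_fst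
      fun p hp => hp.1
  exact c1.add (continuousOn_snd.mul (c2.sub c1))

theorem hasDerivAt_pt (h : IsGlobalSmoothSolution u lm lp) {t : ℝ} (s : ℝ) (ht : 0 < t) :
    HasDerivAt (fun t => pt lm lp t s) (ptVel lm lp t s) t :=
  (h.hasDerivAt_lm ht).fun_add (((h.hasDerivAt_lp ht).fun_sub (h.hasDerivAt_lm ht)).const_mul s)

theorem hasDerivAt_pt_snd (t s : ℝ) : HasDerivAt (pt lm lp t) (lp t - lm t) s :=
  (((hasDerivAt_id' s).mul_const _).const_add _).congr_deriv (one_mul _)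

theorem hasDerivAt_ptVel_snd (t s : ℝ) :
    HasDerivAt (ptVel lm lp t) (deriv lp t - deriv lm t) s :=
  (((hasDerivAt_id' s).mul_const _).const_add _).congr_deriv (one_mul _)

theorem continuousOn_dx_pt (h : IsGlobalSmoothSolution u lm lp) {k : ℕ} (hk : k ≤ 2) :
    ContinuousOn (fun p : ℝ × ℝ => dx u lm lp k p.1 (pt lm lp p.1 p.2)) (Ici 0 ×ˢ Icc 0 1) :=
  (h.dx_continuousOn k hk).comp (f := fun p : ℝ × ℝ => (p.1, pt lm lp p.1 p.2))
    (continuousOn_fst.prodMk h.continuousOn_pt) fun _ hp => ⟨hp.1, h.pt_mem hp.1 hp.2⟩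

theorem continuousOn_dx_pt_pos (h : IsGlobalSmoothSolution u lm lp) (k : ℕ) :
    ContinuousOn (fun p : ℝ × ℝ => dx u lm lp k p.1 (pt lm lp p.1 p.2)) (Ioi 0 ×ˢ Icc 0 1) :=
  (h.contDiffOn_dx k).continuousOn.comp (f := fun p : ℝ × ℝ => (p.1, pt lm lp p.1 p.2))
    (continuousOn_fst.prodMk (h.continuousOn_pt.mono (prod_mono Ioi_subset_Ici_self subset_rfl)))
    fun _ hp => ⟨hp.1, h.pt_mem (le_of_lt hp.1) hp.2⟩

theorem continuousOn_dtx_pt_pos (h : IsGlobalSmoothSolution u lm lp) (k : ℕ) :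
    ContinuousOn (fun p : ℝ × ℝ => dtx u lm lp k p.1 (pt lm lp p.1 p.2)) (Ioi 0 ×ˢ Icc 0 1) :=
  (h.contDiffOn_dtx k).continuousOn.comp (f := fun p : ℝ × ℝ => (p.1, pt lm lp p.1 p.2))
    (continuousOn_fst.prodMk (h.continuousOn_pt.mono (prod_mono Ioi_subset_Ici_self subset_rfl)))
    fun _ hp => ⟨hp.1, h.pt_mem (le_of_lt hp.1) hp.2⟩

/-- The integrand of the mass in relative coordinates. -/
def massDensity (u : ℝ → ℝ → ℝ) (lm lp : ℝ → ℝ) (t s : ℝ) : ℝ :=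
  (lp t - lm t) * dx u lm lp 0 t (pt lm lp t s)

/-- The time derivative of the mass density in relative coordinates. -/
def massDensityDt (u : ℝ → ℝ → ℝ) (lm lp : ℝ → ℝ) (t s : ℝ) : ℝ :=
  (deriv lp t - deriv lm t) * dx u lm lp 0 t (pt lm lp t s) + (lp t - lm t) *
    (dtx u lm lp 0 t (pt lm lp t s) + dx u lm lp 1 t (pt lm lp t s) * ptVel lm lp t s)

/-- The mass flux through the point with relative position `s`. -/
def massFlux (u : ℝ → ℝ → ℝ) (lm lp : ℝ → ℝ) (t s : ℝ) : ℝ :=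
  ptVel lm lp t s * dx u lm lp 0 t (pt lm lp t s) -
    dx u lm lp 0 t (pt lm lp t s) * dx u lm lp 3 t (pt lm lp t s)

theorem hasDerivAt_massDensity (h : IsGlobalSmoothSolution u lm lp) {t s : ℝ} (ht : 0 < t)
    (hs : s ∈ Icc (0 : ℝ) 1) :
    HasDerivAt (fun t => massDensity u lm lp t s) (massDensityDt u lm lp t s) t :=
  ((h.hasDerivAt_lp ht).fun_sub (h.hasDerivAt_lm ht)).fun_mul
    (h.hasDerivAt_dx_curve 0 ht (h.hasDerivAt_pt s ht) fun _ hr => h.pt_mem hr.le hs)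

theorem continuousOn_length (h : IsGlobalSmoothSolution u lm lp) :
    ContinuousOn (fun p : ℝ × ℝ => lp p.1 - lm p.1) (Ici 0 ×ˢ Icc 0 1) :=
  (h.lp_continuousOn.comp continuousOn_fst fun _ hp => hp.1).sub
    (h.lm_continuousOn.comp continuousOn_fst fun _ hp => hp.1)

theorem continuousOn_length_deriv (h : IsGlobalSmoothSolution u lm lp) :
    ContinuousOn (fun p : ℝ × ℝ => deriv lp p.1 - deriv lm p.1) (Ioi 0 ×ˢ Icc 0 1) :=
  ((h.lp_smooth.continuousOn_deriv_of_isOpen isOpen_Ioi (by simp)).comp continuousOn_fst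
    fun _ hp => hp.1).sub ((h.lm_smooth.continuousOn_deriv_of_isOpen isOpen_Ioi (by simp)).comp
    continuousOn_fst fun _ hp => hp.1)

theorem continuousOn_massDensity (h : IsGlobalSmoothSolution u lm lp) :
    ContinuousOn (fun p : ℝ × ℝ => massDensity u lm lp p.1 p.2) (Ici 0 ×ˢ Icc 0 1) :=
  h.continuousOn_length.mul (h.continuousOn_dx_pt (by norm_num))

theorem continuousOn_massDensityDt (h : IsGlobalSmoothSolution u lm lp) :
    ContinuousOn (fun p : ℝ × ℝ => massDensityDt u lm lp p.1 p.2) (Ioi 0 ×ˢ Icc 0 1) :=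
  (h.continuousOn_length_deriv.mul (h.continuousOn_dx_pt_pos 0)).add
    ((h.continuousOn_length.mono (prod_mono Ioi_subset_Ici_self subset_rfl)).mul
      ((h.continuousOn_dtx_pt_pos 0).add ((h.continuousOn_dx_pt_pos 1).mul h.continuousOn_ptVel)))

theorem slice {F : ℝ × ℝ → ℝ} {T : Set ℝ} {t : ℝ} (hF : ContinuousOn F (T ×ˢ Icc 0 1)) (ht : t ∈ T) :
    ContinuousOn (fun s => F (t, s)) (Icc 0 1) :=
  hF.comp (f := fun s => (t, s)) (by fun_prop) fun _ hs => ⟨ht, hs⟩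

theorem hasDerivAt_dx_pt (h : IsGlobalSmoothSolution u lm lp) (k : ℕ) {t s : ℝ} (ht : 0 < t)
    (hs : s ∈ Ioo (0 : ℝ) 1) :
    HasDerivAt (fun s => dx u lm lp k t (pt lm lp t s))
      (dx u lm lp (k + 1) t (pt lm lp t s) * (lp t - lm t)) s :=
  (h.hasDerivAt_dx ht.le (Or.inl ht) (h.pt_mem_Ioo ht.le hs)).comp s (hasDerivAt_pt_snd t s)

/-- The equation in conservation form: the net flux through a moving point is its velocity times u,
minus u u_xxx. -/
theorem hasDerivAt_massFlux (h : IsGlobalSmoothSolution u lm lp) {t s : ℝ} (ht : 0 < t)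
    (hs : s ∈ Ioo (0 : ℝ) 1) :
    HasDerivAt (massFlux u lm lp t) (massDensityDt u lm lp t s) s := by
  have d := h.hasDerivAt_dx_pt (t := t) (s := s)
  refine (((hasDerivAt_ptVel_snd t s).fun_mul (d 0 ht hs)).fun_sub
    ((d 0 ht hs).fun_mul (d 3 ht hs))).congr_deriv ?_
  rw [massDensityDt, h.dtx_zero ht (h.pt_mem ht.le (Ioo_subset_Icc_self hs))]
  ring

theorem continuousOn_massFlux (h : IsGlobalSmoothSolution u lm lp) :
    ContinuousOn (fun p : ℝ × ℝ => massFlux u lm lp p.1 p.2) (Ioi 0 ×ˢ Icc 0 1) :=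
  (h.continuousOn_ptVel.mul (h.continuousOn_dx_pt_pos 0)).sub
    ((h.continuousOn_dx_pt_pos 0).mul (h.continuousOn_dx_pt_pos 3))

theorem massFlux_zero (h : IsGlobalSmoothSolution u lm lp) {t : ℝ} (ht : 0 < t) :
    massFlux u lm lp t 0 = 0 := by
  simp [massFlux, pt_zero, dx_zero, h.left_zero t ht.le]

theorem massFlux_one (h : IsGlobalSmoothSolution u lm lp) {t : ℝ} (ht : 0 < t) :
    massFlux u lm lp t 1 = 0 := by
  simp [massFlux, pt_one, dx_zero, h.right_zero t ht.le]

theorem cum_pt (t η : ℝ) :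
    cum u lm t (pt lm lp t η) = ∫ s in (0 : ℝ)..η, massDensity u lm lp t s := by
  have := intervalIntegral.smul_integral_comp_add_mul (a := 0) (b := η) (u t) (lp t - lm t) (lm t)
  simp only [massDensity, dx_zero, intervalIntegral.integral_const_mul]
  rw [smul_eq_mul, mul_zero, add_zero] at this
  simp only [cum, pt, mul_comm _ (lp t - lm t)]
  exact this.symm

theorem hasDerivAt_cum_pt (h : IsGlobalSmoothSolution u lm lp) {t η : ℝ} (ht : 0 < t)
    (hη : η ∈ Icc (0 : ℝ) 1) :
    HasDerivAt (fun t => cum u lm t (pt lm lp t η)) (massFlux u lm lp t η) t := by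
  simp only [cum_pt]
  refine (hasDerivAt_integral_of_jointly_continuous ht hη
    (fun t ht => slice h.continuousOn_massDensity (le_of_lt ht))
    (fun t ht s hs => h.hasDerivAt_massDensity ht hs) h.continuousOn_massDensityDt).congr_deriv ?_
  have sub : Icc 0 η ⊆ Icc (0 : ℝ) 1 := Icc_subset_Icc_right hη.2
  have e := intervalIntegral.integral_eq_sub_of_hasDerivAt_of_le hη.1
    ((slice h.continuousOn_massFlux ht).mono sub)
    (fun s hs => h.hasDerivAt_massFlux ht ⟨hs.1, hs.2.trans_le hη.2⟩)
    (ContinuousOn.intervalIntegrable_of_Icc hη.1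
      ((slice h.continuousOn_massDensityDt ht).mono sub))
  simpa [h.massFlux_zero ht] using e

theorem continuousOn_cum_pt (h : IsGlobalSmoothSolution u lm lp) {η : ℝ} (hη : η ∈ Icc (0 : ℝ) 1) :
    ContinuousOn (fun t => cum u lm t (pt lm lp t η)) (Ici 0) := by
  simp only [cum_pt]
  exact continuousOn_integral_of_jointly_continuous hη h.continuousOn_massDensity

theorem eq_initial_of_deriv_zero {f : ℝ → ℝ} (hf : ContinuousOn f (Ici 0))
    (hd : ∀ t, 0 < t → HasDerivAt f 0 t) {t : ℝ} (ht : 0 ≤ t) : f t = f 0 :=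
  constant_of_has_deriv_right_zero (hf.mono Icc_subset_Ici_self) (fun s hs => by
    rcases hs.1.eq_or_lt with rfl | h0
    -- At time 0 the right derivative is obtained as the limit of the derivatives at positive times,
    -- using continuity at 0.
    · refine hasDerivWithinAt_Ici_of_tendsto_deriv (s := Ioi 0)
        (fun s hs => (hd s hs).differentiableAt.differentiableWithinAt)
        ((hf 0 (by simp)).mono Ioi_subset_Ici_self) self_mem_nhdsWithin ?_
      refine tendsto_const_nhds.congr' ?_
      filter_upwards [self_mem_nhdsWithin] with s hs using (hd s hs).deriv.symm
    · exact (hd s h0).hasDerivWithinAt) t (right_mem_Icc.2 ht)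

theorem mass_eq (h : IsGlobalSmoothSolution u lm lp) {t : ℝ} (ht : 0 ≤ t) :
    mass u lm lp t = mass u lm lp 0 := by
  have e : ∀ t, mass u lm lp t = cum u lm t (pt lm lp t 1) := fun t => by rw [pt_one]; rfl
  simp only [e]
  refine eq_initial_of_deriv_zero (h.continuousOn_cum_pt (by simp)) (fun t ht => ?_) ht
  simpa [h.massFlux_one ht] using h.hasDerivAt_cum_pt ht (η := 1) (by simp)

theorem centerOfMass_eq_integral (t : ℝ) : centerOfMass u lm lp t =
    ∫ s in (0 : ℝ)..1, pt lm lp t s * massDensity u lm lp t s := by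
  have := intervalIntegral.smul_integral_comp_add_mul (a := 0) (b := 1) (fun x => x * u t x)
    (lp t - lm t) (lm t)
  rw [smul_eq_mul, mul_zero, add_zero, mul_one, add_sub_cancel,
    ← intervalIntegral.integral_const_mul] at this
  rw [centerOfMass, ← this]
  congr 1; ext s
  simp only [pt, massDensity, dx_zero]
  ring_nf

/-- An antiderivative of the time derivative of the density of the center of mass. -/
def momentFlux (u : ℝ → ℝ → ℝ) (lm lp : ℝ → ℝ) (t s : ℝ) : ℝ :=
  pt lm lp t s * massFlux u lm lp t s + (dx u lm lp 0 t (pt lm lp t s) *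
    dx u lm lp 2 t (pt lm lp t s) - dx u lm lp 1 t (pt lm lp t s) ^ 2 / 2)

/-- The first moment changes at the rate ∫ u u_xxx, and u u_xxx = (u u_xx - u_x²/2)_x. At both
contact points u = 0 and u_x² = 1, so the two boundary values are equal and cancel. -/
theorem centerOfMass_eq (h : IsGlobalSmoothSolution u lm lp) {t : ℝ} (ht : 0 ≤ t) :
    centerOfMass u lm lp t = centerOfMass u lm lp 0 := by
  simp only [centerOfMass_eq_integral]
  have one : (1 : ℝ) ∈ Icc (0 : ℝ) 1 := by simp
  have pos : Ioi (0 : ℝ) ×ˢ Icc (0 : ℝ) 1 ⊆ Ici 0 ×ˢ Icc 0 1 :=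
    prod_mono Ioi_subset_Ici_self subset_rfl
  have cG := h.continuousOn_pt.mul h.continuousOn_massDensity
  have cG' := (h.continuousOn_ptVel.mul (h.continuousOn_massDensity.mono pos)).add
    ((h.continuousOn_pt.mono pos).mul h.continuousOn_massDensityDt)
  refine eq_initial_of_deriv_zero
    (continuousOn_integral_of_jointly_continuous (G := fun t s => pt lm lp t s *
      massDensity u lm lp t s) one cG) (fun t ht => ?_) ht
  refine (hasDerivAt_integral_of_jointly_continuous
    (G := fun t s => pt lm lp t s * massDensity u lm lp t s)
    (G' := fun t s => ptVel lm lp t s * massDensity u lm lp t s +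
      pt lm lp t s * massDensityDt u lm lp t s) ht one
    (fun t ht => slice cG (le_of_lt ht))
    (fun t ht s hs => (h.hasDerivAt_pt s ht).fun_mul (h.hasDerivAt_massDensity ht hs))
    cG').congr_deriv ?_
  have cM : ContinuousOn (momentFlux u lm lp t) (Icc 0 1) :=
    ((slice (h.continuousOn_pt.mono pos) ht).mul (slice h.continuousOn_massFlux ht)).add
      (((slice (h.continuousOn_dx_pt_pos 0) ht).mul (slice (h.continuousOn_dx_pt_pos 2) ht)).sub
        (((slice (h.continuousOn_dx_pt_pos 1) ht).pow 2).div_const 2))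
  have d := fun k s hs => h.hasDerivAt_dx_pt (t := t) (s := s) k ht hs
  refine (intervalIntegral.integral_eq_sub_of_hasDerivAt_of_le (f' := fun s =>
    ptVel lm lp t s * massDensity u lm lp t s + pt lm lp t s * massDensityDt u lm lp t s)
    zero_le_one cM (fun s hs => ?_)
    (ContinuousOn.intervalIntegrable_of_Icc zero_le_one (slice cG' ht))).trans ?_
  · refine (((hasDerivAt_pt_snd t s).fun_mul (h.hasDerivAt_massFlux ht hs)).fun_add
      (((d 0 s hs).fun_mul (d 2 s hs)).fun_sub
      (((d 1 s hs).fun_pow 2).div_const 2))).congr_deriv ?_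
    simp only [massDensity, massFlux]
    push_cast
    ring
  simp [momentFlux, h.massFlux_zero ht, h.massFlux_one ht, pt_zero, pt_one, dx_zero,
    h.left_zero t ht.le, h.right_zero t ht.le, h.dx_one_left ht.le, h.dx_one_right ht.le]

/-! ### The cumulated mass -/

theorem cum_left (t : ℝ) : cum u lm t (lm t) = 0 := by simp [cum]

theorem continuousOn_height (h : IsGlobalSmoothSolution u lm lp) {t : ℝ} (ht : 0 ≤ t) :
    ContinuousOn (u t) (Icc (lm t) (lp t)) := by
  have := h.continuousOn_dx_slice (k := 0) ht (Or.inr (by norm_num))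
  exact this.congr fun x _ => (dx_zero t x).symm

theorem hasDerivAt_cum (h : IsGlobalSmoothSolution u lm lp) {t x : ℝ} (ht : 0 ≤ t)
    (hx : x ∈ Ioo (lm t) (lp t)) : HasDerivAt (cum u lm t) (u t x) x := by
  have c := h.continuousOn_height ht
  refine intervalIntegral.integral_hasDerivAt_right
    (ContinuousOn.intervalIntegrable_of_Icc hx.1.le (c.mono (Icc_subset_Icc_right hx.2.le)))
    ((c.mono Ioo_subset_Icc_self).stronglyMeasurableAtFilter isOpen_Ioo x hx)
    (c.continuousAt (Icc_mem_nhds hx.1 hx.2))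

theorem continuousOn_cum (h : IsGlobalSmoothSolution u lm lp) {t : ℝ} (ht : 0 ≤ t) :
    ContinuousOn (cum u lm t) (Icc (lm t) (lp t)) := by
  have hle := (h.lt t ht).le
  have := intervalIntegral.continuousOn_primitive_interval' (a := lm t)
    (ContinuousOn.intervalIntegrable_of_Icc (μ := volume) hle (h.continuousOn_height ht))
    left_mem_uIcc
  rwa [uIcc_of_le hle] at this

theorem strictMonoOn_cum (h : IsGlobalSmoothSolution u lm lp) {t : ℝ} (ht : 0 ≤ t) :
    StrictMonoOn (cum u lm t) (Icc (lm t) (lp t)) := by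
  refine strictMonoOn_of_deriv_pos (convex_Icc _ _) (h.continuousOn_cum ht) fun x hx => ?_
  rw [interior_Icc] at hx
  rw [(h.hasDerivAt_cum ht hx).deriv]
  exact h.pos t ht x hx

/-- The derivatives of the cumulated mass in the interior. -/
theorem hasFDerivAt_cum (h : IsGlobalSmoothSolution u lm lp) {t x : ℝ} (ht : 0 < t)
    (hx : x ∈ Ioo (lm t) (lp t)) :
    HasFDerivAt (fun p : ℝ × ℝ => cum u lm p.1 p.2)
      ((-(dx u lm lp 0 t x * dx u lm lp 3 t x)) • ContinuousLinearMap.fst ℝ ℝ ℝ +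
        dx u lm lp 0 t x • ContinuousLinearMap.snd ℝ ℝ ℝ) (t, x) := by
  have hL : 0 < lp t - lm t := sub_pos.2 (h.lt t ht.le)
  set η : ℝ := (x - lm t) / (lp t - lm t) with hη
  have hη01 : η ∈ Ioo (0 : ℝ) 1 :=
    ⟨div_pos (by linarith [hx.1]) hL, (div_lt_one hL).2 (by linarith [hx.2])⟩
  have hpt : pt lm lp t η = x := by
    rw [pt, hη]; field_simp; ring
  have hopen : Ioi (0 : ℝ) ×ˢ Ioo (0 : ℝ) 1 ∈ 𝓝 (t, η) :=
    (isOpen_Ioi.prod isOpen_Ioo).mem_nhds ⟨ht, hη01⟩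
  have hnhds : Ioi (0 : ℝ) ×ˢ Icc (0 : ℝ) 1 ∈ 𝓝 (t, η) :=
    mem_of_superset hopen (prod_mono subset_rfl Ioo_subset_Icc_self)
  -- In relative coordinates the domain is a fixed rectangle and both partial derivatives are
  -- continuous, hence joint differentiability. It is carried back to (t, x) by composing with the
  -- relative position.
  have key := hasStrictFDerivAt_uncurry_coprod (𝕜 := ℝ) (u := (t, η))
    (f := fun t η => cum u lm t (pt lm lp t η))
    (f₁ := fun t η => ContinuousLinearMap.toSpanSingleton ℝ (massFlux u lm lp t η))
    (f₂ := fun t η => ContinuousLinearMap.toSpanSingleton ℝ (massDensity u lm lp t η))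
    (by
      filter_upwards [hopen] with p hp
      exact (h.hasDerivAt_cum_pt hp.1 (Ioo_subset_Icc_self hp.2)).hasFDerivAt)
    (by
      filter_upwards [hopen] with p hp
      have := (h.hasDerivAt_cum (le_of_lt hp.1) (h.pt_mem_Ioo (le_of_lt hp.1) hp.2)).comp p.2
        (hasDerivAt_pt_snd p.1 p.2)
      refine HasDerivAt.hasFDerivAt (f' := massDensity u lm lp p.1 p.2) ?_
      refine this.congr_deriv ?_
      rw [massDensity, dx_zero]; ring)
    ((ContinuousLinearMap.toSpanSingletonCLE (𝕜 := ℝ) (E := ℝ)).continuous.continuousAt.comp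
      (h.continuousOn_massFlux.continuousAt hnhds))
    ((ContinuousLinearMap.toSpanSingletonCLE (𝕜 := ℝ) (E := ℝ)).continuous.continuousAt.comp
      ((h.continuousOn_massDensity.mono
        (prod_mono Ioi_subset_Ici_self subset_rfl)).continuousAt hnhds))
  have d1 : DifferentiableAt ℝ (fun p : ℝ × ℝ => lm p.1) (t, x) :=
    (h.hasDerivAt_lm ht).differentiableAt.comp (t, x) differentiableAt_fst
  have d2 : DifferentiableAt ℝ (fun p : ℝ × ℝ => lp p.1) (t, x) :=
    (h.hasDerivAt_lp ht).differentiableAt.comp (t, x) differentiableAt_fst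
  have dl : DifferentiableAt ℝ (fun p : ℝ × ℝ => lp p.1 - lm p.1) (t, x) := d2.fun_sub d1
  have dn : DifferentiableAt ℝ (fun p : ℝ × ℝ => p.2 - lm p.1) (t, x) :=
    differentiableAt_snd.fun_sub d1
  have dq : DifferentiableAt ℝ (fun p : ℝ × ℝ => (p.2 - lm p.1) / (lp p.1 - lm p.1)) (t, x) := by
    simp only [div_eq_mul_inv]
    exact dn.fun_mul (dl.fun_inv hL.ne')
  have dg : DifferentiableAt ℝ
      (fun p : ℝ × ℝ => (p.1, (p.2 - lm p.1) / (lp p.1 - lm p.1))) (t, x) :=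
    differentiableAt_fst.prodMk dq
  have dc := (key.hasFDerivAt.differentiableAt).comp (t, x) dg
  have dcum : DifferentiableAt ℝ (fun p : ℝ × ℝ => cum u lm p.1 p.2) (t, x) := by
    refine dc.congr_of_eventuallyEq ?_
    filter_upwards [h.isOpen_inn.mem_nhds (show (t, x) ∈ inn lm lp from ⟨ht, hx⟩)] with p hp
    have : lp p.1 - lm p.1 ≠ 0 := (sub_pos.2 (h.lt p.1 (le_of_lt hp.1))).ne'
    simp only [Function.comp_apply, Function.HasUncurry.uncurry, id, pt]
    congr 1
    field_simp
    ring
  have e2 : fderiv ℝ (fun p : ℝ × ℝ => cum u lm p.1 p.2) (t, x) (0, 1) = u t x := by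
    have a := dcum.hasFDerivAt.comp_hasDerivAt x ((hasDerivAt_const x t).prodMk (hasDerivAt_id' x))
    exact a.unique (h.hasDerivAt_cum ht.le hx)
  -- Along a point with fixed relative position the derivative is the mass flux; subtracting
  -- velocity times u leaves the pure time derivative -u u_xxx.
  have e1 : fderiv ℝ (fun p : ℝ × ℝ => cum u lm p.1 p.2) (t, x) (1, ptVel lm lp t η) =
      massFlux u lm lp t η := by
    have b := (hasDerivAt_id' t).prodMk (h.hasDerivAt_pt η ht)
    have a := HasFDerivAt.comp_hasDerivAt (f := fun s => (s, pt lm lp s η)) t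
      (by simp only [hpt]; exact dcum.hasFDerivAt) b
    exact a.unique (h.hasDerivAt_cum_pt ht (Ioo_subset_Icc_self hη01))
  have e3 : ((1 : ℝ), ptVel lm lp t η) = (1, 0) + ptVel lm lp t η • (0, 1) := by simp
  rw [e3, map_add, map_smul, e2, massFlux, hpt, dx_zero, smul_eq_mul] at e1
  refine dcum.hasFDerivAt.congr_fderiv ?_
  ext
  · simp [dx_zero]; linarith
  · simpa [dx_zero] using e2

end IsGlobalSmoothSolution

/-! ### The Lagrangian map -/

/-- Continuity of the solution of `f a (H a) = c a` for monotone `f a`. -/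
theorem tendsto_of_level {α : Type*} {l : Filter α} {f : α → ℝ → ℝ} {f0 : ℝ → ℝ} {c H : α → ℝ}
    {c0 H0 a b : ℝ} (hmono : ∀ᶠ i in l, StrictMonoOn (f i) (Icc a b))
    (hH : ∀ᶠ i in l, H i ∈ Icc a b) (hc : ∀ᶠ i in l, f i (H i) = c i)
    (hf : ∀ η ∈ Icc a b, Tendsto (fun i => f i η) l (𝓝 (f0 η))) (hcc : Tendsto c l (𝓝 c0))
    (h0 : StrictMonoOn f0 (Icc a b)) (hH0 : H0 ∈ Icc a b) (he : f0 H0 = c0) :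
    Tendsto H l (𝓝 H0) := by
  rw [tendsto_order]
  constructor
  · intro η hη
    rcases lt_or_ge η a with ha | ha
    · filter_upwards [hH] with i hi using ha.trans_le hi.1
    · have hm : η ∈ Icc a b := ⟨ha, hη.le.trans hH0.2⟩
      have : f0 η < c0 := he ▸ h0 hm hH0 hη
      filter_upwards [hmono, hH, hc, (hf η hm).eventually_lt hcc this] with i m hi hci hlt
      rw [← hci] at hlt
      exact (m.lt_iff_lt hm hi).1 hlt
  · intro η hη
    rcases lt_or_ge b η with hb | hb
    · filter_upwards [hH] with i hi using hi.2.trans_lt hb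
    · have hm : η ∈ Icc a b := ⟨hH0.1.trans hη.le, hb⟩
      have : c0 < f0 η := he ▸ h0 hH0 hm hη
      filter_upwards [hmono, hH, hc, hcc.eventually_lt (hf η hm) this] with i m hi hci hlt
      rw [← hci] at hlt
      exact (m.lt_iff_lt hi hm).1 hlt

/-- The cumulated mass of the stationary solution. -/
def parInt (y : ℝ) : ℝ := (1 / 2) * ∫ s in (-1 : ℝ)..y, (1 - s ^ 2)

theorem parInt_eq (y : ℝ) : parInt y = (2 + 3 * y - y ^ 3) / 6 := by
  rw [parInt, intervalIntegral.integral_sub (by simp) (by simp), integral_pow]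
  simp
  ring

theorem hasDerivAt_parInt (y : ℝ) : HasDerivAt parInt (par y) y := by
  have : parInt = fun y => (2 + 3 * y - y ^ 3) / 6 := funext parInt_eq
  rw [this]
  refine (((((hasDerivAt_id' y).const_mul 3).const_add 2).fun_sub
    ((hasDerivAt_id' y).fun_pow 3)).div_const 6).congr_deriv ?_
  rw [par]
  push_cast
  ring

theorem parInt_left : parInt (-1) = 0 := by rw [parInt_eq]; norm_num

theorem parInt_right : parInt 1 = 2 / 3 := by rw [parInt_eq]; norm_num

theorem continuous_parInt : Continuous parInt :=
  continuous_iff_continuousAt.2 fun y => (hasDerivAt_parInt y).continuousAt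

theorem strictMonoOn_parInt : StrictMonoOn parInt (Icc (-1) 1) := by
  refine strictMonoOn_of_deriv_pos (convex_Icc _ _) continuous_parInt.continuousOn fun y hy => ?_
  rw [interior_Icc] at hy
  rw [(hasDerivAt_parInt y).deriv]
  exact par_pos hy

theorem parInt_mem {y : ℝ} (hy : y ∈ Icc (-1 : ℝ) 1) : parInt y ∈ Icc 0 (2 / 3) := by
  rw [← parInt_left, ← parInt_right]
  exact ⟨strictMonoOn_parInt.monotoneOn (by norm_num) hy hy.1,
    strictMonoOn_parInt.monotoneOn hy (by norm_num) hy.2⟩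

theorem parInt_mem_Ioo {y : ℝ} (hy : y ∈ Ioo (-1 : ℝ) 1) : parInt y ∈ Ioo 0 (2 / 3) := by
  rw [← parInt_left, ← parInt_right]
  have hy' := Ioo_subset_Icc_self hy
  exact ⟨strictMonoOn_parInt (by norm_num) hy' hy.1, strictMonoOn_parInt hy' (by norm_num) hy.2⟩

/-! ### Existence, continuity and smoothness of the Lagrangian map -/

namespace IsGlobalSmoothSolution

variable {u : ℝ → ℝ → ℝ} {lm lp : ℝ → ℝ}

theorem cum_right (h : IsGlobalSmoothSolution u lm lp) (hm : mass u lm lp 0 = 2 / 3)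
    {t : ℝ} (ht : 0 ≤ t) : cum u lm t (lp t) = 2 / 3 :=
  (h.mass_eq ht).trans hm

theorem Z_spec (h : IsGlobalSmoothSolution u lm lp) (hm : mass u lm lp 0 = 2 / 3)
    {t y : ℝ} (ht : 0 ≤ t) (hy : y ∈ Icc (-1 : ℝ) 1) :
    Z u lm lp t y ∈ Icc (lm t) (lp t) ∧ cum u lm t (Z u lm lp t y) = parInt y := by
  have ex : ∃ x ∈ Icc (lm t) (lp t), cum u lm t x = parInt y := by
    have := intermediate_value_Icc (h.lt t ht).le (h.continuousOn_cum ht)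
    rw [cum_left, h.cum_right hm ht] at this
    exact this (parInt_mem hy)
  exact ⟨Function.invFunOn_mem ex, Function.invFunOn_eq ex⟩

theorem Z_mem (h : IsGlobalSmoothSolution u lm lp) (hm : mass u lm lp 0 = 2 / 3)
    {t y : ℝ} (ht : 0 ≤ t) (hy : y ∈ Icc (-1 : ℝ) 1) :
    Z u lm lp t y ∈ Icc (lm t) (lp t) := (h.Z_spec hm ht hy).1

theorem cum_Z (h : IsGlobalSmoothSolution u lm lp) (hm : mass u lm lp 0 = 2 / 3)
    {t y : ℝ} (ht : 0 ≤ t) (hy : y ∈ Icc (-1 : ℝ) 1) :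
    cum u lm t (Z u lm lp t y) = parInt y := (h.Z_spec hm ht hy).2

theorem eq_Z_of_cum_eq (h : IsGlobalSmoothSolution u lm lp) (hm : mass u lm lp 0 = 2 / 3)
    {t x y : ℝ} (ht : 0 ≤ t) (hy : y ∈ Icc (-1 : ℝ) 1)
    (hx : x ∈ Icc (lm t) (lp t)) (he : cum u lm t x = parInt y) : x = Z u lm lp t y :=
  (h.strictMonoOn_cum ht).injOn hx (h.Z_mem hm ht hy) (he.trans (h.cum_Z hm ht hy).symm)

theorem Z_left (h : IsGlobalSmoothSolution u lm lp) (hm : mass u lm lp 0 = 2 / 3)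
    {t : ℝ} (ht : 0 ≤ t) : Z u lm lp t (-1) = lm t :=
  (h.eq_Z_of_cum_eq hm ht (by norm_num) (h.left_mem ht) (by rw [cum_left, parInt_left])).symm

theorem Z_right (h : IsGlobalSmoothSolution u lm lp) (hm : mass u lm lp 0 = 2 / 3)
    {t : ℝ} (ht : 0 ≤ t) : Z u lm lp t 1 = lp t :=
  (h.eq_Z_of_cum_eq hm ht (by norm_num) (h.right_mem ht)
    (by rw [h.cum_right hm ht, parInt_right])).symm

theorem Z_mem_Ioo (h : IsGlobalSmoothSolution u lm lp) (hm : mass u lm lp 0 = 2 / 3)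
    {t y : ℝ} (ht : 0 ≤ t) (hy : y ∈ Ioo (-1 : ℝ) 1) :
    Z u lm lp t y ∈ Ioo (lm t) (lp t) := by
  have hZ := h.Z_mem hm ht (Ioo_subset_Icc_self hy)
  have hc := h.cum_Z hm ht (Ioo_subset_Icc_self hy)
  have hp := parInt_mem_Ioo hy
  refine ⟨lt_of_le_of_ne hZ.1 fun e => ?_, lt_of_le_of_ne hZ.2 fun e => ?_⟩
  · rw [← e, cum_left] at hc
    exact hp.1.ne hc
  · rw [e, h.cum_right hm ht] at hc
    exact hp.2.ne hc.symm

theorem continuousOn_Z (h : IsGlobalSmoothSolution u lm lp) (hm : mass u lm lp 0 = 2 / 3)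
    {t : ℝ} (ht : 0 ≤ t) : ContinuousOn (Z u lm lp t) (Icc (-1) 1) := by
  intro y hy
  refine tendsto_of_level (f := fun _ => cum u lm t) (c := parInt) (Eventually.of_forall fun _ =>
    h.strictMonoOn_cum ht) ?_ ?_ (fun _ _ => tendsto_const_nhds)
    (continuous_parInt.continuousAt.mono_left nhdsWithin_le_nhds) (h.strictMonoOn_cum ht)
    (h.Z_mem hm ht hy) (h.cum_Z hm ht hy)
  · filter_upwards [self_mem_nhdsWithin] with z hz using h.Z_mem hm ht hz
  · filter_upwards [self_mem_nhdsWithin] with z hz using h.cum_Z hm ht hz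

/-- The argument with monotone level functions requires a fixed interval, so it is applied to the
relative position of Z in [0, 1]. It includes t = 0, where the implicit function theorem for the
solution in (t, x) is not available. -/
theorem continuousOn_Z_time (h : IsGlobalSmoothSolution u lm lp) (hm : mass u lm lp 0 = 2 / 3)
    {y : ℝ} (hy : y ∈ Icc (-1 : ℝ) 1) :
    ContinuousOn (fun t => Z u lm lp t y) (Ici 0) := by
  have hL : ∀ t, 0 ≤ t → 0 < lp t - lm t := fun t ht => sub_pos.2 (h.lt t ht)
  have hpt : ∀ t, 0 ≤ t → pt lm lp t ((Z u lm lp t y - lm t) / (lp t - lm t)) = Z u lm lp t y := by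
    intro t ht
    have := (hL t ht).ne'
    rw [pt]; field_simp; ring
  have hmem : ∀ t, 0 ≤ t → (Z u lm lp t y - lm t) / (lp t - lm t) ∈ Icc (0 : ℝ) 1 := by
    intro t ht
    have := h.Z_mem hm ht hy
    exact ⟨div_nonneg (by linarith [this.1]) (hL t ht).le,
      (div_le_one (hL t ht)).2 (by linarith [this.2])⟩
  have hmono : ∀ t, 0 ≤ t → StrictMonoOn (fun η => cum u lm t (pt lm lp t η)) (Icc 0 1) := by
    intro t ht
    refine (h.strictMonoOn_cum ht).comp (fun a _ b _ hab => ?_) fun s hs => h.pt_mem ht hs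
    unfold pt
    nlinarith [hL t ht]
  have key : ContinuousOn (fun t => (Z u lm lp t y - lm t) / (lp t - lm t)) (Ici 0) := by
    intro t ht
    have ht : 0 ≤ t := ht
    refine tendsto_of_level (f := fun t η => cum u lm t (pt lm lp t η)) (c := fun _ => parInt y)
      ?_ ?_ ?_ (fun η hη => h.continuousOn_cum_pt hη t ht) tendsto_const_nhds (hmono t ht)
      (hmem t ht) ?_
    · filter_upwards [self_mem_nhdsWithin] with s hs using hmono s hs
    · filter_upwards [self_mem_nhdsWithin] with s hs using hmem s hs
    · filter_upwards [self_mem_nhdsWithin] with s hs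
      rw [hpt s hs, h.cum_Z hm hs hy]
    · beta_reduce
      rw [hpt t ht, h.cum_Z hm ht hy]
  refine (h.lm_continuousOn.add (key.mul (h.lp_continuousOn.sub h.lm_continuousOn))).congr
    fun t ht => (hpt t ht).symm

/-- Z is the composition of `parInt` with the inverse of the cumulated mass, whose derivative is
1/u. Only one-dimensional differentiation is used, so the initial time is covered. -/
theorem hasDerivAt_Z (h : IsGlobalSmoothSolution u lm lp) (hm : mass u lm lp 0 = 2 / 3)
    {t y : ℝ} (ht : 0 ≤ t) (hy : y ∈ Ioo (-1 : ℝ) 1) :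
    HasDerivAt (Z u lm lp t) (par y / u t (Z u lm lp t y)) y := by
  have hZ := h.Z_mem_Ioo hm ht hy
  have up := h.pos t ht _ hZ
  set g : ℝ → ℝ := fun m => Function.invFunOn (cum u lm t) (Icc (lm t) (lp t)) m with hg
  have hgm : ∀ m ∈ Icc (0 : ℝ) (2 / 3), g m ∈ Icc (lm t) (lp t) ∧ cum u lm t (g m) = m := by
    intro m hmm
    have ex : ∃ x ∈ Icc (lm t) (lp t), cum u lm t x = m := by
      have := intermediate_value_Icc (h.lt t ht).le (h.continuousOn_cum ht)
      rw [cum_left, h.cum_right hm ht] at this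
      exact this hmm
    exact ⟨Function.invFunOn_mem ex, Function.invFunOn_eq ex⟩
  have hZg : Z u lm lp t = fun y => g (parInt y) := rfl
  have hnh : Icc (0 : ℝ) (2 / 3) ∈ 𝓝 (parInt y) :=
    Icc_mem_nhds (parInt_mem_Ioo hy).1 (parInt_mem_Ioo hy).2
  have hp := mem_of_mem_nhds hnh
  have cg : ContinuousAt g (parInt y) := by
    refine tendsto_of_level (f := fun _ => cum u lm t) (c := id) (Eventually.of_forall fun _ =>
      h.strictMonoOn_cum ht) ?_ ?_ (fun _ _ => tendsto_const_nhds) tendsto_id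
      (h.strictMonoOn_cum ht) (hgm _ hp).1 (hgm _ hp).2
    · filter_upwards [hnh] with z hz using (hgm z hz).1
    · filter_upwards [hnh] with z hz using (hgm z hz).2
  have dg : HasDerivAt g (u t (Z u lm lp t y))⁻¹ (parInt y) := by
    refine HasDerivAt.of_local_left_inverse cg (h.hasDerivAt_cum ht hZ) up.ne' ?_
    filter_upwards [hnh] with z hz using (hgm z hz).2
  rw [hZg]
  refine (dg.comp y (hasDerivAt_parInt y)).congr_deriv ?_
  rw [hZg]
  field_simp

/-- The differential is expressed by u and u_xxx, which are already known to be smooth. -/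
theorem contDiffOn_cum (h : IsGlobalSmoothSolution u lm lp) :
    ContDiffOn ℝ ∞ (fun p : ℝ × ℝ => cum u lm p.1 p.2) (inn lm lp) := by
  rw [contDiffOn_infty_iff_fderiv_of_isOpen h.isOpen_inn]
  refine ⟨fun p hp => (h.hasFDerivAt_cum hp.1 hp.2).differentiableAt.differentiableWithinAt, ?_⟩
  have c : ∀ k, ContDiffOn ℝ ∞ (fun p : ℝ × ℝ => dx u lm lp k p.1 p.2) (inn lm lp) :=
    fun k => (h.contDiffOn_dx k).mono inn_subset_dom
  exact ((((c 0).mul (c 3)).neg.smul contDiffOn_const).add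
    ((c 0).smul contDiffOn_const)).congr fun p hp => (h.hasFDerivAt_cum hp.1 hp.2).fderiv

/-- The linear equivalence `(a, b) ↦ (a, α a + β b)` for `β ≠ 0`. -/
def shear (α β : ℝ) (hβ : β ≠ 0) : (ℝ × ℝ) ≃L[ℝ] ℝ × ℝ :=
  ContinuousLinearEquiv.equivOfInverse
    ((ContinuousLinearMap.fst ℝ ℝ ℝ).prod
      (α • ContinuousLinearMap.fst ℝ ℝ ℝ + β • ContinuousLinearMap.snd ℝ ℝ ℝ))
    ((ContinuousLinearMap.fst ℝ ℝ ℝ).prod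
      (β⁻¹ • (ContinuousLinearMap.snd ℝ ℝ ℝ - α • ContinuousLinearMap.fst ℝ ℝ ℝ)))
    (fun p => by ext <;> simp [hβ])
    (fun p => by ext <;> simp [hβ])

/-- Inverse function theorem for (t, x) ↦ (t, cumulated mass): its differential is a shear,
invertible since u > 0 in the interior. Uniqueness of the level point identifies the local inverse
with Z. -/
theorem contDiffAt_Z (h : IsGlobalSmoothSolution u lm lp) (hm : mass u lm lp 0 = 2 / 3)
    {t y : ℝ} (ht : 0 < t) (hy : y ∈ Ioo (-1 : ℝ) 1) :
    ContDiffAt ℝ ∞ (fun p : ℝ × ℝ => Z u lm lp p.1 p.2) (t, y) := by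
  set x := Z u lm lp t y with hx
  have hxm : x ∈ Ioo (lm t) (lp t) := h.Z_mem_Ioo hm ht.le hy
  have hin : (t, x) ∈ inn lm lp := ⟨ht, hxm⟩
  have hnh := h.isOpen_inn.mem_nhds hin
  have up : dx u lm lp 0 t x ≠ 0 := by rw [dx_zero]; exact (h.pos t ht.le x hxm).ne'
  set Ψ : ℝ × ℝ → ℝ × ℝ := fun p => (p.1, cum u lm p.1 p.2) with hΨ
  have cΨ : ContDiffAt ℝ ∞ Ψ (t, x) :=
    contDiffAt_fst.prodMk (h.contDiffOn_cum.contDiffAt hnh)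
  have dΨ : HasFDerivAt Ψ
      (shear (-(dx u lm lp 0 t x * dx u lm lp 3 t x)) (dx u lm lp 0 t x) up : ℝ × ℝ →L[ℝ] ℝ × ℝ)
      (t, x) := hasFDerivAt_fst.prodMk (h.hasFDerivAt_cum ht hxm)
  have hinf : (∞ : WithTop ℕ∞) ≠ 0 := by simp
  have sΨ := cΨ.hasStrictFDerivAt' dΨ hinf
  set g := cΨ.localInverse dΨ hinf with hg
  have cg : ContDiffAt ℝ ∞ g (Ψ (t, x)) := cΨ.to_localInverse dΨ hinf
  have hΨx : Ψ (t, x) = (t, parInt y) := by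
    simp only [hΨ, hx, h.cum_Z hm ht.le (Ioo_subset_Icc_self hy)]
  have hgx : g (t, parInt y) = (t, x) := by
    rw [← hΨx]; exact cΨ.localInverse_apply_image dΨ hinf
  have right : ∀ᶠ q in 𝓝 (t, parInt y), Ψ (g q) = q := by
    rw [← hΨx]; exact sΨ.eventually_right_inverse
  rw [hΨx] at cg
  have mem : ∀ᶠ q in 𝓝 (t, parInt y), g q ∈ inn lm lp :=
    cg.continuousAt.eventually (by rw [hgx]; exact hnh)
  have cq : ContDiff ℝ ∞ fun p : ℝ × ℝ => (p.1, parInt p.2) := by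
    simp only [parInt_eq]; fun_prop
  have ct : Tendsto (fun p : ℝ × ℝ => (p.1, parInt p.2)) (𝓝 (t, y)) (𝓝 (t, parInt y)) :=
    cq.continuous.tendsto (t, y)
  have cc : ContDiffAt ℝ ∞ (fun p : ℝ × ℝ => (g (p.1, parInt p.2)).2) (t, y) :=
    (ContDiffAt.comp (t, y) (f := fun p : ℝ × ℝ => (p.1, parInt p.2)) (g := g) cg
      cq.contDiffAt).snd
  refine cc.congr_of_eventuallyEq ?_
  filter_upwards [ct.eventually right, ct.eventually mem,
    (isOpen_Ioi.prod isOpen_Ioo).mem_nhds (show (t, y) ∈ Ioi (0 : ℝ) ×ˢ Ioo (-1 : ℝ) 1 from ⟨ht, hy⟩)]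
    with p hp hp' hpos
  simp only [hΨ, Prod.mk.injEq] at hp
  have hpos1 : 0 < p.1 := hpos.1
  have m2 := hp'.2
  rw [hp.1] at m2
  rw [hp.1] at hp
  exact (h.eq_Z_of_cum_eq hm hpos1.le (Ioo_subset_Icc_self hpos.2)
    (Ioo_subset_Icc_self m2) hp.2).symm

/-- The mass to the left of Z does not depend on time, so -u u_xxx + u Z_t = 0, and u > 0 can be
divided out. -/
theorem hasDerivAt_Z_time (h : IsGlobalSmoothSolution u lm lp) (hm : mass u lm lp 0 = 2 / 3)
    {t y : ℝ} (ht : 0 < t) (hy : y ∈ Ioo (-1 : ℝ) 1) :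
    HasDerivAt (fun t => Z u lm lp t y) (dx u lm lp 3 t (Z u lm lp t y)) t := by
  have hxm := h.Z_mem_Ioo hm ht.le hy
  have up : 0 < dx u lm lp 0 t (Z u lm lp t y) := by rw [dx_zero]; exact h.pos t ht.le _ hxm
  have d : DifferentiableAt ℝ (fun s => Z u lm lp s y) t :=
    ((h.contDiffAt_Z hm ht hy).differentiableAt (by simp)).comp t
      (f := fun s => (s, y)) (by fun_prop)
  have D := HasFDerivAt.comp_hasDerivAt (f := fun s => (s, Z u lm lp s y)) t
    (h.hasFDerivAt_cum ht hxm) ((hasDerivAt_id' t).prodMk d.hasDerivAt)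
  have ev : (fun p : ℝ × ℝ => cum u lm p.1 p.2) ∘ (fun s => (s, Z u lm lp s y)) =ᶠ[𝓝 t]
      fun _ => parInt y := by
    filter_upwards [Ioi_mem_nhds ht] with s hs
    exact h.cum_Z hm (le_of_lt hs) (Ioo_subset_Icc_self hy)
  have e := D.deriv
  rw [ev.deriv_eq, deriv_const] at e
  simp at e
  have : deriv (fun s => Z u lm lp s y) t = dx u lm lp 3 t (Z u lm lp t y) := by
    have : dx u lm lp 0 t (Z u lm lp t y) *
        (deriv (fun s => Z u lm lp s y) t - dx u lm lp 3 t (Z u lm lp t y)) = 0 := by linarith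
    rcases mul_eq_zero.1 this with h1 | h1
    · exact absurd h1 up.ne'
    · linarith
  rw [← this]
  exact d.hasDerivAt

end IsGlobalSmoothSolution

/-! ### The relative height in Lagrangian coordinates -/

/-- The quotient `ũ / u^∞`. -/
def relHeight (u : ℝ → ℝ → ℝ) (lm lp : ℝ → ℝ) (t y : ℝ) : ℝ := uTilde u lm lp t y / uInf y

/-- The `k`-th spatial derivative of the height in Lagrangian coordinates. -/
def ldx (u : ℝ → ℝ → ℝ) (lm lp : ℝ → ℝ) (k : ℕ) (t y : ℝ) : ℝ := dx u lm lp k t (Z u lm lp t y)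

theorem uInf_eq_par {y : ℝ} (hy : y ∈ Ioo (-1 : ℝ) 1) : uInf y = par y := by
  rw [uInf, max_eq_left (by nlinarith [hy.1, hy.2]), par]
  ring

/-- 6 `parInt y` = (1 + y)² (2 - y), and the last factor is at least 1. -/
theorem sq_le_parInt {y : ℝ} (hy : y ∈ Icc (-1 : ℝ) 1) : (1 + y) ^ 2 ≤ 6 * parInt y := by
  rw [parInt_eq]
  nlinarith [hy.1, hy.2, mul_nonneg (sq_nonneg (1 + y)) (sub_nonneg.2 hy.2)]

theorem sq_le_sub_parInt {y : ℝ} (hy : y ∈ Icc (-1 : ℝ) 1) :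
    (1 - y) ^ 2 ≤ 6 * (2 / 3 - parInt y) := by
  rw [parInt_eq]
  nlinarith [hy.1, hy.2, mul_nonneg (sq_nonneg (1 - y)) (neg_le_iff_add_nonneg.1 hy.1)]

/-- Mean value inequality on a compact interval. -/
theorem abs_sub_le_of_hasDerivWithinAt {f f' : ℝ → ℝ} {a b C x z : ℝ}
    (hd : ∀ x ∈ Icc a b, HasDerivWithinAt f (f' x) (Icc a b) x) (hC : ∀ x ∈ Icc a b, |f' x| ≤ C)
    (hx : x ∈ Icc a b) (hz : z ∈ Icc a b) : |f z - f x| ≤ C * |z - x| :=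
  (convex_Icc a b).norm_image_sub_le_of_norm_hasDerivWithin_le hd hC hx hz

/-! ### Bounds and regularity of the relative height -/

namespace IsGlobalSmoothSolution

variable {u : ℝ → ℝ → ℝ} {lm lp : ℝ → ℝ}

theorem exists_pt_eq (h : IsGlobalSmoothSolution u lm lp) {t x : ℝ} (ht : 0 ≤ t)
    (hx : x ∈ Icc (lm t) (lp t)) : ∃ s ∈ Icc (0 : ℝ) 1, pt lm lp t s = x := by
  have hL : 0 < lp t - lm t := sub_pos.2 (h.lt t ht)
  refine ⟨(x - lm t) / (lp t - lm t), ⟨div_nonneg (by linarith [hx.1]) hL.le,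
    (div_le_one hL).2 (by linarith [hx.2])⟩, ?_⟩
  rw [pt]; field_simp; ring

theorem exists_bound_dx (h : IsGlobalSmoothSolution u lm lp) (T : ℝ) :
    ∃ K, 1 ≤ K ∧ ∀ k ≤ 2, ∀ t ∈ Icc 0 T, ∀ x ∈ Icc (lm t) (lp t), |dx u lm lp k t x| ≤ K := by
  have hK : IsCompact (Icc 0 T ×ˢ Icc (0 : ℝ) 1) := isCompact_Icc.prod isCompact_Icc
  have ex : ∀ k ≤ 2, ∃ C, ∀ p ∈ Icc 0 T ×ˢ Icc (0 : ℝ) 1,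
      ‖dx u lm lp k p.1 (pt lm lp p.1 p.2)‖ ≤ C := fun k hk =>
    hK.exists_bound_of_continuousOn ((h.continuousOn_dx_pt hk).mono
      (prod_mono (fun s hs => hs.1) subset_rfl))
  obtain ⟨C0, h0⟩ := ex 0 (by norm_num)
  obtain ⟨C1, h1⟩ := ex 1 (by norm_num)
  obtain ⟨C2, h2⟩ := ex 2 le_rfl
  refine ⟨max 1 (max C0 (max C1 C2)), le_max_left _ _, fun k hk t ht x hx => ?_⟩
  obtain ⟨s, hs, rfl⟩ := h.exists_pt_eq ht.1 hx
  interval_cases k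
  · exact (h0 (t, s) ⟨ht, hs⟩).trans (by simp)
  · exact (h1 (t, s) ⟨ht, hs⟩).trans (by simp)
  · exact (h2 (t, s) ⟨ht, hs⟩).trans (by simp)

theorem exists_bound_dx_pos (h : IsGlobalSmoothSolution u lm lp) (k : ℕ) {t₁ t₂ : ℝ} (ht : 0 < t₁) :
    ∃ K, ∀ t ∈ Icc t₁ t₂, ∀ x ∈ Icc (lm t) (lp t), |dx u lm lp k t x| ≤ K := by
  have hK : IsCompact (Icc t₁ t₂ ×ˢ Icc (0 : ℝ) 1) := isCompact_Icc.prod isCompact_Icc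
  obtain ⟨C, hC⟩ := hK.exists_bound_of_continuousOn ((h.continuousOn_dx_pt_pos k).mono
    (prod_mono (fun s hs => ht.trans_le hs.1) subset_rfl))
  refine ⟨C, fun t ht' x hx => ?_⟩
  obtain ⟨s, hs, rfl⟩ := h.exists_pt_eq (ht.le.trans ht'.1) hx
  exact hC (t, s) ⟨ht', hs⟩

theorem height_le (h : IsGlobalSmoothSolution u lm lp) {t x K : ℝ} (ht : 0 ≤ t)
    (hK : ∀ k ≤ 2, ∀ x ∈ Icc (lm t) (lp t), |dx u lm lp k t x| ≤ K)
    (hx : x ∈ Icc (lm t) (lp t)) : u t x ≤ K * (x - lm t) ∧ u t x ≤ K * (lp t - x) := by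
  have d : ∀ x ∈ Icc (lm t) (lp t), HasDerivWithinAt (dx u lm lp 0 t) (dx u lm lp 1 t x)
      (Icc (lm t) (lp t)) x := fun x hx => h.hasDerivWithinAt_dx ht (Or.inr two_pos) hx
  have a := abs_sub_le_of_hasDerivWithinAt d (hK 1 (by norm_num)) (h.left_mem ht) hx
  have b := abs_sub_le_of_hasDerivWithinAt d (hK 1 (by norm_num)) (h.right_mem ht) hx
  simp only [dx_zero, h.left_zero t ht, h.right_zero t ht, sub_zero] at a b
  rw [abs_of_nonneg (sub_nonneg.2 hx.1)] at a
  rw [abs_sub_comm, abs_of_nonneg (sub_nonneg.2 hx.2)] at b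
  exact ⟨(le_abs_self _).trans a, (le_abs_self _).trans b⟩

/-- Near the contact points the height is comparable to the distance. -/
theorem le_height (h : IsGlobalSmoothSolution u lm lp) {t x K : ℝ} (ht : 0 ≤ t)
    (hK : ∀ k ≤ 2, ∀ x ∈ Icc (lm t) (lp t), |dx u lm lp k t x| ≤ K)
    (hx : x ∈ Icc (lm t) (lp t)) :
    (K * (x - lm t) ≤ 1 / 2 → (x - lm t) / 2 ≤ u t x) ∧
    (K * (lp t - x) ≤ 1 / 2 → (lp t - x) / 2 ≤ u t x) := by
  have K0 : 0 ≤ K := (abs_nonneg _).trans (hK 0 (by norm_num) x hx)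
  have d0 : ∀ x ∈ Icc (lm t) (lp t), HasDerivWithinAt (dx u lm lp 0 t) (dx u lm lp 1 t x)
      (Icc (lm t) (lp t)) x := fun x hx => h.hasDerivWithinAt_dx ht (Or.inr two_pos) hx
  have d1 : ∀ x ∈ Icc (lm t) (lp t), HasDerivWithinAt (dx u lm lp 1 t) (dx u lm lp 2 t x)
      (Icc (lm t) (lp t)) x := fun x hx => h.hasDerivWithinAt_dx ht (Or.inr one_lt_two) hx
  constructor
  · intro hs
    have sub : Icc (lm t) x ⊆ Icc (lm t) (lp t) := Icc_subset_Icc_right hx.2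
    have a := abs_sub_le_of_hasDerivWithinAt (f := fun z => dx u lm lp 0 t z - z)
      (f' := fun z => dx u lm lp 1 t z - 1) (C := 1 / 2) (a := lm t) (b := x)
      (fun z hz => ((d0 z (sub hz)).mono sub).fun_sub (hasDerivAt_id' z).hasDerivWithinAt)
      (fun z hz => by
        have := abs_sub_le_of_hasDerivWithinAt d1 (hK 2 le_rfl) (h.left_mem ht) (sub hz)
        rw [h.dx_one_left ht, abs_of_nonneg (sub_nonneg.2 hz.1)] at this
        nlinarith [hz.2])
      (left_mem_Icc.2 hx.1) (right_mem_Icc.2 hx.1)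
    simp only [dx_zero, h.left_zero t ht] at a
    rw [abs_of_nonneg (sub_nonneg.2 hx.1)] at a
    linarith [(abs_le.1 a).1]
  · intro hs
    have sub : Icc x (lp t) ⊆ Icc (lm t) (lp t) := Icc_subset_Icc_left hx.1
    have a := abs_sub_le_of_hasDerivWithinAt (f := fun z => dx u lm lp 0 t z + z)
      (f' := fun z => dx u lm lp 1 t z + 1) (C := 1 / 2) (a := x) (b := lp t)
      (fun z hz => ((d0 z (sub hz)).mono sub).fun_add (hasDerivAt_id' z).hasDerivWithinAt)
      (fun z hz => by
        have := abs_sub_le_of_hasDerivWithinAt d1 (hK 2 le_rfl) (h.right_mem ht) (sub hz)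
        rw [h.dx_one_right ht, abs_sub_comm z, abs_of_nonneg (sub_nonneg.2 hz.2),
          sub_neg_eq_add] at this
        nlinarith [hz.1])
      (right_mem_Icc.2 hx.2) (left_mem_Icc.2 hx.2)
    simp only [dx_zero, h.right_zero t ht] at a
    rw [abs_sub_comm x, abs_of_nonneg (sub_nonneg.2 hx.2)] at a
    linarith [(abs_le.1 a).1]

/-- Away from the contact points the height is bounded from below. -/
theorem exists_pos_le_height (h : IsGlobalSmoothSolution u lm lp) (T : ℝ) {δ : ℝ} (hδ : 0 < δ) :
    ∃ c, 0 < c ∧ ∀ t ∈ Icc 0 T, ∀ x ∈ Icc (lm t) (lp t), δ ≤ x - lm t → δ ≤ lp t - x →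
      c ≤ u t x := by
  have hK : IsCompact (Icc 0 T ×ˢ Icc (0 : ℝ) 1) := isCompact_Icc.prod isCompact_Icc
  have sub : Icc 0 T ×ˢ Icc (0 : ℝ) 1 ⊆ Ici 0 ×ˢ Icc 0 1 :=
    prod_mono (fun s hs => hs.1) subset_rfl
  have cp := h.continuousOn_pt.mono sub
  have c1 : ContinuousOn (fun p : ℝ × ℝ => lm p.1) (Icc 0 T ×ˢ Icc (0 : ℝ) 1) :=
    h.lm_continuousOn.comp continuousOn_fst fun p hp => hp.1.1
  have c2 : ContinuousOn (fun p : ℝ × ℝ => lp p.1) (Icc 0 T ×ˢ Icc (0 : ℝ) 1) :=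
    h.lp_continuousOn.comp continuousOn_fst fun p hp => hp.1.1
  set B := {p ∈ Icc 0 T ×ˢ Icc (0 : ℝ) 1 |
    δ ≤ min (pt lm lp p.1 p.2 - lm p.1) (lp p.1 - pt lm lp p.1 p.2)} with hB
  have hBc : IsCompact B := by
    refine hK.of_isClosed_subset ?_ (sep_subset _ _)
    exact (ContinuousOn.inf (cp.sub c1) (c2.sub cp)).preimage_isClosed_of_isClosed
      (hK.isClosed) isClosed_Ici
  obtain ⟨c, hc, hle⟩ := hBc.exists_forall_le' (f := fun p : ℝ × ℝ =>
    dx u lm lp 0 p.1 (pt lm lp p.1 p.2)) (a := 0)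
    (((h.continuousOn_dx_pt (by norm_num)).mono sub).mono (sep_subset _ _)) (by
      rintro ⟨t, s⟩ ⟨⟨ht, hs⟩, hd⟩
      simp only [le_min_iff] at hd ht
      rw [dx_zero]
      exact h.pos t ht.1 _ ⟨by linarith [hd.1], by linarith [hd.2]⟩)
  refine ⟨c, hc, fun t ht x hx h1 h2 => ?_⟩
  obtain ⟨s, hs, rfl⟩ := h.exists_pt_eq ht.1 hx
  have := hle (t, s) ⟨⟨ht, hs⟩, le_min h1 h2⟩
  rwa [dx_zero] at this

theorem relHeight_eq (t : ℝ) {y : ℝ} (hy : y ∈ Ioo (-1 : ℝ) 1) :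
    relHeight u lm lp t y = ldx u lm lp 0 t y / par y := by
  rw [relHeight, uTilde, uInf_eq_par hy, ldx, dx_zero]

theorem ldx_zero_eq (t : ℝ) {y : ℝ} (hy : y ∈ Ioo (-1 : ℝ) 1) :
    ldx u lm lp 0 t y = par y * relHeight u lm lp t y := by
  rw [relHeight_eq t hy, mul_div_cancel₀ _ (par_pos hy).ne']

theorem relHeight_pos (h : IsGlobalSmoothSolution u lm lp) (hm : mass u lm lp 0 = 2 / 3)
    {t y : ℝ} (ht : 0 ≤ t) (hy : y ∈ Ioo (-1 : ℝ) 1) : 0 < relHeight u lm lp t y := by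
  rw [relHeight_eq t hy, ldx, dx_zero]
  exact div_pos (h.pos t ht _ (h.Z_mem_Ioo hm ht hy)) (par_pos hy)

theorem cum_le (h : IsGlobalSmoothSolution u lm lp) (hm : mass u lm lp 0 = 2 / 3) {t x K : ℝ}
    (ht : 0 ≤ t) (hK0 : 0 ≤ K) (hK : ∀ k ≤ 2, ∀ x ∈ Icc (lm t) (lp t), |dx u lm lp k t x| ≤ K)
    (hx : x ∈ Icc (lm t) (lp t)) :
    cum u lm t x ≤ K * (x - lm t) ^ 2 ∧ 2 / 3 - cum u lm t x ≤ K * (lp t - x) ^ 2 := by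
  have c := h.continuousOn_height ht
  have il : IntervalIntegrable (u t) volume (lm t) x :=
    ContinuousOn.intervalIntegrable_of_Icc hx.1 (c.mono (Icc_subset_Icc_right hx.2))
  have ir : IntervalIntegrable (u t) volume x (lp t) :=
    ContinuousOn.intervalIntegrable_of_Icc hx.2 (c.mono (Icc_subset_Icc_left hx.1))
  constructor
  · have := intervalIntegral.integral_mono_on hx.1 il
      (intervalIntegrable_const (c := K * (x - lm t))) fun z hz =>
        (h.height_le ht hK ⟨hz.1, hz.2.trans hx.2⟩).1.trans
          (mul_le_mul_of_nonneg_left (by linarith [hz.2]) hK0)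
    rw [intervalIntegral.integral_const, smul_eq_mul] at this
    rw [cum]
    linarith
  · have := intervalIntegral.integral_mono_on hx.2 ir
      (intervalIntegrable_const (c := K * (lp t - x))) fun z hz =>
        (h.height_le ht hK ⟨hx.1.trans hz.1, hz.2⟩).2.trans
          (mul_le_mul_of_nonneg_left (by linarith [hz.1]) hK0)
    rw [intervalIntegral.integral_const, smul_eq_mul] at this
    have e : cum u lm t x + ∫ z in x..lp t, u t z = 2 / 3 := by
      rw [← h.cum_right hm ht]
      exact intervalIntegral.integral_add_adjacent_intervals il ir
    linarith

/-- Uniform lower bound for the relative height. -/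
theorem exists_pos_le_relHeight (h : IsGlobalSmoothSolution u lm lp)
    (hm : mass u lm lp 0 = 2 / 3) (T : ℝ) :
    ∃ c, 0 < c ∧ ∀ t ∈ Icc 0 T, ∀ y ∈ Ioo (-1 : ℝ) 1, c ≤ relHeight u lm lp t y := by
  obtain ⟨K, hK1, hK⟩ := h.exists_bound_dx T
  have K0 : 0 < K := by linarith
  obtain ⟨c₁, hc₁, hle⟩ := h.exists_pos_le_height T (δ := 1 / (2 * K)) (by positivity)
  refine ⟨min (1 / (12 * K)) c₁, lt_min (by positivity) hc₁, fun t ht y hy => ?_⟩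
  have hy' := Ioo_subset_Icc_self hy
  set x := Z u lm lp t y with hx
  have hxm : x ∈ Icc (lm t) (lp t) := h.Z_mem hm ht.1 hy'
  have hKt : ∀ k ≤ 2, ∀ x ∈ Icc (lm t) (lp t), |dx u lm lp k t x| ≤ K := fun k hk => hK k hk t ht
  have cl := h.cum_le hm ht.1 K0.le hKt hxm
  rw [h.cum_Z hm ht.1 hy'] at cl
  -- Near the left end both masses are quadratic in the distance: (1 + y)² ≤ 6 · mass ≤ 6K (x -
  -- lm)². Since K ≥ 1 this is at most the square of 6K (x - lm), which avoids a square root.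
  have s1 : 1 + y ≤ 6 * K * (x - lm t) := by
    refine abs_le_of_sq_le_sq' ?_ (mul_nonneg (by positivity) (sub_nonneg.2 hxm.1)) |>.2
    have a := sq_le_parInt hy'
    have b : K * (x - lm t) ^ 2 ≤ K * K * (x - lm t) ^ 2 :=
      mul_le_mul_of_nonneg_right (by nlinarith) (sq_nonneg _)
    nlinarith [mul_nonneg (mul_nonneg K0.le K0.le) (sq_nonneg (x - lm t))]
  have s2 : 1 - y ≤ 6 * K * (lp t - x) := by
    refine abs_le_of_sq_le_sq' ?_ (mul_nonneg (by positivity) (sub_nonneg.2 hxm.2)) |>.2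
    have a := sq_le_sub_parInt hy'
    have b : K * (lp t - x) ^ 2 ≤ K * K * (lp t - x) ^ 2 :=
      mul_le_mul_of_nonneg_right (by nlinarith) (sq_nonneg _)
    nlinarith [mul_nonneg (mul_nonneg K0.le K0.le) (sq_nonneg (lp t - x))]
  rw [relHeight_eq t hy, ldx, dx_zero, le_div_iff₀ (par_pos hy)]
  have lh := h.le_height ht.1 hKt hxm
  have pp := par_pos hy
  have p1 : par y ≤ 1 + y := by unfold par; nlinarith [hy.1, hy.2]
  have p2 : par y ≤ 1 - y := by unfold par; nlinarith [hy.1, hy.2]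
  have i : 1 / (12 * K) * (6 * K) = 1 / 2 := by field_simp; norm_num
  have i' : K * (1 / (2 * K)) = 1 / 2 := by field_simp
  -- Within distance 1/(2K) of a contact point u is at least half that distance, because |u_xx| ≤ K
  -- keeps |u_x| ≥ 1/2. Elsewhere compactness gives a positive lower bound.
  rcases le_or_gt (x - lm t) (1 / (2 * K)) with c | c
  · have := lh.1 (by rw [← i']; exact mul_le_mul_of_nonneg_left c K0.le)
    calc min (1 / (12 * K)) c₁ * par y ≤ 1 / (12 * K) * par y :=
          mul_le_mul_of_nonneg_right (min_le_left _ _) pp.le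
      _ ≤ 1 / (12 * K) * (6 * K * (x - lm t)) :=
          mul_le_mul_of_nonneg_left (p1.trans s1) (by positivity)
      _ = (x - lm t) / 2 := by rw [← mul_assoc, i]; ring
      _ ≤ _ := this
  rcases le_or_gt (lp t - x) (1 / (2 * K)) with c' | c'
  · have := lh.2 (by rw [← i']; exact mul_le_mul_of_nonneg_left c' K0.le)
    calc min (1 / (12 * K)) c₁ * par y ≤ 1 / (12 * K) * par y :=
          mul_le_mul_of_nonneg_right (min_le_left _ _) pp.le
      _ ≤ 1 / (12 * K) * (6 * K * (lp t - x)) :=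
          mul_le_mul_of_nonneg_left (p2.trans s2) (by positivity)
      _ = (lp t - x) / 2 := by rw [← mul_assoc, i]; ring
      _ ≤ _ := this
  · calc min (1 / (12 * K)) c₁ * par y ≤ c₁ * par y :=
          mul_le_mul_of_nonneg_right (min_le_right _ _) pp.le
      _ ≤ c₁ * 1 := mul_le_mul_of_nonneg_left ((par_le y).trans (by norm_num)) hc₁.le
      _ = c₁ := mul_one _
      _ ≤ _ := hle t ht x hxm c.le c'.le

theorem hasDerivAt_Z_relHeight (h : IsGlobalSmoothSolution u lm lp) (hm : mass u lm lp 0 = 2 / 3)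
    {t y : ℝ} (ht : 0 ≤ t) (hy : y ∈ Ioo (-1 : ℝ) 1) :
    HasDerivAt (Z u lm lp t) (relHeight u lm lp t y)⁻¹ y := by
  refine (h.hasDerivAt_Z hm ht hy).congr_deriv ?_
  rw [relHeight_eq t hy, ldx, dx_zero, inv_div]

theorem hasDerivAt_ldx (h : IsGlobalSmoothSolution u lm lp) (hm : mass u lm lp 0 = 2 / 3) {k : ℕ}
    {t y : ℝ} (ht : 0 ≤ t) (hk : 0 < t ∨ k < 2) (hy : y ∈ Ioo (-1 : ℝ) 1) :
    HasDerivAt (ldx u lm lp k t) (ldx u lm lp (k + 1) t y * (relHeight u lm lp t y)⁻¹) y :=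
  (h.hasDerivAt_dx ht hk (h.Z_mem_Ioo hm ht hy)).comp y (h.hasDerivAt_Z_relHeight hm ht hy)

theorem continuousOn_ldx (h : IsGlobalSmoothSolution u lm lp) (hm : mass u lm lp 0 = 2 / 3) {k : ℕ}
    {t : ℝ} (ht : 0 ≤ t) (hk : 0 < t ∨ k ≤ 2) : ContinuousOn (ldx u lm lp k t) (Icc (-1) 1) :=
  (h.continuousOn_dx_slice ht hk).comp (h.continuousOn_Z hm ht) fun _ hy => h.Z_mem hm ht hy

theorem bddCont_ldx (h : IsGlobalSmoothSolution u lm lp) (hm : mass u lm lp 0 = 2 / 3) {k : ℕ}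
    {t : ℝ} (ht : 0 ≤ t) (hk : 0 < t ∨ k ≤ 2) : BddCont (ldx u lm lp k t) (Ioo (-1) 1) := by
  have c := h.continuousOn_ldx hm ht hk
  obtain ⟨C, hC⟩ := isCompact_Icc.exists_bound_of_continuousOn c
  exact ⟨c.mono Ioo_subset_Icc_self, C, fun y hy => hC y (Ioo_subset_Icc_self hy)⟩

theorem tendsto_ldx_left (h : IsGlobalSmoothSolution u lm lp) (hm : mass u lm lp 0 = 2 / 3) {k : ℕ}
    {t : ℝ} (ht : 0 ≤ t) (hk : 0 < t ∨ k ≤ 2) :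
    Tendsto (ldx u lm lp k t) (𝓝[>] (-1)) (𝓝 (dx u lm lp k t (lm t))) := by
  have c := h.continuousOn_ldx hm ht hk (-1) (by norm_num)
  rw [ContinuousWithinAt, ldx, h.Z_left hm ht] at c
  rw [← nhdsWithin_Ioo_eq_nhdsGT (show (-1 : ℝ) < 1 by norm_num)]
  exact c.mono_left (nhdsWithin_mono _ Ioo_subset_Icc_self)

theorem tendsto_ldx_right (h : IsGlobalSmoothSolution u lm lp) (hm : mass u lm lp 0 = 2 / 3) {k : ℕ}
    {t : ℝ} (ht : 0 ≤ t) (hk : 0 < t ∨ k ≤ 2) :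
    Tendsto (ldx u lm lp k t) (𝓝[<] 1) (𝓝 (dx u lm lp k t (lp t))) := by
  have c := h.continuousOn_ldx hm ht hk 1 (by norm_num)
  rw [ContinuousWithinAt, ldx, h.Z_right hm ht] at c
  rw [← nhdsWithin_Ioo_eq_nhdsLT (show (-1 : ℝ) < 1 by norm_num)]
  exact c.mono_left (nhdsWithin_mono _ Ioo_subset_Icc_self)

theorem hasDerivAt_relHeight (h : IsGlobalSmoothSolution u lm lp) (hm : mass u lm lp 0 = 2 / 3)
    {t y : ℝ} (ht : 0 ≤ t) (hy : y ∈ Ioo (-1 : ℝ) 1) :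
    HasDerivAt (relHeight u lm lp t) ((ldx u lm lp 1 t y * (relHeight u lm lp t y)⁻¹ +
      y * relHeight u lm lp t y) / par y) y := by
  have ev : relHeight u lm lp t =ᶠ[𝓝 y] fun z => ldx u lm lp 0 t z / par z := by
    filter_upwards [isOpen_Ioo.mem_nhds hy] with z hz using relHeight_eq t hz
  have pp := (par_pos hy).ne'
  refine HasDerivAt.congr_of_eventuallyEq ?_ ev
  refine ((h.hasDerivAt_ldx hm ht (Or.inr two_pos) hy).fun_div (hasDerivAt_par y) pp).congr_deriv ?_
  rw [ldx_zero_eq t hy]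
  field_simp
  ring

/-- Both sides come from u² = `par`² w². Differentiating u² in y gives 2 u u_x / w, and u/w = `par`:
squaring makes the unknown w disappear from the right-hand side. -/
theorem weighted (h : IsGlobalSmoothSolution u lm lp) (hm : mass u lm lp 0 = 2 / 3) {t : ℝ}
    (ht : 0 ≤ t) : Weighted (fun y => relHeight u lm lp t y ^ 2) (ldx u lm lp 1 t) := by
  have e : ∀ y ∈ Ioo (-1 : ℝ) 1, ldx u lm lp 0 t y ^ 2 = par y ^ 2 * relHeight u lm lp t y ^ 2 :=
    fun y hy => by rw [ldx_zero_eq t hy, mul_pow]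
  refine ⟨fun y hy => ?_, ?_, ?_⟩
  · have ev : (fun y => par y ^ 2 * relHeight u lm lp t y ^ 2) =ᶠ[𝓝 y]
        fun y => ldx u lm lp 0 t y ^ 2 := by
      filter_upwards [isOpen_Ioo.mem_nhds hy] with z hz using (e z hz).symm
    refine HasDerivAt.congr_of_eventuallyEq ?_ ev
    refine ((h.hasDerivAt_ldx hm ht (Or.inr two_pos) hy).fun_pow 2).congr_deriv ?_
    have := (h.relHeight_pos hm ht hy).ne'
    rw [ldx_zero_eq t hy]
    push_cast
    field_simp
  · have := (h.tendsto_ldx_left hm (k := 0) ht (Or.inr (by norm_num))).pow 2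
    rw [dx_zero, h.left_zero t ht, zero_pow two_ne_zero] at this
    refine this.congr' ?_
    filter_upwards [Ioo_mem_nhdsGT (show (-1 : ℝ) < 1 by norm_num)] with y hy using e y hy
  · have := (h.tendsto_ldx_right hm (k := 0) ht (Or.inr (by norm_num))).pow 2
    rw [dx_zero, h.right_zero t ht, zero_pow two_ne_zero] at this
    refine this.congr' ?_
    filter_upwards [Ioo_mem_nhdsLT (show (-1 : ℝ) < 1 by norm_num)] with y hy using e y hy

/-- Uniform bounds for the relative height and its derivative. -/
theorem exists_bound_relHeight (h : IsGlobalSmoothSolution u lm lp)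
    (hm : mass u lm lp 0 = 2 / 3) (T : ℝ) :
    ∃ C, ∀ t ∈ Icc 0 T, ∀ y ∈ Ioo (-1 : ℝ) 1, |relHeight u lm lp t y| ≤ C ∧
      |deriv (relHeight u lm lp t) y| ≤ C := by
  obtain ⟨K, hK1, hK⟩ := h.exists_bound_dx T
  obtain ⟨c, hc, hle⟩ := h.exists_pos_le_relHeight hm T
  refine ⟨32 * K + 160 * (K + K * c⁻¹) / (2 * c), fun t ht y hy => ?_⟩
  have hZ : ∀ y ∈ Ioo (-1 : ℝ) 1, Z u lm lp t y ∈ Icc (lm t) (lp t) := fun y hy =>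
    h.Z_mem hm ht.1 (Ioo_subset_Icc_self hy)
  have hinv : ∀ y ∈ Ioo (-1 : ℝ) 1, |(relHeight u lm lp t y)⁻¹| ≤ c⁻¹ := fun y hy => by
    rw [abs_of_pos (inv_pos.2 (h.relHeight_pos hm ht.1 hy))]
    exact inv_anti₀ hc (hle t ht y hy)
  have binv : BddCont (fun y => (relHeight u lm lp t y)⁻¹) (Ioo (-1) 1) :=
    ⟨fun y hy => ((h.hasDerivAt_relHeight hm ht.1 hy).continuousAt.inv₀
      (h.relHeight_pos hm ht.1 hy).ne').continuousWithinAt, c⁻¹, hinv⟩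
  -- Applied to e = u_x∘Z, with e' = u_xx∘Z / w: only u_x, u_xx and the lower bound c for w enter,
  -- all uniform down to t = 0.
  have B := (h.weighted hm ht.1).abs_le (K := K) (K1 := K * c⁻¹)
    (h.bddCont_ldx hm ht.1 (Or.inr one_le_two))
    (fun y hy => h.hasDerivAt_ldx hm ht.1 (Or.inr one_lt_two) hy)
    ((h.bddCont_ldx hm ht.1 (Or.inr le_rfl)).mul binv)
    (fun y hy => hK 1 one_le_two t ht _ (hZ y hy))
    (fun y hy => by
      rw [abs_mul]
      exact mul_le_mul (hK 2 le_rfl t ht _ (hZ y hy)) (hinv y hy) (abs_nonneg _) (by linarith))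
    hy
  have wp := h.relHeight_pos hm ht.1 hy
  have hcw := hle t ht y hy
  have d := (h.hasDerivAt_relHeight hm ht.1 hy).differentiableAt.hasDerivAt
  rw [(d.fun_pow 2).deriv] at B
  obtain ⟨B1, B2⟩ := B
  have K0 : 0 < K := by linarith
  have pos2 : 0 ≤ 160 * (K + K * c⁻¹) / (2 * c) := by positivity
  constructor
  · have : |relHeight u lm lp t y| ≤ 32 * K := by
      refine abs_le_of_sq_le_sq ?_ (by positivity)
      nlinarith [le_abs_self (relHeight u lm lp t y ^ 2)]
    linarith
  · have : |deriv (relHeight u lm lp t) y| ≤ 160 * (K + K * c⁻¹) / (2 * c) := by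
      rw [le_div_iff₀ (by positivity)]
      refine le_trans ?_ B2
      rw [abs_mul, abs_of_pos (show 0 < ((2 : ℕ) : ℝ) * relHeight u lm lp t y ^ (2 - 1) by
        simp; exact wp)]
      push_cast
      simp only [pow_one]
      nlinarith [abs_nonneg (deriv (relHeight u lm lp t) y)]
    linarith

/-- From ∂_y (u_k∘Z) = (u_(k+1)∘Z)/w, where u_k = ∂_x^k u: n derivatives of w yield n + 1
derivatives of every u_k∘Z. This gain drives the bootstrap. -/
theorem bddDeriv_ldx (h : IsGlobalSmoothSolution u lm lp) (hm : mass u lm lp 0 = 2 / 3) {t c : ℝ}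
    (ht : 0 < t) (hc : 0 < c) (hle : ∀ y ∈ Ioo (-1 : ℝ) 1, c ≤ relHeight u lm lp t y) {n : ℕ}
    (hw : BddDeriv n (relHeight u lm lp t) (Ioo (-1) 1)) (k : ℕ) :
    BddDeriv (n + 1) (ldx u lm lp k t) (Ioo (-1) 1) := by
  have b : ∀ k, BddCont (ldx u lm lp k t) (Ioo (-1) 1) := fun k =>
    h.bddCont_ldx hm ht.le (Or.inl ht)
  have e : BddDeriv n (ldx u lm lp (k + 1) t) (Ioo (-1) 1) := by
    induction n generalizing k with
    | zero => exact b _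
    | succ n ih =>
      exact .of_hasDerivAt isOpen_Ioo (b _)
        (fun y hy => h.hasDerivAt_ldx hm ht.le (Or.inl ht) hy)
        ((ih hw.pred (k + 1)).mul isOpen_Ioo (hw.pred.inv isOpen_Ioo hc hle))
  exact .of_hasDerivAt isOpen_Ioo (b _) (fun y hy => h.hasDerivAt_ldx hm ht.le (Or.inl ht) hy)
    (e.mul isOpen_Ioo (hw.inv isOpen_Ioo hc hle))

/-- The relative height is smooth up to the end points at positive times. -/
theorem bddDeriv_relHeight (h : IsGlobalSmoothSolution u lm lp) (hm : mass u lm lp 0 = 2 / 3)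
    {t : ℝ} (ht : 0 < t) (n : ℕ) : BddDeriv n (relHeight u lm lp t) (Ioo (-1) 1) := by
  obtain ⟨c, hc, hle⟩ := h.exists_pos_le_relHeight hm t
  replace hle := hle t ⟨ht.le, le_rfl⟩
  induction n with
  | zero =>
    obtain ⟨C, hC⟩ := h.exists_bound_relHeight hm t
    exact ⟨fun y hy => (h.hasDerivAt_relHeight hm ht.le hy).continuousAt.continuousWithinAt, C,
      fun y hy => (hC t ⟨ht.le, le_rfl⟩ y hy).1⟩
  | succ n ih =>
    -- One round of the bootstrap: from w to u_x∘Z with one more derivative, then to w², and to w by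
    -- a square root away from zero.
    have b := (h.weighted hm ht.le).bddDeriv (h.bddDeriv_ldx hm ht hc hle ih 1)
    refine (b.sqrt isOpen_Ioo (pow_pos hc 2) fun y hy =>
      pow_le_pow_left₀ hc.le (hle y hy) 2).congr isOpen_Ioo fun y hy => ?_
    exact (Real.sqrt_sq (h.relHeight_pos hm ht.le hy).le).symm

/-- L'Hôpital for w² = (`par`² w²)/`par`²: the quotient of the derivatives is u_x∘Z/(-y), which
tends to 1 by the contact angle condition. -/
theorem tendsto_relHeight_left (h : IsGlobalSmoothSolution u lm lp) (hm : mass u lm lp 0 = 2 / 3)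
    {t : ℝ} (ht : 0 ≤ t) : Tendsto (relHeight u lm lp t) (𝓝[>] (-1)) (𝓝 1) := by
  have w := h.weighted hm ht
  have l : Tendsto (fun y => relHeight u lm lp t y ^ 2) (𝓝[>] (-1)) (𝓝 1) := by
    have dg : ∀ y ∈ Ioo (-1 : ℝ) 0, HasDerivAt (fun y => par y ^ 2) (2 * par y * (-y)) y :=
      fun y _ => ((hasDerivAt_par y).fun_pow 2).congr_deriv (by simp)
    have hy : ∀ y ∈ Ioo (-1 : ℝ) 0, y ∈ Ioo (-1 : ℝ) 1 := fun y hy => ⟨hy.1, hy.2.trans one_pos⟩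
    have key := HasDerivAt.lhopital_zero_right_on_Ioo (l := 𝓝 1) (show (-1 : ℝ) < 0 by norm_num)
      (fun y hy' => w.hasDerivAt y (hy y hy')) dg
      (fun y hy' => (mul_pos (mul_pos two_pos (par_pos (hy y hy'))) (neg_pos.2 hy'.2)).ne') w.left
      (by
        have := (continuous_par.pow 2).tendsto (-1)
        simp only [Pi.pow_apply, par] at this
        norm_num at this
        exact this.mono_left nhdsWithin_le_nhds) (by
        have t1 := h.tendsto_ldx_left hm (k := 1) ht (Or.inr one_le_two)
        rw [h.dx_one_left ht] at t1
        have t2 : Tendsto (fun y : ℝ => -y) (𝓝[>] (-1)) (𝓝 1) := by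
          have := (continuous_neg (G := ℝ)).tendsto (-1)
          rw [neg_neg] at this
          exact this.mono_left nhdsWithin_le_nhds
        have t3 := t1.div t2 one_ne_zero
        rw [div_one] at t3
        refine t3.congr' ?_
        filter_upwards [Ioo_mem_nhdsGT (show (-1 : ℝ) < 0 by norm_num)] with y hy'
        have p := (par_pos (hy y hy')).ne'
        have : y ≠ 0 := hy'.2.ne
        simp only [Pi.div_apply]
        field_simp)
    refine key.congr' ?_
    filter_upwards [Ioo_mem_nhdsGT (show (-1 : ℝ) < 0 by norm_num)] with y hy'
    rw [mul_div_cancel_left₀ _ (pow_ne_zero 2 (par_pos (hy y hy')).ne')]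
  have s := l.sqrt
  rw [Real.sqrt_one] at s
  refine s.congr' ?_
  filter_upwards [Ioo_mem_nhdsGT (show (-1 : ℝ) < 1 by norm_num)] with y hy
  exact Real.sqrt_sq (h.relHeight_pos hm ht hy).le

theorem tendsto_relHeight_right (h : IsGlobalSmoothSolution u lm lp) (hm : mass u lm lp 0 = 2 / 3)
    {t : ℝ} (ht : 0 ≤ t) : Tendsto (relHeight u lm lp t) (𝓝[<] 1) (𝓝 1) := by
  have w := h.weighted hm ht
  have l : Tendsto (fun y => relHeight u lm lp t y ^ 2) (𝓝[<] 1) (𝓝 1) := by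
    have dg : ∀ y ∈ Ioo (0 : ℝ) 1, HasDerivAt (fun y => par y ^ 2) (2 * par y * (-y)) y :=
      fun y _ => ((hasDerivAt_par y).fun_pow 2).congr_deriv (by simp)
    have hy : ∀ y ∈ Ioo (0 : ℝ) 1, y ∈ Ioo (-1 : ℝ) 1 := fun y hy =>
      ⟨by linarith [hy.1], hy.2⟩
    have key := HasDerivAt.lhopital_zero_left_on_Ioo (l := 𝓝 1) (show (0 : ℝ) < 1 by norm_num)
      (fun y hy' => w.hasDerivAt y (hy y hy')) dg
      (fun y hy' => (mul_neg_of_pos_of_neg (mul_pos two_pos (par_pos (hy y hy')))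
        (neg_neg_of_pos hy'.1)).ne) w.right
      (by
        have := (continuous_par.pow 2).tendsto 1
        simp only [Pi.pow_apply, par] at this
        norm_num at this
        exact this.mono_left nhdsWithin_le_nhds) (by
        have t1 := h.tendsto_ldx_right hm (k := 1) ht (Or.inr one_le_two)
        rw [h.dx_one_right ht] at t1
        have t2 : Tendsto (fun y : ℝ => -y) (𝓝[<] 1) (𝓝 (-1)) :=
          ((continuous_neg (G := ℝ)).tendsto 1).mono_left nhdsWithin_le_nhds
        have t3 := t1.div t2 (by norm_num)
        rw [div_self (by norm_num)] at t3
        refine t3.congr' ?_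
        filter_upwards [Ioo_mem_nhdsLT (show (0 : ℝ) < 1 by norm_num)] with y hy'
        have p := (par_pos (hy y hy')).ne'
        have : y ≠ 0 := hy'.1.ne'
        simp only [Pi.div_apply]
        field_simp)
    refine key.congr' ?_
    filter_upwards [Ioo_mem_nhdsLT (show (0 : ℝ) < 1 by norm_num)] with y hy'
    rw [mul_div_cancel_left₀ _ (pow_ne_zero 2 (par_pos (hy y hy')).ne')]
  have s := l.sqrt
  rw [Real.sqrt_one] at s
  refine s.congr' ?_
  filter_upwards [Ioo_mem_nhdsLT (show (-1 : ℝ) < 1 by norm_num)] with y hy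
  exact Real.sqrt_sq (h.relHeight_pos hm ht hy).le

/-- The relative height and its derivatives form a profile. -/
theorem profile (h : IsGlobalSmoothSolution u lm lp) (hm : mass u lm lp 0 = 2 / 3) {t : ℝ}
    (ht : 0 < t) : Profile (relHeight u lm lp t) (deriv (relHeight u lm lp t))
      (deriv (deriv (relHeight u lm lp t))) (deriv (deriv (deriv (relHeight u lm lp t)))) := by
  have b := h.bddDeriv_relHeight hm ht 3
  exact ⟨fun y hy => b.hasDerivAt hy, fun y hy => b.2.2.hasDerivAt hy,
    fun y hy => b.2.2.2.2.hasDerivAt hy, b.2.2.bddCont, b.2.2.2.2.bddCont, b.2.2.2.2.2.2,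
    h.tendsto_relHeight_left hm ht.le, h.tendsto_relHeight_right hm ht.le⟩

/-- Three applications of ∂_x = w ∂_y to u = `par` · w. Each step multiplies the y-derivative by w.
-/
theorem ldx_three_eq (h : IsGlobalSmoothSolution u lm lp) (hm : mass u lm lp 0 = 2 / 3) {t y : ℝ}
    (ht : 0 < t) (hy : y ∈ Ioo (-1 : ℝ) 1) {w w1 w2 w3 : ℝ → ℝ} (hw : w = relHeight u lm lp t)
    (p : Profile w w1 w2 w3) : ldx u lm lp 3 t y =
      (w y * w1 y ^ 3 + 4 * w y ^ 2 * w1 y * w2 y + w y ^ 3 * w3 y) * par y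
        - (7 * w y ^ 2 * w1 y ^ 2 + 4 * w y ^ 3 * w2 y) * y - 6 * w y ^ 3 * w1 y := by
  have step : ∀ (k : ℕ) {f f' : ℝ → ℝ}, EqOn (ldx u lm lp k t) f (Ioo (-1) 1) →
      (∀ y ∈ Ioo (-1 : ℝ) 1, HasDerivAt f (f' y) y) →
      EqOn (ldx u lm lp (k + 1) t) (fun y => w y * f' y) (Ioo (-1) 1) := by
    intro k f f' he hf y hy
    have d := h.hasDerivAt_ldx hm (k := k) ht.le (Or.inl ht) hy
    have ev : f =ᶠ[𝓝 y] ldx u lm lp k t := by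
      filter_upwards [isOpen_Ioo.mem_nhds hy] with z hz using (he hz).symm
    have e := (d.congr_of_eventuallyEq ev).unique (hf y hy)
    have := (h.relHeight_pos hm ht.le hy).ne'
    simp only [← e, hw]
    field_simp
  have e0 : EqOn (ldx u lm lp 0 t) (fun y => par y * w y) (Ioo (-1) 1) := fun y hy => by
    simp only [hw, ldx_zero_eq t hy]
  have e1 := step 0 e0 fun y hy => (hasDerivAt_par y).fun_mul (p.d0 y hy)
  have e2 := step 1 e1 fun y hy => (p.d0 y hy).fun_mul ((((hasDerivAt_neg y).fun_mul
    (p.d0 y hy))).fun_add ((hasDerivAt_par y).fun_mul (p.d1 y hy)))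
  have e3 := step 2 e2 fun y hy => by
    have dy := hasDerivAt_neg y
    have dp := hasDerivAt_par y
    have a := p.d0 y hy
    have b := p.d1 y hy
    have c := p.d2 y hy
    exact a.fun_mul ((b.fun_mul ((dy.fun_mul a).fun_add (dp.fun_mul b))).fun_add
      (a.fun_mul (((a.const_mul (-1)).fun_add (dy.fun_mul b)).fun_add
        ((dy.fun_mul b).fun_add (dp.fun_mul c)))))
  rw [e3 hy]
  ring

theorem integral_dissipation_relHeight_le (h : IsGlobalSmoothSolution u lm lp)
    (hm : mass u lm lp 0 = 2 / 3) {t : ℝ} (ht : 0 < t)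
    (hs : ∫ s in (-1 : ℝ)..1, deriv (relHeight u lm lp t) s ^ 2 ≤ (1 / 1000) ^ 2) :
    ∫ s in (-1 : ℝ)..1, deriv (deriv (relHeight u lm lp t)) s *
      (relHeight u lm lp t s * ldx u lm lp 4 t s) ≤
      -(1 / 16) * ∫ s in (-1 : ℝ)..1, deriv (relHeight u lm lp t) s ^ 2 := by
  have p := h.profile hm ht
  obtain ⟨c, hc, hle⟩ := h.exists_pos_le_relHeight hm t
  have i := (h.bddDeriv_relHeight hm ht 0).inv isOpen_Ioo hc (hle t ⟨ht.le, le_rfl⟩)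
  -- Since (u_xxx∘Z)_y = u_xxxx∘Z / w, the factor w u_xxxx is w² (u_xxx∘Z)_y, the form required
  -- there.
  refine le_trans (le_of_eq ?_) (p.integral_dissipation_le (q := ldx u lm lp 3 t)
    (fun y hy => h.ldx_three_eq hm ht hy rfl p)
    (fun y hy => h.hasDerivAt_ldx hm ht.le (Or.inl ht) hy)
    ((h.bddCont_ldx hm ht.le (Or.inl ht)).mul i.bddCont) hs)
  refine intervalIntegral.integral_congr_Ioo_of_le (by norm_num) fun y hy => ?_
  have := (h.relHeight_pos hm ht.le hy).ne'
  field_simp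

end IsGlobalSmoothSolution

/-! ### Evolution of the energy -/

namespace IsGlobalSmoothSolution

variable {u : ℝ → ℝ → ℝ} {lm lp : ℝ → ℝ}

theorem contDiffAt_relHeight (h : IsGlobalSmoothSolution u lm lp) (hm : mass u lm lp 0 = 2 / 3)
    {t y : ℝ} (ht : 0 < t) (hy : y ∈ Ioo (-1 : ℝ) 1) :
    ContDiffAt ℝ ∞ (fun p : ℝ × ℝ => relHeight u lm lp p.1 p.2) (t, y) := by
  have hin : (t, Z u lm lp t y) ∈ inn lm lp := ⟨ht, h.Z_mem_Ioo hm ht.le hy⟩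
  have c0 : ContDiffAt ℝ ∞ (fun p : ℝ × ℝ => dx u lm lp 0 p.1 p.2) (t, Z u lm lp t y) :=
    ((h.contDiffOn_dx 0).mono inn_subset_dom).contDiffAt (h.isOpen_inn.mem_nhds hin)
  have c1 : ContDiffAt ℝ ∞ (fun p : ℝ × ℝ => ldx u lm lp 0 p.1 p.2) (t, y) :=
    ContDiffAt.comp (t, y) (f := fun p : ℝ × ℝ => (p.1, Z u lm lp p.1 p.2)) c0
      (contDiffAt_fst.prodMk (h.contDiffAt_Z hm ht hy))
  have c2 : ContDiffAt ℝ ∞ (fun p : ℝ × ℝ => par p.2) (t, y) := by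
    unfold par; fun_prop
  refine (c1.fun_div c2 (par_pos hy).ne').congr_of_eventuallyEq ?_
  filter_upwards [(isOpen_univ.prod isOpen_Ioo).mem_nhds
    (show (t, y) ∈ univ ×ˢ Ioo (-1 : ℝ) 1 from ⟨mem_univ _, hy⟩)] with p hp
  exact relHeight_eq p.1 hp.2

/-- In u_t + u_x Z_t the transport contribution u_x u_xxx cancels the same term in u_t, leaving -u
u_xxxx; dividing by `par` gives the evolution of w. -/
theorem hasDerivAt_relHeight_time (h : IsGlobalSmoothSolution u lm lp)
    (hm : mass u lm lp 0 = 2 / 3) {t y : ℝ} (ht : 0 < t) (hy : y ∈ Ioo (-1 : ℝ) 1) :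
    HasDerivAt (fun t => relHeight u lm lp t y) (-(relHeight u lm lp t y * ldx u lm lp 4 t y)) t := by
  have hx := h.Z_mem_Ioo hm ht.le hy
  have D : HasDerivAt (fun s => ldx u lm lp 0 s y) _ t :=
    HasFDerivAt.comp_hasDerivAt (f := fun s => (s, Z u lm lp s y)) t
      (h.hasFDerivAt_dx 0 ht hx) ((hasDerivAt_id' t).prodMk (h.hasDerivAt_Z_time hm ht hy))
  have e : (fun t => relHeight u lm lp t y) = fun t => ldx u lm lp 0 t y / par y :=
    funext fun t => relHeight_eq t hy
  rw [e]
  refine (D.div_const (par y)).congr_deriv ?_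
  simp only [_root_.add_apply, _root_.smul_apply, ContinuousLinearMap.coe_fst',
    ContinuousLinearMap.coe_snd', smul_eq_mul, mul_one]
  rw [h.dtx_zero_inn ht hx, relHeight_eq t hy]
  simp only [ldx]
  ring

theorem hasDerivAt_flux (h : IsGlobalSmoothSolution u lm lp) (hm : mass u lm lp 0 = 2 / 3)
    {t y : ℝ} (ht : 0 < t) (hy : y ∈ Ioo (-1 : ℝ) 1) :
    HasDerivAt (fun y => relHeight u lm lp t y * ldx u lm lp 4 t y)
      (deriv (relHeight u lm lp t) y * ldx u lm lp 4 t y + ldx u lm lp 5 t y) y := by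
  refine ((h.hasDerivAt_relHeight hm ht.le hy).differentiableAt.hasDerivAt.fun_mul
    (h.hasDerivAt_ldx hm (k := 4) ht.le (Or.inl ht) hy)).congr_deriv ?_
  have := (h.relHeight_pos hm ht.le hy).ne'
  field_simp

/-- Joint smoothness in the interior allows ∂_t and ∂_y to be exchanged in w_t = -w u_xxxx. -/
theorem hasDerivAt_deriv_relHeight (h : IsGlobalSmoothSolution u lm lp)
    (hm : mass u lm lp 0 = 2 / 3) {t y : ℝ} (ht : 0 < t) (hy : y ∈ Ioo (-1 : ℝ) 1) :
    HasDerivAt (fun t => deriv (relHeight u lm lp t) y)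
      (-(deriv (relHeight u lm lp t) y * ldx u lm lp 4 t y + ldx u lm lp 5 t y)) t := by
  set F : ℝ × ℝ → ℝ := fun p => relHeight u lm lp p.1 p.2 with hF
  have hF2 : ContDiffAt ℝ 2 F (t, y) :=
    (h.contDiffAt_relHeight hm ht hy).of_le (WithTop.coe_le_coe.2 le_top)
  have hnh : Ioi (0 : ℝ) ×ˢ Ioo (-1 : ℝ) 1 ∈ 𝓝 (t, y) :=
    (isOpen_Ioi.prod isOpen_Ioo).mem_nhds ⟨ht, hy⟩
  have dF : ∀ p ∈ Ioi (0 : ℝ) ×ˢ Ioo (-1 : ℝ) 1, HasFDerivAt F (fderiv ℝ F p) p := fun p hp =>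
    ((h.contDiffAt_relHeight hm hp.1 hp.2).differentiableAt (by simp)).hasFDerivAt
  have e1 : ∀ p ∈ Ioi (0 : ℝ) ×ˢ Ioo (-1 : ℝ) 1,
      fderiv ℝ F p (0, 1) = deriv (relHeight u lm lp p.1) p.2 := fun p hp =>
    ((HasFDerivAt.comp_hasDerivAt (f := fun z => (p.1, z)) p.2 (dF p hp)
      ((hasDerivAt_const p.2 p.1).prodMk (hasDerivAt_id' p.2))).deriv).symm
  have e2 : ∀ p ∈ Ioi (0 : ℝ) ×ˢ Ioo (-1 : ℝ) 1,
      fderiv ℝ F p (1, 0) = -(relHeight u lm lp p.1 p.2 * ldx u lm lp 4 p.1 p.2) := fun p hp =>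
    (HasFDerivAt.comp_hasDerivAt (f := fun s => (s, p.2)) p.1 (dF p hp)
      ((hasDerivAt_id' p.1).prodMk (hasDerivAt_const p.1 p.2))).unique
      (h.hasDerivAt_relHeight_time hm hp.1 hp.2)
  have dd : ∀ v, HasFDerivAt (fun q => fderiv ℝ F q v)
      (fderiv ℝ (fun q => fderiv ℝ F q v) (t, y)) (t, y) := fun v =>
    (((hF2.fderiv_right (m := 1) (by norm_num)).clm_apply contDiffAt_const).differentiableAt
      (by norm_num)).hasFDerivAt
  have a := HasFDerivAt.comp_hasDerivAt (f := fun s => (s, y)) t (dd (0, 1))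
    ((hasDerivAt_id' t).prodMk (hasDerivAt_const t y))
  have b := HasFDerivAt.comp_hasDerivAt (f := fun z => (t, z)) y (dd (1, 0))
    ((hasDerivAt_const y t).prodMk (hasDerivAt_id' y))
  rw [fderiv_fderiv_comm hF2] at a
  have eva : (fun t => deriv (relHeight u lm lp t) y) =ᶠ[𝓝 t]
      (fun q => fderiv ℝ F q (0, 1)) ∘ fun s => (s, y) := by
    filter_upwards [Ioi_mem_nhds ht] with s hs using (e1 (s, y) ⟨hs, hy⟩).symm
  have evb : (fun y => -(relHeight u lm lp t y * ldx u lm lp 4 t y)) =ᶠ[𝓝 y]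
      (fun q => fderiv ℝ F q (1, 0)) ∘ fun z => (t, z) := by
    filter_upwards [isOpen_Ioo.mem_nhds hy] with z hz using (e2 (t, z) ⟨ht, hz⟩).symm
  rw [(b.congr_of_eventuallyEq evb).unique (h.hasDerivAt_flux hm ht hy).fun_neg] at a
  exact a.congr_of_eventuallyEq eva

theorem energy_eq (t : ℝ) : energy u lm lp t =
    1 / 2 * ∫ y in (-1 : ℝ)..1, deriv (relHeight u lm lp t) y ^ 2 := by
  simp only [energy, sq_abs]
  rfl

theorem bddCont_deriv_relHeight (h : IsGlobalSmoothSolution u lm lp) (hm : mass u lm lp 0 = 2 / 3)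
    {t : ℝ} (ht : 0 ≤ t) : BddCont (deriv (relHeight u lm lp t)) (Ioo (-1) 1) := by
  obtain ⟨C, hC⟩ := h.exists_bound_relHeight hm t
  refine ⟨?_, C, fun y hy => (hC t ⟨ht, le_rfl⟩ y hy).2⟩
  have c : ContinuousOn (relHeight u lm lp t) (Ioo (-1) 1) := fun y hy =>
    (h.hasDerivAt_relHeight hm ht hy).continuousAt.continuousWithinAt
  have e : ContinuousOn (fun y => (ldx u lm lp 1 t y * (relHeight u lm lp t y)⁻¹ +
      y * relHeight u lm lp t y) / par y) (Ioo (-1) 1) :=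
    (((h.bddCont_ldx hm ht (Or.inr one_le_two)).1.mul
      (c.inv₀ fun y hy => (h.relHeight_pos hm ht hy).ne')).add (continuousOn_id.mul c)).div
      continuous_par.continuousOn fun y hy => (par_pos hy).ne'
  exact e.congr fun y hy => (h.hasDerivAt_relHeight hm ht hy).deriv

theorem hasDerivAt_energy (h : IsGlobalSmoothSolution u lm lp) (hm : mass u lm lp 0 = 2 / 3)
    {t : ℝ} (ht : 0 < t) : HasDerivAt (energy u lm lp)
      (-∫ y in (-1 : ℝ)..1, deriv (relHeight u lm lp t) y *
        (deriv (relHeight u lm lp t) y * ldx u lm lp 4 t y + ldx u lm lp 5 t y)) t := by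
  have hle : (-1 : ℝ) ≤ 1 := by norm_num
  have hae : ∀ {P : ℝ → Prop}, (∀ y ∈ Ioo (-1 : ℝ) 1, P y) →
      ∀ᵐ y : ℝ, y ∈ uIoc (-1 : ℝ) 1 → P y := by
    intro P hP
    have hne : ∀ᵐ x : ℝ, x ≠ 1 := by simp [ae_iff]
    filter_upwards [hne] with y hy1 hy
    rw [uIoc_of_le hle] at hy
    exact hP y ⟨hy.1, lt_of_le_of_ne hy.2 hy1⟩
  have meas : ∀ {f : ℝ → ℝ}, BddCont f (Ioo (-1) 1) →
      AEStronglyMeasurable f (volume.restrict (uIoc (-1) 1)) := by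
    intro f hf
    rw [uIoc_of_le hle, Measure.restrict_congr_set Ioo_ae_eq_Ioc.symm]
    exact hf.1.aestronglyMeasurable measurableSet_Ioo
  -- On the time window [t/2, 2t] the bounds on w_y, u_xxxx and u_xxxxx give a constant dominating
  -- function.
  obtain ⟨C, hC⟩ := h.exists_bound_relHeight hm (2 * t)
  obtain ⟨K4, h4⟩ := h.exists_bound_dx_pos 4 (t₁ := t / 2) (t₂ := 2 * t) (by positivity)
  obtain ⟨K5, h5⟩ := h.exists_bound_dx_pos 5 (t₁ := t / 2) (t₂ := 2 * t) (by positivity)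
  have hpos : ∀ s ∈ Icc (t / 2) (2 * t), 0 < s := fun s hs => lt_of_lt_of_le (by positivity) hs.1
  have bt : BddCont (fun y => deriv (relHeight u lm lp t) y * ldx u lm lp 4 t y +
      ldx u lm lp 5 t y) (Ioo (-1) 1) :=
    ((h.bddCont_deriv_relHeight hm ht.le).mul (h.bddCont_ldx hm ht.le (Or.inl ht))).add
      (h.bddCont_ldx hm ht.le (Or.inl ht))
  have key := (intervalIntegral.hasDerivAt_integral_of_dominated_loc_of_deriv_le
    (μ := volume) (a := -1) (b := 1) (F := fun t y => deriv (relHeight u lm lp t) y ^ 2)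
    (F' := fun t y => 2 * (deriv (relHeight u lm lp t) y *
      (-(deriv (relHeight u lm lp t) y * ldx u lm lp 4 t y + ldx u lm lp 5 t y))))
    (bound := fun _ => 2 * (C * (C * K4 + K5)))
    (Icc_mem_nhds (show t / 2 < t by linarith) (show t < 2 * t by linarith)) ?_
    (((h.bddCont_deriv_relHeight hm ht.le).pow 2).intervalIntegrable hle)
    (meas ((BddCont.const 2).mul ((h.bddCont_deriv_relHeight hm ht.le).mul bt.neg)))
    (hae fun y hy s hs => ?_) intervalIntegrable_const (hae fun y hy s hs => ?_)).2
  · have e : energy u lm lp = fun t => 1 / 2 * ∫ y in (-1 : ℝ)..1,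
        deriv (relHeight u lm lp t) y ^ 2 := funext energy_eq
    rw [e]
    refine (key.const_mul (1 / 2)).congr_deriv ?_
    rw [intervalIntegral.integral_const_mul, ← intervalIntegral.integral_neg]
    simp only [mul_neg]
    ring
  · filter_upwards [Ioi_mem_nhds ht] with s hs
    exact meas ((h.bddCont_deriv_relHeight hm (le_of_lt hs)).pow 2)
  · have hs0 := hpos s hs
    have hZ := h.Z_mem hm hs0.le (Ioo_subset_Icc_self hy)
    have b1 := (hC s ⟨hs0.le, hs.2⟩ y hy).2
    have C0 : 0 ≤ C := (abs_nonneg _).trans b1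
    rw [Real.norm_eq_abs, abs_mul, abs_two, abs_mul, abs_neg]
    refine mul_le_mul_of_nonneg_left (mul_le_mul b1 ((abs_add_le _ _).trans (add_le_add ?_
      (h5 s hs _ hZ))) (abs_nonneg _) C0) two_pos.le
    rw [abs_mul]
    exact mul_le_mul b1 (h4 s hs _ hZ) (abs_nonneg _) C0
  · refine ((h.hasDerivAt_deriv_relHeight hm (hpos s hs) hy).fun_pow 2).congr_deriv ?_
    push_cast
    ring

/-- Integration by parts; the boundary term w_y w u_xxxx tends to zero because u_xxxx vanishes at
the contact points while w_y and w stay bounded. -/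
theorem integral_energy_eq (h : IsGlobalSmoothSolution u lm lp) (hm : mass u lm lp 0 = 2 / 3)
    {t : ℝ} (ht : 0 < t) :
    (-∫ y in (-1 : ℝ)..1, deriv (relHeight u lm lp t) y *
        (deriv (relHeight u lm lp t) y * ldx u lm lp 4 t y + ldx u lm lp 5 t y)) =
      ∫ s in (-1 : ℝ)..1, deriv (deriv (relHeight u lm lp t)) s *
      (relHeight u lm lp t s * ldx u lm lp 4 t s) := by
  have hle : (-1 : ℝ) ≤ 1 := by norm_num
  have p := h.profile hm ht
  have b4 := h.bddCont_ldx hm (k := 4) ht.le (Or.inl ht)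
  have b5 := h.bddCont_ldx hm (k := 5) ht.le (Or.inl ht)
  have i1 := p.b2.mul (p.bdd.mul b4)
  have i2 := p.b1.mul ((p.b1.mul b4).add b5)
  have lim : ∀ {l : Filter ℝ} , (∀ᶠ y in l, y ∈ Ioo (-1 : ℝ) 1) →
      Tendsto (ldx u lm lp 4 t) l (𝓝 0) →
      Tendsto (fun y => deriv (relHeight u lm lp t) y *
        (relHeight u lm lp t y * ldx u lm lp 4 t y)) l (𝓝 0) := by
    intro l hl h4
    obtain ⟨C, hC⟩ := (p.b1.mul p.bdd).2
    have t0 := h4.abs.const_mul C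
    rw [abs_zero, mul_zero] at t0
    refine squeeze_zero_norm' ?_ t0
    filter_upwards [hl] with y hy
    rw [Real.norm_eq_abs, ← mul_assoc, abs_mul]
    exact mul_le_mul_of_nonneg_right (hC y hy) (abs_nonneg _)
  have l1 := h.tendsto_ldx_left hm (k := 4) ht.le (Or.inl ht)
  have l2 := h.tendsto_ldx_right hm (k := 4) ht.le (Or.inl ht)
  rw [h.dx_four_left ht] at l1
  rw [h.dx_four_right ht] at l2
  have e := intervalIntegral.integral_eq_sub_of_hasDerivAt_of_tendsto
    (show (-1 : ℝ) < 1 by norm_num)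
    (fun y hy => (p.d1 y hy).fun_mul (h.hasDerivAt_flux hm ht hy))
    ((i1.add i2).intervalIntegrable hle)
    (lim (Ioo_mem_nhdsGT (by norm_num)) l1) (lim (Ioo_mem_nhdsLT (by norm_num)) l2)
  rw [intervalIntegral.integral_add (i1.intervalIntegrable hle) (i2.intervalIntegrable hle)] at e
  linarith

/-! ### Continuity and exponential decay of the energy -/

theorem continuousOn_ldx_time (h : IsGlobalSmoothSolution u lm lp) (hm : mass u lm lp 0 = 2 / 3)
    {k : ℕ} {y : ℝ} (hk : k ≤ 2) (hy : y ∈ Icc (-1 : ℝ) 1) :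
    ContinuousOn (fun t => ldx u lm lp k t y) (Ici 0) :=
  (h.dx_continuousOn k hk).comp (f := fun t => (t, Z u lm lp t y))
    (continuousOn_id.prodMk (h.continuousOn_Z_time hm hy)) fun _ ht => ⟨ht, h.Z_mem hm ht hy⟩

/-- Dominated convergence: w_y converges pointwise through its formula in u, u_x and w, and is
bounded uniformly on compact time intervals containing 0. -/
theorem continuousOn_energy (h : IsGlobalSmoothSolution u lm lp) (hm : mass u lm lp 0 = 2 / 3) :
    ContinuousOn (energy u lm lp) (Ici 0) := by
  have hle : (-1 : ℝ) ≤ 1 := by norm_num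
  have e : energy u lm lp = fun t => 1 / 2 * ∫ y in (-1 : ℝ)..1,
      deriv (relHeight u lm lp t) y ^ 2 := funext energy_eq
  rw [e]
  refine continuousOn_const.mul fun t ht => ?_
  have ht : 0 ≤ t := ht
  have hae : ∀ {P : ℝ → Prop}, (∀ y ∈ Ioo (-1 : ℝ) 1, P y) →
      ∀ᵐ y : ℝ, y ∈ uIoc (-1 : ℝ) 1 → P y := by
    intro P hP
    have hne : ∀ᵐ x : ℝ, x ≠ 1 := by simp [ae_iff]
    filter_upwards [hne] with y hy1 hy
    rw [uIoc_of_le hle] at hy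
    exact hP y ⟨hy.1, lt_of_le_of_ne hy.2 hy1⟩
  obtain ⟨C, hC⟩ := h.exists_bound_relHeight hm (t + 1)
  refine intervalIntegral.continuousWithinAt_of_dominated_interval (bound := fun _ => C ^ 2) ?_ ?_
    intervalIntegrable_const (hae fun y hy => ?_)
  · filter_upwards [self_mem_nhdsWithin] with s hs
    rw [uIoc_of_le hle, Measure.restrict_congr_set Ioo_ae_eq_Ioc.symm]
    exact ((h.bddCont_deriv_relHeight hm hs).pow 2).1.aestronglyMeasurable measurableSet_Ioo
  · filter_upwards [self_mem_nhdsWithin, mem_nhdsWithin_of_mem_nhds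
      (Iio_mem_nhds (show t < t + 1 by linarith))] with s hs hs'
    refine hae fun y hy => ?_
    rw [Real.norm_eq_abs, abs_pow]
    exact pow_le_pow_left₀ (abs_nonneg _) (hC s ⟨hs, le_of_lt hs'⟩ y hy).2 2
  · have hy' := Ioo_subset_Icc_self hy
    have cw : ContinuousOn (fun t => relHeight u lm lp t y) (Ici 0) := by
      have : (fun t => relHeight u lm lp t y) = fun t => ldx u lm lp 0 t y / par y :=
        funext fun t => relHeight_eq t hy
      rw [this]
      exact (h.continuousOn_ldx_time hm (by norm_num) hy').div_const _
    have c : ContinuousOn (fun t => (ldx u lm lp 1 t y * (relHeight u lm lp t y)⁻¹ +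
        y * relHeight u lm lp t y) / par y) (Ici 0) :=
      (((h.continuousOn_ldx_time hm one_le_two hy').mul (cw.inv₀ fun t ht =>
        (h.relHeight_pos hm ht hy).ne')).add (continuousOn_const.mul cw)).div_const _
    exact ((c.congr fun t ht => (h.hasDerivAt_relHeight hm ht hy).deriv).pow 2) t ht

theorem energy_nonneg (t : ℝ) : 0 ≤ energy u lm lp t := by
  rw [energy_eq]
  exact mul_nonneg (by norm_num) (intervalIntegral.integral_nonneg (by norm_num)
    fun _ _ => sq_nonneg _)

/-- As ∫ w_y² = 2E, the threshold 10⁻⁶ for the integral becomes 1/2000000 for E, and the rate 1/16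
becomes 1/8. -/
theorem deriv_energy_le (h : IsGlobalSmoothSolution u lm lp) (hm : mass u lm lp 0 = 2 / 3)
    {t : ℝ} (ht : 0 < t) (hE : energy u lm lp t ≤ 1 / 2000000) :
    deriv (energy u lm lp) t ≤ -(1 / 8) * energy u lm lp t := by
  rw [(h.hasDerivAt_energy hm ht).deriv, h.integral_energy_eq hm ht]
  rw [energy_eq] at hE ⊢
  have := h.integral_dissipation_relHeight_le hm ht (by linarith)
  linarith

/-- Barrier argument: at a level c₁ strictly between E(0) and the threshold the dissipation
inequality applies and makes E' negative, so E cannot cross c₁. -/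
theorem energy_lt (h : IsGlobalSmoothSolution u lm lp) (hm : mass u lm lp 0 = 2 / 3)
    (hE : energy u lm lp 0 < 1 / 2000000) {t : ℝ} (ht : 0 ≤ t) :
    energy u lm lp t < 1 / 2000000 := by
  have c := h.continuousOn_energy hm
  obtain ⟨c₁, h1, h2⟩ := exists_between hE
  have c1pos : 0 < c₁ := (energy_nonneg 0).trans_lt h1
  -- E is differentiated only at positive times, so the barrier starts at some ε > 0; continuity at
  -- 0 bridges the gap.
  obtain ⟨ε, hε, hlt⟩ : ∃ ε > 0, ∀ s ∈ Icc 0 ε, energy u lm lp s < c₁ := by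
    have := (c 0 (by simp)).eventually_lt_const h1
    rw [← nhdsWithin_Icc_eq_nhdsGE (show (0 : ℝ) < 1 by norm_num)] at this
    obtain ⟨δ, hδ, hb⟩ := Metric.mem_nhdsWithin_iff.1 this
    refine ⟨min (δ / 2) 1, lt_min (by positivity) one_pos, fun s hs => hb ⟨?_, ?_⟩⟩
    · have := hs.2.trans (min_le_left _ _)
      rw [Metric.mem_ball, Real.dist_eq, sub_zero, abs_of_nonneg hs.1]
      linarith
    · exact ⟨hs.1, hs.2.trans (min_le_right _ _)⟩
  rcases le_or_gt t ε with h0 | h0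
  · exact (hlt t ⟨ht, h0⟩).trans h2
  · refine lt_of_le_of_lt ?_ h2
    refine image_le_of_deriv_right_lt_deriv_boundary' (a := ε) (b := t) (B := fun _ => c₁)
      (B' := fun _ => 0) (f' := deriv (energy u lm lp))
      (c.mono fun s hs => hε.le.trans hs.1)
      (fun s hs => ?_) (hlt ε ⟨hε.le, le_rfl⟩).le continuousOn_const
      (fun s _ => hasDerivWithinAt_const s _ c₁) (fun s hs he => ?_) ⟨h0.le, le_rfl⟩
    · exact (h.hasDerivAt_energy hm (hε.trans_le hs.1)).differentiableAt.hasDerivAt.hasDerivWithinAt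
    · have := h.deriv_energy_le hm (hε.trans_le hs.1) (by rw [he]; exact h2.le)
      rw [he] at this
      linarith

theorem energy_le_exp (h : IsGlobalSmoothSolution u lm lp) (hm : mass u lm lp 0 = 2 / 3)
    (hE : energy u lm lp 0 < 1 / 2000000) {t : ℝ} (ht : 0 ≤ t) :
    energy u lm lp t ≤ energy u lm lp 0 * Real.exp (-(1 / 8) * t) := by
  have anti : AntitoneOn (fun t => energy u lm lp t * Real.exp (1 / 8 * t)) (Ici 0) := by
    have dexp : ∀ t : ℝ, HasDerivAt (fun t => Real.exp (1 / 8 * t))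
        (Real.exp (1 / 8 * t) * (1 / 8)) t := fun t =>
      ((hasDerivAt_id' t).const_mul (1 / 8)).exp.congr_deriv (by ring)
    have D : ∀ t, 0 < t → HasDerivAt (fun t => energy u lm lp t * Real.exp (1 / 8 * t))
        (deriv (energy u lm lp) t * Real.exp (1 / 8 * t) +
          energy u lm lp t * (Real.exp (1 / 8 * t) * (1 / 8))) t := fun t ht =>
      (h.hasDerivAt_energy hm ht).differentiableAt.hasDerivAt.fun_mul (dexp t)
    refine antitoneOn_of_deriv_nonpos (convex_Ici 0) ((h.continuousOn_energy hm).mul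
      (by fun_prop)) (fun t ht => ?_) fun t ht => ?_
    · rw [interior_Ici] at ht
      exact (D t ht).differentiableAt.differentiableWithinAt
    · rw [interior_Ici] at ht
      have ht : 0 < t := ht
      rw [(D t ht).deriv]
      have := h.deriv_energy_le hm ht (h.energy_lt hm hE ht.le).le
      nlinarith [Real.exp_pos (1 / 8 * t)]
  have := anti (by simp) (show t ∈ Ici 0 from ht) ht
  simp only [mul_zero, Real.exp_zero, mul_one] at this
  calc energy u lm lp t = energy u lm lp t * Real.exp (1 / 8 * t) * Real.exp (-(1 / 8) * t) := by
        rw [mul_assoc, ← Real.exp_add]; simp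
    _ ≤ _ := mul_le_mul_of_nonneg_right this (Real.exp_pos _).le

/-! ### The contact points -/

/-- The substitution x = Z(y), under which u dx = `par` dy. -/
theorem centerOfMass_eq_integral_Z (h : IsGlobalSmoothSolution u lm lp)
    (hm : mass u lm lp 0 = 2 / 3) {t : ℝ} (ht : 0 ≤ t) :
    centerOfMass u lm lp t = ∫ y in (-1 : ℝ)..1, Z u lm lp t y * par y := by
  have cu := h.continuousOn_height ht
  have cxu : ContinuousOn (fun x => x * u t x) (Icc (lm t) (lp t)) := continuousOn_id.mul cu
  have hle := (h.lt t ht).le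
  have cF : ContinuousOn (fun x => ∫ z in (lm t)..x, z * u t z) (Icc (lm t) (lp t)) := by
    have := intervalIntegral.continuousOn_primitive_interval' (a := lm t)
      (ContinuousOn.intervalIntegrable_of_Icc (μ := volume) hle cxu) left_mem_uIcc
    rwa [uIcc_of_le hle] at this
  have dF : ∀ x ∈ Ioo (lm t) (lp t),
      HasDerivAt (fun x => ∫ z in (lm t)..x, z * u t z) (x * u t x) x := fun x hx =>
    intervalIntegral.integral_hasDerivAt_right
      (ContinuousOn.intervalIntegrable_of_Icc hx.1.le (cxu.mono (Icc_subset_Icc_right hx.2.le)))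
      ((cxu.mono Ioo_subset_Icc_self).stronglyMeasurableAtFilter isOpen_Ioo x hx)
      (cxu.continuousAt (Icc_mem_nhds hx.1 hx.2))
  have cZ := h.continuousOn_Z hm ht
  have e := intervalIntegral.integral_eq_sub_of_hasDerivAt_of_le
    (f := fun y => ∫ z in (lm t)..(Z u lm lp t y), z * u t z)
    (f' := fun y => Z u lm lp t y * par y) (show (-1 : ℝ) ≤ 1 by norm_num)
    (cF.comp cZ fun y hy => h.Z_mem hm ht hy)
    (fun y hy => by
      have hx := h.Z_mem_Ioo hm ht hy
      refine ((dF _ hx).comp y (h.hasDerivAt_Z hm ht hy)).congr_deriv ?_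
      have := (h.pos t ht _ hx).ne'
      field_simp)
    (ContinuousOn.intervalIntegrable_of_Icc (by norm_num)
      (cZ.mul continuous_par.continuousOn))
  simp only [h.Z_left hm ht, h.Z_right hm ht, intervalIntegral.integral_same, sub_zero] at e
  exact e.symm

/-- Z_y = 1/w differs from 1 by at most 2m, since |w - 1| ≤ m and w ≥ 1/2; the mean value theorem
over a length of at most 2 gives 4m. -/
theorem abs_Z_sub_le (h : IsGlobalSmoothSolution u lm lp) (hm : mass u lm lp 0 = 2 / 3) {t m : ℝ}
    (ht : 0 < t) (hm0 : 0 ≤ m) (hm1 : m ≤ 1 / 1000) (hE : 2 * energy u lm lp t ≤ m ^ 2) {y : ℝ}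
    (hy : y ∈ Icc (-1 : ℝ) 1) : |Z u lm lp t y - lm t - (y + 1)| ≤ 4 * m := by
  rcases hy.1.eq_or_lt with rfl | hy1
  · rw [h.Z_left hm ht.le]
    simpa using hm0
  have p := h.profile hm ht
  have hw : ∀ z ∈ Ioo (-1 : ℝ) 1, |(relHeight u lm lp t z)⁻¹ - 1| ≤ 2 * m := by
    intro z hz
    have s := p.sq_sub_one_le hz
    rw [energy_eq] at hE
    have a : |relHeight u lm lp t z - 1| ≤ m := by
      refine abs_le_of_sq_le_sq ?_ hm0
      have := intervalIntegral.integral_nonneg (μ := volume)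
        (f := fun y => deriv (relHeight u lm lp t) y ^ 2) (show (-1 : ℝ) ≤ 1 by norm_num) fun _ _ => sq_nonneg _
      nlinarith [mul_le_mul_of_nonneg_right (par_le z) this]
    have wp := h.relHeight_pos hm ht.le hz
    have w2 : 1 / 2 ≤ relHeight u lm lp t z := by linarith [(abs_le.1 a).1]
    have e : (relHeight u lm lp t z)⁻¹ - 1 =
        -((relHeight u lm lp t z)⁻¹ * (relHeight u lm lp t z - 1)) := by
      field_simp; ring
    rw [e, abs_neg, abs_mul, abs_of_pos (inv_pos.2 wp)]
    refine mul_le_mul ?_ a (abs_nonneg _) two_pos.le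
    rw [inv_le_comm₀ wp two_pos]
    linarith
  obtain ⟨c, hc, he⟩ := exists_hasDerivAt_eq_slope (fun y => Z u lm lp t y - y)
    (fun y => (relHeight u lm lp t y)⁻¹ - 1) hy1
    (((h.continuousOn_Z hm ht.le).mono (Icc_subset_Icc_right hy.2)).sub continuousOn_id)
    fun z hz => (h.hasDerivAt_Z_relHeight hm ht.le ⟨hz.1, hz.2.trans_le hy.2⟩).fun_sub
      (hasDerivAt_id' z)
  rw [eq_div_iff (by linarith), h.Z_left hm ht.le] at he
  have e : Z u lm lp t y - lm t - (y + 1) = ((relHeight u lm lp t c)⁻¹ - 1) * (y - -1) := by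
    rw [he]; ring
  rw [e, abs_mul, abs_of_pos (show 0 < y - -1 by linarith)]
  have := hw c ⟨hc.1, hc.2.trans_le hy.2⟩
  nlinarith [hy.2]

/-- The length is read off at y = 1. For the position, replace Z by lm + 1 + y in 0 = ∫ Z `par`: the
odd part drops out, leaving (2/3)(lm + 1) plus an error of at most 4m, whence 6m. -/
theorem abs_contact_le (h : IsGlobalSmoothSolution u lm lp) (hm : mass u lm lp 0 = 2 / 3)
    (hcom : centerOfMass u lm lp 0 = 0) {t m : ℝ} (ht : 0 < t) (hm0 : 0 ≤ m) (hm1 : m ≤ 1 / 1000)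
    (hE : 2 * energy u lm lp t ≤ m ^ 2) :
    |lp t - lm t - 2| ≤ 4 * m ∧ |lm t + 1| ≤ 6 * m := by
  have hle : (-1 : ℝ) ≤ 1 := by norm_num
  have r := fun y hy => h.abs_Z_sub_le hm ht hm0 hm1 hE (y := y) hy
  constructor
  · have := r 1 (by norm_num)
    rw [h.Z_right hm ht.le] at this
    convert this using 2
    ring
  · have e := h.centerOfMass_eq_integral_Z hm ht.le
    rw [h.centerOfMass_eq ht.le, hcom] at e
    have cZ := h.continuousOn_Z hm ht.le
    have cr : ContinuousOn (fun y => (Z u lm lp t y - lm t - (y + 1)) * par y) (Icc (-1) 1) :=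
      ((cZ.sub continuousOn_const).sub (by fun_prop)).mul continuous_par.continuousOn
    have cl : Continuous fun y => (lm t + 1 + y) * par y :=
      (by fun_prop : Continuous fun y => lm t + 1 + y).mul continuous_par
    have split : ∫ y in (-1 : ℝ)..1, Z u lm lp t y * par y =
        (∫ y in (-1 : ℝ)..1, (Z u lm lp t y - lm t - (y + 1)) * par y) +
          ∫ y in (-1 : ℝ)..1, (lm t + 1 + y) * par y := by
      rw [← intervalIntegral.integral_add (ContinuousOn.intervalIntegrable_of_Icc hle cr)
        (cl.intervalIntegrable _ _)]
      congr 1; ext y; ring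
    have lin : ∫ y in (-1 : ℝ)..1, (lm t + 1 + y) * par y = 2 / 3 * (lm t + 1) := by
      have d : ∀ y : ℝ, HasDerivAt (fun y : ℝ => (lm t + 1) * (y - y ^ 3 / 3) / 2 +
          (y ^ 2 / 2 - y ^ 4 / 4) / 2) ((lm t + 1 + y) * par y) y := fun y => by
        have di := hasDerivAt_id' y
        refine ((((di.fun_sub ((di.fun_pow 3).div_const 3)).const_mul (lm t + 1)).div_const 2).fun_add
          ((((di.fun_pow 2).div_const 2).fun_sub ((di.fun_pow 4).div_const 4)).div_const
            2)).congr_deriv ?_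
        unfold par
        push_cast
        ring
      rw [intervalIntegral.integral_eq_sub_of_hasDerivAt (fun y _ => d y)
        (cl.intervalIntegrable _ _)]
      ring
    have small := intervalIntegral.norm_integral_le_of_norm_le_const (a := -1) (b := 1) (C := 2 * m)
      (f := fun y => (Z u lm lp t y - lm t - (y + 1)) * par y) (fun y hy => by
        rw [uIoc_of_le hle] at hy
        have hy' : y ∈ Icc (-1 : ℝ) 1 := ⟨hy.1.le, hy.2⟩
        have pp : 0 ≤ par y := by unfold par; nlinarith [hy'.1, hy'.2]
        rw [Real.norm_eq_abs, abs_mul, abs_of_nonneg pp]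
        have := mul_le_mul (r y hy') (par_le y) pp (by positivity)
        linarith)
    rw [Real.norm_eq_abs] at small
    norm_num at small
    rw [split, lin] at e
    have := abs_le.1 small
    rw [abs_le]
    constructor <;> linarith [this.1, this.2]

end IsGlobalSmoothSolution

end ThinFilm

end

theorem corollary1p4 :
    ∃ c₀ : ℝ, 0 < c₀ ∧ ∃ γ : ℝ, 0 < γ ∧ ∃ C : ℝ, 0 < C ∧ ∃ T : ℝ, 0 ≤ T ∧
      ∀ (u : ℝ → ℝ → ℝ) (lm lp : ℝ → ℝ),
        ThinFilm.IsGlobalSmoothSolution u lm lp →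
        ThinFilm.mass u lm lp 0 = 2 / 3 →
        ThinFilm.centerOfMass u lm lp 0 = 0 →
        ThinFilm.energy u lm lp 0 < c₀ →
        (∀ t : ℝ, 0 ≤ t →
          ThinFilm.energy u lm lp t ≤ ThinFilm.energy u lm lp 0 * Real.exp (-γ * t)) ∧
        (∀ t : ℝ, T ≤ t →
          |lp t - lm t - 2| ≤ C * Real.exp (-(γ / 2) * t) ∧
          |lp t + lm t| ≤ C * Real.exp (-(γ / 2) * t) ∧
          |lp t - 1| + |lm t + 1| ≤ C * Real.exp (-(γ / 2) * t)) := by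
  -- T = 1 serves only to make t positive. With m = e^(-t/16)/1000 one has 2E ≤ 10⁻⁶ e^(-t/8) = m²,
  -- and 4m + 6m + 6m = 16m is well below the bound with C = 1.
  refine ⟨1 / 2000000, by norm_num, 1 / 8, by norm_num, 1, one_pos, 1, zero_le_one,
    fun u lm lp h hm hcom hE => ⟨fun t ht => h.energy_le_exp hm hE ht, fun t ht => ?_⟩⟩
  have ht0 : 0 < t := one_pos.trans_le ht
  have hexp := Real.exp_pos (-(1 / 8 / 2) * t)
  have hexp1 : Real.exp (-(1 / 8 / 2) * t) ≤ 1 := Real.exp_le_one_iff.2 (by linarith)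
  have hsq : Real.exp (-(1 / 8 / 2) * t) ^ 2 = Real.exp (-(1 / 8) * t) := by
    rw [← Real.exp_nat_mul]
    congr 1
    push_cast
    ring
  obtain ⟨h1, h2⟩ := h.abs_contact_le hm hcom ht0
    (m := 1 / 1000 * Real.exp (-(1 / 8 / 2) * t)) (by positivity) (by linarith) (by
      rw [mul_pow, hsq]
      have := h.energy_le_exp hm hE ht0.le
      nlinarith [Real.exp_pos (-(1 / 8) * t)])
  have h3 : |lp t - 1| ≤ |lp t - lm t - 2| + |lm t + 1| := by
    rw [show lp t - 1 = (lp t - lm t - 2) + (lm t + 1) by ring]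
    exact abs_add_le _ _
  have h4 : |lp t + lm t| ≤ |lp t - 1| + |lm t + 1| := by
    rw [show lp t + lm t = (lp t - 1) + (lm t + 1) by ring]
    exact abs_add_le _ _
  refine ⟨?_, ?_, ?_⟩ <;> linarith
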